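/- **Conventions.** Two reduced plane curve germs $g,h\in\mathbb C[[x,y]]$ have the same (topological) singularity type, i.e. are equisingular, if there is a bijection between their branches preserving the value semigroup of each branch and the pairwise intersection multiplicities of the branches. For $f=\sum a_{ij}x^iy^j$ the segments of the Newton diagram are the compact edges of the convex hull of $\{(i,j): a_{ij}\ne0\}+\mathbb R_{\ge0}^2$; the slope $\tan\alpha$ of the segment from $(a,b)$ to $(c,e)$, with $a<c$ and $b>e$, is $\frac{b-e}{c-a}$. The polynomial $f$ is Newton-non-degenerate if its truncation to every segment of its Newton diagram has no singular point in $(\mathbb C^*)^2$. Let $f\in\mathbb C[x,y]$ be a Newton-non-degenerate polynomial (a normal form) whose germ at the origin is reduced and singular, i.e. $f$ has order at least $2$ there. A germ $h$ is in *preliminary form* (with respect to $f$) if it has the singularity type of $f$ and the line through each segment of the Newton diagram of $f$ is a supporting line of the Newton diagram of $h$: no monomial of $h$ lies below that line and some monomial of $h$ lies on it. The *equisingular stratum* $\Sigma_d(f)$ is the set of plane projective curves of degree $d$ which have at some point a singularity of the type of $f$. It is *linear* if for every curve in $\Sigma_d(f)$ and every point at which it has the type of $f$, there is a projective transformation bringing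 that point to $(1:0:0)$ and the germ of the curve there, in the affine coordinates $x_1/x_0,\,x_2/x_0$, to preliminary form. **Statement.** For every such $f$ there is $d_0$ such that for all $d\ge d_0$ the following are equivalent: 1. the stratum $\Sigma_d(f)$ is linear; 2. every segment of the Newton diagram of $f$ has slope $\frac12\le\tan\alpha\le2$; 3. every germ $g\in\mathbb C[[x,y]]$ of the type of $f$ can be brought to preliminary form by a linear change of the coordinates $x,y$. -/

import Mathlib

/-- The ring `ℂ⟦x, y⟧` of germs at the origin of the plane; `x = X 0`, `y = X 1`. -/
abbrev GermRing : Type := MvPowerSeries (Fin 2) ℂ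

/-! ### Equisingularity (topological type) of plane curve germs -/

/-- The local intersection multiplicity of the subschemes cut out by two ideals of `ℂ⟦x, y⟧`:
the length of `ℂ⟦x, y⟧ / (P + Q)`, which is its dimension over the residue field `ℂ`
(and `⊤` if that is infinite). -/
noncomputable def intersectionMultiplicity (P Q : Ideal GermRing) : ℕ∞ :=
  Module.length GermRing (GermRing ⧸ (P ⊔ Q))

/-- The branches of the curve germ `g = 0`: the irreducible factors of `g`, each taken up to
units, that is, as the principal ideal that it generates. -/
def branches (g : GermRing) : Set (Ideal GermRing) :=
  {P | ∃ b : GermRing, Irreducible b ∧ b ∣ g ∧ P = Ideal.span {b}}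

/-- The value semigroup of a branch: all finite intersection multiplicities of the branch with
curve germs `h = 0`. -/
def valueSemigroup (P : Ideal GermRing) : Set ℕ :=
  {n | ∃ h : GermRing, intersectionMultiplicity P (Ideal.span {h}) = n}

/-- Two reduced plane curve germs are equisingular (have the same topological type): there is a
bijection between their branches which preserves the type of each branch (its value semigroup,
equivalently its Puiseux characteristic, equivalently the multiplicities of its infinitely near
points) and the mutual intersection multiplicities of the branches. -/
def Equisingular (g h : GermRing) : Prop :=
  Squarefree g ∧ Squarefree h ∧
    ∃ σ : branches g ≃ branches h,
      (∀ P : branches g, valueSemigroup (P : Ideal GermRing) = valueSemigroup (σ P : Ideal GermRing)) ∧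
      (∀ P Q : branches g, P ≠ Q →
        intersectionMultiplicity (P : Ideal GermRing) (Q : Ideal GermRing) =
          intersectionMultiplicity (σ P : Ideal GermRing) (σ Q : Ideal GermRing))

/-! ### The Newton diagram -/

/-- The weights of `x` and `y` for which the two end points `p`, `q` (with `p` upper left of `q`)
have the same weighted degree: the level sets of `Finsupp.weight (segmentWeight p q)` are the
parallels of the line through `p` and `q`. -/
def segmentWeight (p q : Fin 2 →₀ ℕ) : Fin 2 → ℕ := ![p 1 - q 1, q 0 - p 0]

/-- `p`, `q` are the upper left and the lower right end point of a segment of the Newton diagram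
of `f`, i.e. of a compact edge of the convex hull of `supp f + ℝ²_{≥ 0}`: all exponents of `f`
lie on or above the line through `p` and `q`, and those on the line lie between `p` and `q`. -/
def IsNewtonSegment (f : MvPolynomial (Fin 2) ℂ) (p q : Fin 2 →₀ ℕ) : Prop :=
  p ∈ f.support ∧ q ∈ f.support ∧ p 0 < q 0 ∧ q 1 < p 1 ∧
    ∀ m ∈ f.support,
      Finsupp.weight (segmentWeight p q) p ≤ Finsupp.weight (segmentWeight p q) m ∧
      (Finsupp.weight (segmentWeight p q) m = Finsupp.weight (segmentWeight p q) p →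
        p 0 ≤ m 0 ∧ m 0 ≤ q 0)

/-- The slope `tan α` (in absolute value) of the segment with end points `p`, `q`. -/
noncomputable def segmentSlope (p q : Fin 2 →₀ ℕ) : ℝ :=
  ((p 1 : ℝ) - (q 1 : ℝ)) / ((q 0 : ℝ) - (p 0 : ℝ))

/-- The truncation of `f` to the segment with end points `p`, `q`. -/
noncomputable def segmentTruncation (f : MvPolynomial (Fin 2) ℂ) (p q : Fin 2 →₀ ℕ) :
    MvPolynomial (Fin 2) ℂ :=
  MvPolynomial.weightedHomogeneousComponent (segmentWeight p q)
    (Finsupp.weight (segmentWeight p q) p) f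

/-- `f` is Newton-non-degenerate: the truncation of `f` to any segment of its Newton diagram
has no singular point in the torus `(ℂ^*)²`. -/
def NewtonNondegenerate (f : MvPolynomial (Fin 2) ℂ) : Prop :=
  ∀ p q, IsNewtonSegment f p q →
    ¬ ∃ z : Fin 2 → ℂ, z 0 ≠ 0 ∧ z 1 ≠ 0 ∧
      MvPolynomial.eval z (segmentTruncation f p q) = 0 ∧
      ∀ i, MvPolynomial.eval z (MvPolynomial.pderiv i (segmentTruncation f p q)) = 0

/-- `f` is the normal form of a Newton-non-degenerate type of isolated curve singularities at the
origin: the germ of `f` is reduced and singular, and `f` is Newton-non-degenerate. -/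
structure IsNewtonNondegenerateNormalForm (f : MvPolynomial (Fin 2) ℂ) : Prop where
  reduced : Squarefree (f : GermRing)
  singular : ∀ m ∈ f.support, 2 ≤ m 0 + m 1
  nondegenerate : NewtonNondegenerate f

/-- The germ `h` is in preliminary form with respect to the normal form `f`: it has the
singularity type of `f`, and the Newton diagrams agree in the sense that the line through any
segment of the diagram of `f` supports the diagram of `h`, i.e. no monomial of `h` lies below
that line and some monomial of `h` lies on it. -/
def IsPreliminaryForm (f : MvPolynomial (Fin 2) ℂ) (h : GermRing) : Prop :=
  Equisingular h (f : GermRing) ∧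
    ∀ p q, IsNewtonSegment f p q →
      (∀ m, MvPowerSeries.coeff m h ≠ 0 →
        Finsupp.weight (segmentWeight p q) p ≤ Finsupp.weight (segmentWeight p q) m) ∧
      (∃ m, MvPowerSeries.coeff m h ≠ 0 ∧
        Finsupp.weight (segmentWeight p q) m = Finsupp.weight (segmentWeight p q) p)

/-! ### Equisingular strata of projective plane curves -/

/-- The form `F ∘ M`, for a projective coordinate change `M`. -/
noncomputable def projectiveChange (M : GL (Fin 3) ℂ) (F : MvPolynomial (Fin 3) ℂ) :
    MvPolynomial (Fin 3) ℂ :=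
  MvPolynomial.aeval
    (fun i => ∑ j, MvPolynomial.C ((M : Matrix (Fin 3) (Fin 3) ℂ) i j) * MvPolynomial.X j) F

/-- The germ at the point `(1 : 0 : 0)` of the curve `F = 0`, in the affine coordinates
`x = x₁ / x₀`, `y = x₂ / x₀`. -/
noncomputable def germAtOrigin (F : MvPolynomial (Fin 3) ℂ) : GermRing :=
  ((MvPolynomial.aeval ![1, MvPolynomial.X 0, MvPolynomial.X 1] F :
    MvPolynomial (Fin 2) ℂ) : GermRing)

/-- `M` is a projective coordinate system centred at the point with homogeneous coordinates
`v`: it takes `(1 : 0 : 0)` to that point. -/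
def IsCentredAt (M : GL (Fin 3) ℂ) (v : Fin 3 → ℂ) : Prop :=
  (M : Matrix (Fin 3) (Fin 3) ℂ).mulVec ![1, 0, 0] = v

/-- The curve `F = 0` has at the point with homogeneous coordinates `v` a singularity of the
type of `f`. -/
def HasSingularityTypeAt (f : MvPolynomial (Fin 2) ℂ) (F : MvPolynomial (Fin 3) ℂ)
    (v : Fin 3 → ℂ) : Prop :=
  ∃ M : GL (Fin 3) ℂ, IsCentredAt M v ∧
    Equisingular (germAtOrigin (projectiveChange M F)) (f : GermRing)

/-- The equisingular stratum of the type of `f` in the space of plane curves of degree `d`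
(a curve is given by a nonzero form of degree `d`, unique up to a scalar). -/
def equisingularStratum (d : ℕ) (f : MvPolynomial (Fin 2) ℂ) : Set (MvPolynomial (Fin 3) ℂ) :=
  {F | F.IsHomogeneous d ∧ F ≠ 0 ∧ ∃ v, HasSingularityTypeAt f F v}

/-- The equisingular stratum of the type of `f` in degree `d` is linear: its curves can be brought
to preliminary form, at each point where they have that type, by projective transformations. -/
def IsLinearStratum (d : ℕ) (f : MvPolynomial (Fin 2) ℂ) : Prop :=
  ∀ F ∈ equisingularStratum d f, ∀ v, HasSingularityTypeAt f F v →
    ∃ M : GL (Fin 3) ℂ, IsCentredAt M v ∧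
      IsPreliminaryForm f (germAtOrigin (projectiveChange M F))

/-- The germ `g ∘ A`, for a linear coordinate change `A`. -/
noncomputable def linearChange (A : GL (Fin 2) ℂ) (g : GermRing) : GermRing :=
  MvPowerSeries.subst
    (fun i => (∑ j, MvPowerSeries.C ((A : Matrix (Fin 2) (Fin 2) ℂ) i j) * MvPowerSeries.X j :
      GermRing)) g

/-- Every germ with the type of `f` can be brought to preliminary form by a linear change of the
local coordinates. -/
def IsLinearSingularity (f : MvPolynomial (Fin 2) ℂ) : Prop :=
  ∀ g : GermRing, Equisingular g (f : GermRing) →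
    ∃ A : GL (Fin 2) ℂ, IsPreliminaryForm f (linearChange A g)

/-! Write (b·c) for the intersection multiplicity `contact b c`. Slopes in [1/2, 2] suffice. A
branch b of multiplicity m has a single tangent and its Newton diagram is bounded by one segment, so
for a weight with w₀ ≥ w₁ its weighted order is min(m w₀, (b·x) w₁)
(`IsTangentBranch.weightedOrder_eq`). If moreover w₀ ≤ 2w₁, then (b·x) matters only up to 2m. This
truncated number is topological once the position of the tangent is known: a transversal line has
contact m, and the contact with the tangent, if it is below 2m, is the only element of the value
semigroup strictly between m and 2m, since terms of order at least 2 contribute at least 2m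
(`IsTangentBranch.contact_tangent_eq_of_lt`). Whether two branches share their tangent is
topological as well: (b·c) is the product of the multiplicities exactly when the tangents differ
(`IsTangentBranch.contact_eq_mul_iff`). Hence a linear change that puts the tangents of g in the
same position to the axes as those of f gives g all weighted orders of f in this range, and these
orders express preliminary form. A linear change of the affine plane is projective, so a linear
singularity has linear strata in every degree. The slopes are necessary. The test curve is the
homogenization of f(x + c(y + c'x²)², y + c'x²), which is equisingular to f. Let A, B, o be the
minima of x + 2y, 2x + y, x + y on the support of f. For general c and c' the restriction of the
test curve to a line through the origin has order at most A along the x-axis, at most B along the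
y-axis, and at most o + 1 along any other line, the last because non-degeneracy makes the zeros of
the tangent cone off the axes simple (`exists_twist_coeff_lineRestriction_ne_zero`). A projective
change fixing the point moves lines to lines, so these numbers bound the intercepts of the Newton
diagram on the axes in any projective coordinates. A preliminary form needs intercepts beyond all
supporting lines of f, and a segment of slope outside [1/2, 2] makes this impossible
(`le_two_mul_of_supporting`). -/

open LaurentSeries PowerSeries
open scoped WithZero

/-! ### Valuations over the field of Laurent series. -/

noncomputable instance rankOneLaurentSeries : (Valued.v : Valuation ℂ⸨X⸩ ℤᵐ⁰).RankOne :=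
  have : (Valued.v : Valuation ℂ⸨X⸩ ℤᵐ⁰).IsRankOneDiscrete := by
    rw [LaurentSeries.valuation_def]
    infer_instance
  Valuation.IsRankOneDiscrete.rankOne _ (one_lt_two : (1 : NNReal) < 2)

noncomputable instance normedFieldLaurentSeries : NontriviallyNormedField ℂ⸨X⸩ :=
  Valued.toNontriviallyNormedField (L := ℂ⸨X⸩) (Γ₀ := ℤᵐ⁰)

instance isUltrametricDistLaurentSeries : IsUltrametricDist ℂ⸨X⸩ :=
  inferInstance

theorem LaurentSeries.norm_le_one_iff (F : ℂ⸨X⸩) :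
    ‖F‖ ≤ 1 ↔ ∃ G : ℂ⟦X⟧, (G : ℂ⸨X⸩) = F :=
  Valued.toNormedField.norm_le_one_iff.trans (LaurentSeries.val_le_one_iff_eq_coe _ F)

theorem LaurentSeries.norm_coe_le_norm_coe_iff (F G : ℂ⟦X⟧) :
    ‖algebraMap ℂ⟦X⟧ ℂ⸨X⸩ F‖ ≤ ‖algebraMap ℂ⟦X⟧ ℂ⸨X⸩ G‖ ↔ G ∣ F := by
  constructor
  · intro h
    rcases eq_or_ne G 0 with rfl | hG
    · simp only [map_zero, norm_zero, norm_le_zero_iff] at h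
      rw [(map_eq_zero_iff _ (FaithfulSMul.algebraMap_injective ℂ⟦X⟧ ℂ⸨X⸩)).1 h]
    have hG' : algebraMap ℂ⟦X⟧ ℂ⸨X⸩ G ≠ 0 :=
      (map_ne_zero_iff _ (FaithfulSMul.algebraMap_injective ℂ⟦X⟧ ℂ⸨X⸩)).2 hG
    obtain ⟨H, hH⟩ := (LaurentSeries.norm_le_one_iff
      (algebraMap ℂ⟦X⟧ ℂ⸨X⸩ F / algebraMap ℂ⟦X⟧ ℂ⸨X⸩ G)).1
      (by rw [norm_div]; exact div_le_one_of_le₀ h (norm_nonneg _))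
    refine ⟨H, FaithfulSMul.algebraMap_injective ℂ⟦X⟧ ℂ⸨X⸩ ?_⟩
    rw [eq_div_iff hG'] at hH
    rw [← hH, map_mul, mul_comm]; rfl
  · rintro ⟨H, rfl⟩
    rw [map_mul, norm_mul]
    exact mul_le_of_le_one_right (norm_nonneg _) ((LaurentSeries.norm_le_one_iff _).2 ⟨H, rfl⟩)

/-- The Newton polygon of an irreducible monic polynomial over `ℂ⟦X⟧` is a single segment. -/
theorem Polynomial.Monic.order_coeff_slope {P : Polynomial ℂ⟦X⟧} (hP : P.Monic)
    (hirr : Irreducible P) {j : ℕ} (hj : j < P.natDegree) :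
    ((P.natDegree - j : ℕ) : ℕ∞) * (P.coeff 0).order ≤ P.natDegree * (P.coeff j).order := by
  set Q := P.map (algebraMap ℂ⟦X⟧ ℂ⸨X⸩) with hQ
  have hQirr : Irreducible Q := (hP.irreducible_iff_irreducible_map_fraction_map).1 hirr
  have hQm : Q.Monic := hP.map _
  have hdeg : Q.natDegree = P.natDegree := hP.natDegree_map _
  have : Fact (Irreducible Q) := ⟨hQirr⟩
  have : FiniteDimensional ℂ⸨X⸩ (AdjoinRoot Q) := (AdjoinRoot.powerBasis hQirr.ne_zero).finite
  have hmin : minpoly ℂ⸨X⸩ (AdjoinRoot.root Q) = Q := by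
    rw [AdjoinRoot.minpoly_root hQirr.ne_zero, hQm.leadingCoeff, inv_one, map_one, mul_one]
  -- The norm of a root is computed in two ways: from the constant coefficient, because all
  -- conjugates have the same norm over a complete field, and as the supremum of the terms
  -- ‖a_j‖^(1/(n-j)).
  have h1 := spectralNorm.spectralNorm_eq_norm_coeff_zero_rpow ℂ⸨X⸩ (AdjoinRoot Q) (AdjoinRoot.root Q)
  rw [spectralNorm, hmin, hdeg] at h1
  have h2 : spectralValueTerms Q j ≤ spectralValue Q := le_ciSup (spectralValueTerms_bddAbove Q) j
  rw [spectralValueTerms_of_lt_natDegree _ (hdeg ▸ hj), h1, hdeg] at h2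
  have hm : (0 : ℝ) < P.natDegree := by exact_mod_cast (Nat.zero_le j).trans_lt hj
  have hmj : (0 : ℝ) < (P.natDegree : ℝ) - j := by
    rw [sub_pos]; exact_mod_cast hj
  have h3 : ‖Q.coeff j‖ ^ P.natDegree ≤ ‖Q.coeff 0‖ ^ (P.natDegree - j) := by
    have := Real.rpow_le_rpow (by positivity) h2
      (show 0 ≤ ((P.natDegree : ℝ) - j) * P.natDegree by positivity)
    rw [← Real.rpow_mul (norm_nonneg _), ← Real.rpow_mul (norm_nonneg _)] at this
    have e1 : 1 / ((P.natDegree : ℝ) - j) * (((P.natDegree : ℝ) - j) * P.natDegree) =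
      P.natDegree := by field_simp
    have e2 : 1 / (P.natDegree : ℝ) * (((P.natDegree : ℝ) - j) * P.natDegree) =
      ((P.natDegree - j : ℕ) : ℝ) := by rw [Nat.cast_sub hj.le]; field_simp
    rwa [e1, e2, Real.rpow_natCast, Real.rpow_natCast] at this
  rw [← norm_pow, ← norm_pow, hQ, Polynomial.coeff_map, Polynomial.coeff_map, ← map_pow,
    ← map_pow, LaurentSeries.norm_coe_le_norm_coe_iff] at h3
  obtain ⟨c, hc⟩ := h3
  have := congrArg PowerSeries.order hc
  rw [PowerSeries.order_mul, PowerSeries.order_pow, PowerSeries.order_pow, nsmul_eq_mul,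
    nsmul_eq_mul] at this
  rw [this]
  exact le_self_add

theorem Ring.krullDimLE_one_of_isIntegral (A O : Type*) [CommRing A] [IsDomain A]
    [Ring.KrullDimLE 1 A] [CommRing O] [IsDomain O] [Algebra A O] [Algebra.IsIntegral A O] :
    Ring.KrullDimLE 1 O := by
  refine Ring.KrullDimLE.mk₁' fun I hI hp => ?_
  have := hp
  have h : I.comap (algebraMap A O) ≠ ⊥ := Ideal.IsIntegral.comap_ne_bot A hI
  exact Ideal.isMaximal_of_isIntegral_of_isMaximal_comap I
    ((Ideal.comap_isPrime (algebraMap A O) I).isMaximal_of_ne_bot h)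

/-- A common denominator r of all powers of c/d gives n · ord d ≤ ord r + n · ord c for every n, and
the constant ord r is negligible for large n. This replaces a passage to the normalization. -/
theorem Ring.ord_le_ord_of_isAlmostIntegral {O L : Type*} [CommRing O] [IsDomain O]
    [IsNoetherianRing O] [Ring.KrullDimLE 1 O] [Field L] [Algebra O L] [IsFractionRing O L]
    {c d : O} (hd : d ≠ 0) (h : IsAlmostIntegral O (algebraMap O L c / algebraMap O L d)) :
    Ring.ord O d ≤ Ring.ord O c := by
  rcases eq_or_ne c 0 with rfl | hc
  · exact Ring.ord_le_ord_of_dvd (dvd_zero d)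
  obtain ⟨r, hr, hrn⟩ := h
  have key : ∀ n : ℕ, n * Ring.ord O d ≤ Ring.ord O r + n * Ring.ord O c := by
    intro n
    obtain ⟨e, he⟩ := hrn n
    have : r * c ^ n = e * d ^ n := by
      apply FaithfulSMul.algebraMap_injective O L
      have hd' : algebraMap O L d ≠ 0 :=
        (map_ne_zero_iff _ (FaithfulSMul.algebraMap_injective O L)).2 hd
      rw [map_mul, map_mul, map_pow, map_pow, he, Algebra.smul_def, div_pow, mul_assoc,
        div_mul_cancel₀ _ (pow_ne_zero n hd')]
    have h2 := congrArg (Ring.ord O) this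
    rw [Ring.ord_mul _ (mem_nonZeroDivisors_of_ne_zero (pow_ne_zero n hc)),
      Ring.ord_mul _ (mem_nonZeroDivisors_of_ne_zero (pow_ne_zero n hd)),
      Ring.ord_pow (mem_nonZeroDivisors_of_ne_zero hc),
      Ring.ord_pow (mem_nonZeroDivisors_of_ne_zero hd), nsmul_eq_mul, nsmul_eq_mul] at h2
    rw [h2]
    exact le_add_self
  have hr' := Ring.ord_ne_top hr
  have hc' := Ring.ord_ne_top (mem_nonZeroDivisors_of_ne_zero hc)
  have hd' := Ring.ord_ne_top (mem_nonZeroDivisors_of_ne_zero hd)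
  lift Ring.ord O r to ℕ using hr' with a
  lift Ring.ord O c to ℕ using hc' with x
  lift Ring.ord O d to ℕ using hd' with y
  norm_cast at key ⊢
  by_contra! hlt
  -- If ord d ≥ ord c + 1, the inequality for n = ord r + 1 would read ord r + 1 ≤ ord r.
  have := key (a + 1)
  nlinarith

/-- The order of vanishing on a curve germ that is finite over `ℂ⟦X⟧` is a valuation. -/
theorem Ring.min_ord_le_ord_add {O : Type*} [CommRing O] [IsDomain O]
    [Algebra ℂ⟦X⟧ O] [Module.Finite ℂ⟦X⟧ O] [FaithfulSMul ℂ⟦X⟧ O] (c d : O) :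
    min (Ring.ord O c) (Ring.ord O d) ≤ Ring.ord O (c + d) := by
  let L := FractionRing O
  have : IsNoetherianRing O := isNoetherian_of_tower ℂ⟦X⟧ (isNoetherian_of_isNoetherianRing_of_finite ℂ⟦X⟧ O)
  have : Ring.KrullDimLE 1 O := Ring.krullDimLE_one_of_isIntegral ℂ⟦X⟧ O
  have hinj : Function.Injective (algebraMap ℂ⟦X⟧ L) := by
    rw [IsScalarTower.algebraMap_eq ℂ⟦X⟧ O L]
    exact (FaithfulSMul.algebraMap_injective O L).comp
      (FaithfulSMul.algebraMap_injective ℂ⟦X⟧ O)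
  let : Algebra ℂ⸨X⸩ L := (IsFractionRing.lift hinj).toAlgebra
  have : IsScalarTower ℂ⟦X⟧ ℂ⸨X⸩ L := IsScalarTower.of_algebraMap_eq fun a =>
    (IsFractionRing.lift_algebraMap hinj a).symm
  have : Algebra.IsAlgebraic ℂ⸨X⸩ L := by
    rw [← IsFractionRing.comap_isAlgebraic_iff (A := ℂ⟦X⟧)]
    exact (IsFractionRing.isAlgebraic_iff' ℂ⟦X⟧ O L).1 inferInstance
  -- The spectral norm on the fraction field is ultrametric and refines the order: if |c| ≤ |d|, the
  -- minimal polynomial of c/d has coefficients in the unit ball ℂ⟦X⟧, so c/d is integral.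
  have hle : ∀ c d : O, d ≠ 0 → spectralNorm ℂ⸨X⸩ L (algebraMap O L c) ≤
      spectralNorm ℂ⸨X⸩ L (algebraMap O L d) → Ring.ord O d ≤ Ring.ord O c := by
    intro c d hd h
    apply Ring.ord_le_ord_of_isAlmostIntegral (L := L) hd
    apply IsIntegral.isAlmostIntegral
    suffices IsIntegral ℂ⟦X⟧ (algebraMap O L c / algebraMap O L d) from this.tower_top
    have hd' : algebraMap O L d ≠ 0 :=
      (map_ne_zero_iff _ (FaithfulSMul.algebraMap_injective O L)).2 hd
    have h1 : spectralNorm ℂ⸨X⸩ L (algebraMap O L c / algebraMap O L d) ≤ 1 := by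
      rw [← spectralMulAlgNorm_def] at h ⊢
      rw [← spectralMulAlgNorm_def] at h
      have hpos : 0 < spectralMulAlgNorm ℂ⸨X⸩ L (algebraMap O L d) := by
        rw [spectralMulAlgNorm_def]
        exact spectralNorm_zero_lt hd' (Algebra.IsAlgebraic.isAlgebraic _)
      refine le_of_mul_le_mul_right ?_ hpos
      rw [← map_mul, div_mul_cancel₀ _ hd', one_mul]
      exact h
    set u := algebraMap O L c / algebraMap O L d
    have hu : IsIntegral ℂ⸨X⸩ u := Algebra.IsIntegral.isIntegral u
    rw [spectralNorm, spectralValue_le_one_iff (minpoly.monic hu)] at h1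
    have hl : minpoly ℂ⸨X⸩ u ∈ Polynomial.lifts (algebraMap ℂ⟦X⟧ ℂ⸨X⸩) := by
      rw [Polynomial.lifts_iff_coeff_lifts]
      intro n
      exact (LaurentSeries.norm_le_one_iff _).1 (h1 n)
    obtain ⟨q, hq, -, hqm⟩ := Polynomial.lifts_and_natDegree_eq_and_monic hl (minpoly.monic hu)
    refine ⟨q, hqm, ?_⟩
    have := minpoly.aeval ℂ⸨X⸩ u
    rwa [← hq, Polynomial.aeval_map_algebraMap] at this
  rcases eq_or_ne c 0 with rfl | hc
  · simp
  rcases eq_or_ne d 0 with rfl | hd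
  · simp
  have hna := isNonarchimedean_spectralNorm (K := ℂ⸨X⸩) (L := L) (algebraMap O L c) (algebraMap O L d)
  rw [← map_add] at hna
  rcases le_total (spectralNorm ℂ⸨X⸩ L (algebraMap O L c)) (spectralNorm ℂ⸨X⸩ L (algebraMap O L d))
    with h | h
  · rw [max_eq_right h] at hna
    exact (min_le_right _ _).trans (hle _ _ hd hna)
  · rw [max_eq_left h] at hna
    exact (min_le_left _ _).trans (hle _ _ hc hna)

/-! ### Germs as iterated power series. -/

/-- The exponent of the monomial `x ^ i * y ^ j`. -/
noncomputable def biexp (i j : ℕ) : Fin 2 →₀ ℕ := Finsupp.single 0 i + Finsupp.single 1 j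

@[simp] theorem biexp_zero (i j : ℕ) : biexp i j 0 = i := by simp [biexp]

@[simp] theorem biexp_one (i j : ℕ) : biexp i j 1 = j := by simp [biexp]

theorem biexp_eta (m : Fin 2 →₀ ℕ) : biexp (m 0) (m 1) = m := by
  ext k; fin_cases k <;> simp

theorem biexp_inj {i j k l : ℕ} : biexp i j = biexp k l ↔ i = k ∧ j = l := by
  refine ⟨fun h => ⟨?_, ?_⟩, fun h => by rw [h.1, h.2]⟩
  · simpa using DFunLike.congr_fun h 0
  · simpa using DFunLike.congr_fun h 1

theorem eq_biexp_iff {d : Fin 2 →₀ ℕ} {i j : ℕ} : d = biexp i j ↔ d 0 = i ∧ d 1 = j := by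
  rw [← biexp_inj, biexp_eta]

theorem weight_fin_two (w : Fin 2 → ℕ) (m : Fin 2 →₀ ℕ) :
    Finsupp.weight w m = m 0 * w 0 + m 1 * w 1 := by
  rw [Finsupp.weight_apply, Finsupp.sum_fintype _ _ (by simp)]
  simp [Fin.sum_univ_two]

theorem degree_fin_two (m : Fin 2 →₀ ℕ) : Finsupp.degree m = m 0 + m 1 := by
  rw [Finsupp.degree_eq_sum]; simp [Fin.sum_univ_two]

/-- Germs as power series in `x` with coefficients in `ℂ⟦y⟧`. -/
noncomputable def germEquiv : GermRing ≃+* ℂ⟦X⟧⟦X⟧ :=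
  (MvPowerSeries.finSuccEquiv ℂ 1).toRingEquiv.trans <|
    RingEquiv.ofRingHom
      (PowerSeries.map (MvPowerSeries.renameEquiv ℂ (Equiv.ofUnique (Fin 1) Unit)).toRingEquiv.toRingHom)
      (PowerSeries.map (MvPowerSeries.renameEquiv ℂ (Equiv.ofUnique (Fin 1) Unit)).symm.toRingEquiv.toRingHom)
      (by
        ext1 p
        refine PowerSeries.ext fun n => ?_
        rw [RingHom.comp_apply, PowerSeries.coeff_map, PowerSeries.coeff_map]
        exact AlgEquiv.apply_symm_apply _ _)
      (by
        ext1 p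
        refine PowerSeries.ext fun n => ?_
        rw [RingHom.comp_apply, PowerSeries.coeff_map, PowerSeries.coeff_map]
        exact AlgEquiv.symm_apply_apply _ _)

theorem coeff_coeff_germEquiv (b : GermRing) (i j : ℕ) :
    PowerSeries.coeff j (PowerSeries.coeff i (germEquiv b)) =
      MvPowerSeries.coeff (biexp i j) b := by
  have h : PowerSeries.coeff i (germEquiv b) =
      MvPowerSeries.renameEquiv ℂ (Equiv.ofUnique (Fin 1) Unit)
        (PowerSeries.coeff i (MvPowerSeries.finSuccEquiv ℂ 1 b)) := rfl
  have h2 : (Finsupp.single 0 j : Fin 1 →₀ ℕ).embDomain (Equiv.ofUnique (Fin 1) Unit).toEmbedding =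
      Finsupp.single () j := by
    rw [Finsupp.embDomain_single]
  rw [h]
  change MvPowerSeries.coeff (Finsupp.single () j) (MvPowerSeries.rename (Equiv.ofUnique (Fin 1) Unit).toEmbedding
        (PowerSeries.coeff i (MvPowerSeries.finSuccEquiv ℂ 1 b))) = _
  rw [← h2, MvPowerSeries.coeff_embDomain_rename, MvPowerSeries.coeff_coeff_finSuccEquiv]
  refine congrArg (fun m => MvPowerSeries.coeff m b) (Finsupp.ext fun k => ?_)
  fin_cases k
  · simp
  · simp only [Fin.mk_one]
    rw [show (1 : Fin 2) = Fin.succ 0 from rfl, Finsupp.cons_succ]; simp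

theorem germEquiv_X_zero : germEquiv (MvPowerSeries.X 0) = PowerSeries.X := by
  ext i j
  rw [coeff_coeff_germEquiv, MvPowerSeries.coeff_X, PowerSeries.coeff_X]
  have : biexp i j = Finsupp.single 0 1 ↔ i = 1 ∧ j = 0 := by
    rw [show (Finsupp.single 0 1 : Fin 2 →₀ ℕ) = biexp 1 0 by simp [biexp], biexp_inj]
  simp only [this]
  split_ifs <;> simp_all [PowerSeries.coeff_one]

theorem germEquiv_X_one : germEquiv (MvPowerSeries.X 1) = PowerSeries.C PowerSeries.X := by
  ext i j
  rw [coeff_coeff_germEquiv, MvPowerSeries.coeff_X, PowerSeries.coeff_C]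
  have : biexp i j = Finsupp.single 1 1 ↔ i = 0 ∧ j = 1 := by
    rw [show (Finsupp.single 1 1 : Fin 2 →₀ ℕ) = biexp 0 1 by simp [biexp], biexp_inj]
  simp only [this]
  split_ifs <;> simp_all [PowerSeries.coeff_X]

instance uniqueFactorizationMonoid_germRing : UniqueFactorizationMonoid GermRing :=
  germEquiv.toMulEquiv.symm.uniqueFactorizationMonoid inferInstance

/-! ### Intersection multiplicities and coordinate lines. -/

/-- Intersection multiplicity as an order of vanishing along a curve. -/
theorem intersectionMultiplicity_eq_ord {S : Type} [CommRing S] (φ : GermRing →+* S)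
    (hφ : Function.Surjective φ) {P : Ideal GermRing} (hk : RingHom.ker φ = P) (c : GermRing) :
    intersectionMultiplicity P (Ideal.span {c}) = Ring.ord S (φ c) := by
  let _ : Algebra GermRing S := φ.toAlgebra
  have hs : Function.Surjective (algebraMap GermRing S) := hφ
  rw [Ring.ord, ← Module.length_eq_of_surjective hs, intersectionMultiplicity]
  apply LinearEquiv.length_eq
  let ψ : GermRing →ₐ[GermRing] (S ⧸ Ideal.span {φ c}) :=
    (Ideal.Quotient.mkₐ GermRing (Ideal.span {φ c})).comp (Algebra.ofId GermRing S)
  have hψ : Function.Surjective ψ := (Ideal.Quotient.mkₐ_surjective GermRing (Ideal.span {φ c})).comp hs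
  have hker : RingHom.ker ψ.toRingHom = P ⊔ Ideal.span {c} := by
    have h1 : RingHom.ker ψ.toRingHom = (Ideal.span {φ c}).comap φ := by
      ext x
      rw [RingHom.mem_ker, Ideal.mem_comap]
      exact Ideal.Quotient.eq_zero_iff_mem
    rw [h1, ← Set.image_singleton, ← Ideal.map_span, Ideal.comap_map_of_surjective φ hφ, sup_comm, ← hk]
    rfl
  exact ((Ideal.quotientEquivAlgOfEq GermRing hker.symm).trans
    (Ideal.quotientKerAlgEquivOfSurjective (f := ψ) hψ)).toLinearEquiv

theorem PowerSeries.ringOrd_eq_order (F : ℂ⟦X⟧) : Ring.ord ℂ⟦X⟧ F = F.order := by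
  rcases eq_or_ne F 0 with rfl | hF
  · rw [Ring.ord_eq_addVal, PowerSeries.order_zero]
    simp
  · obtain ⟨n, u, hu⟩ := IsDiscreteValuationRing.eq_unit_mul_pow_irreducible hF PowerSeries.X_irreducible
    rw [hu, Ring.ord_mul_of_isUnit_left u.isUnit, Ring.ord_pow
      (mem_nonZeroDivisors_of_ne_zero PowerSeries.X_ne_zero),
      Ring.ord_of_irreducible PowerSeries.X_irreducible, PowerSeries.order_mul,
      PowerSeries.order_X_pow, PowerSeries.order_zero_of_unit u.isUnit]
    simp

/-- The intersection multiplicity of the germs `b = 0` and `c = 0`. -/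
noncomputable def contact (b c : GermRing) : ℕ∞ :=
  intersectionMultiplicity (Ideal.span {b}) (Ideal.span {c})

theorem contact_comm (b c : GermRing) : contact b c = contact c b := by
  rw [contact, contact, intersectionMultiplicity, intersectionMultiplicity, sup_comm]

theorem contact_eq_ord {S : Type} [CommRing S] (φ : GermRing →+* S)
    (hφ : Function.Surjective φ) {b : GermRing} (hk : RingHom.ker φ = Ideal.span {b})
    (c : GermRing) : contact b c = Ring.ord S (φ c) :=
  intersectionMultiplicity_eq_ord φ hφ hk c

/-- An automorphism is not linear over the ring of germs. The length of a cyclic quotient is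
therefore read off from its lattice of ideals, which depends on the quotient ring alone. -/
theorem intersectionMultiplicity_map (e : GermRing ≃+* GermRing) (P Q : Ideal GermRing) :
    intersectionMultiplicity (P.map e) (Q.map e) = intersectionMultiplicity P Q := by
  have h (I : Ideal GermRing) :
      Module.length GermRing (GermRing ⧸ I) = Module.length (GermRing ⧸ I) (GermRing ⧸ I) :=
    Module.length_eq_of_surjective Ideal.Quotient.mk_surjective
  rw [intersectionMultiplicity, ← Ideal.map_sup, intersectionMultiplicity, h, h]
  apply WithBot.coe_injective
  rw [Module.coe_length, Module.coe_length]
  exact Order.krullDim_eq_of_orderIso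
    (RingEquiv.idealComapOrderIso (Ideal.quotientEquiv (P ⊔ Q) ((P ⊔ Q).map e) e rfl))

theorem contact_map (e : GermRing ≃+* GermRing) (b c : GermRing) :
    contact (e b) (e c) = contact b c := by
  rw [contact, contact, ← intersectionMultiplicity_map e (Ideal.span {b}), Ideal.map_span,
    Ideal.map_span, Set.image_singleton, Set.image_singleton]

/-- The interchange of the coordinates. -/
noncomputable def germSwap : GermRing ≃+* GermRing :=
  (MvPowerSeries.renameEquiv ℂ (Equiv.swap (0 : Fin 2) 1)).toRingEquiv

theorem coeff_germSwap (b : GermRing) (i j : ℕ) :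
    MvPowerSeries.coeff (biexp i j) (germSwap b) = MvPowerSeries.coeff (biexp j i) b := by
  change MvPowerSeries.coeff (biexp i j)
    (MvPowerSeries.rename (Equiv.swap (0 : Fin 2) 1).toEmbedding b) = _
  rw [← MvPowerSeries.coeff_embDomain_rename (Equiv.swap (0 : Fin 2) 1).toEmbedding b (biexp j i)]
  refine congrArg (fun m => MvPowerSeries.coeff m _) ?_
  rw [biexp, biexp, Finsupp.embDomain_add, Finsupp.embDomain_single, Finsupp.embDomain_single]
  simp [add_comm]

theorem germSwap_X_zero : germSwap (MvPowerSeries.X 0) = MvPowerSeries.X 1 := by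
  change MvPowerSeries.rename (Equiv.swap (0 : Fin 2) 1) _ = _
  simp

theorem germSwap_X_one : germSwap (MvPowerSeries.X 1) = MvPowerSeries.X 0 := by
  change MvPowerSeries.rename (Equiv.swap (0 : Fin 2) 1) _ = _
  simp

theorem weightedOrder_germSwap (w : Fin 2 → ℕ) (b : GermRing) :
    (germSwap b).weightedOrder w = b.weightedOrder ![w 1, w 0] := by
  have key : ∀ (w : Fin 2 → ℕ) (b : GermRing),
      b.weightedOrder ![w 1, w 0] ≤ (germSwap b).weightedOrder w := by
    intro w b
    refine MvPowerSeries.le_weightedOrder w fun m hm => ?_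
    rw [← biexp_eta m, coeff_germSwap]
    apply MvPowerSeries.coeff_eq_zero_of_lt_weightedOrder ![w 1, w 0]
    refine lt_of_eq_of_lt ?_ hm
    simp [weight_fin_two, add_comm]
  refine le_antisymm ?_ (key w b)
  have := key ![w 1, w 0] (germSwap b)
  have h2 : germSwap (germSwap b) = b := by
    refine MvPowerSeries.ext fun m => ?_
    rw [← biexp_eta m, coeff_germSwap, coeff_germSwap]
  rw [h2] at this
  have h3 : ![(![w 1, w 0] : Fin 2 → ℕ) 1, (![w 1, w 0] : Fin 2 → ℕ) 0] = w := by
    ext k; fin_cases k <;> rfl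
  rwa [h3] at this

theorem order_eq_weightedOrder (b : GermRing) : b.order = b.weightedOrder ![1, 1] := by
  rw [MvPowerSeries.order]
  congr 1
  ext k; fin_cases k <;> rfl

theorem order_germSwap (b : GermRing) : (germSwap b).order = b.order := by
  rw [order_eq_weightedOrder, order_eq_weightedOrder, weightedOrder_germSwap]
  rfl

/-- The restriction of a germ to the line `x = 0`. -/
noncomputable def restrictLine : GermRing →+* ℂ⟦X⟧ :=
  PowerSeries.constantCoeff.comp germEquiv.toRingHom

theorem coeff_restrictLine (b : GermRing) (j : ℕ) :
    PowerSeries.coeff j (restrictLine b) = MvPowerSeries.coeff (biexp 0 j) b := by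
  rw [← coeff_coeff_germEquiv, PowerSeries.coeff_zero_eq_constantCoeff_apply]; rfl

theorem contact_X_zero (b : GermRing) :
    contact b (MvPowerSeries.X 0) = (restrictLine b).order := by
  rw [contact_comm, contact_eq_ord restrictLine _ _ b, PowerSeries.ringOrd_eq_order]
  · intro F
    obtain ⟨c, hc⟩ := germEquiv.surjective (PowerSeries.C F)
    refine ⟨c, ?_⟩
    change PowerSeries.constantCoeff (germEquiv c) = F
    rw [hc]; simp
  · ext b
    rw [RingHom.mem_ker, Ideal.mem_span_singleton, ← map_dvd_iff germEquiv, germEquiv_X_zero,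
      PowerSeries.X_dvd_iff]
    rfl

theorem contact_X_one (b : GermRing) :
    contact b (MvPowerSeries.X 1) = (restrictLine (germSwap b)).order := by
  rw [← contact_map germSwap, germSwap_X_one, contact_X_zero]

theorem contact_X_one_eq {b : GermRing} {m : ℕ} (h : (m : ℕ∞) ≤ b.order)
    (hm : MvPowerSeries.coeff (biexp m 0) b ≠ 0) : contact b (MvPowerSeries.X 1) = m := by
  rw [contact_X_one, PowerSeries.order_eq_nat]
  refine ⟨by rwa [coeff_restrictLine, coeff_germSwap], fun i hi => ?_⟩
  rw [coeff_restrictLine, coeff_germSwap]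
  apply MvPowerSeries.coeff_of_lt_order
  refine lt_of_lt_of_le ?_ h
  simpa [degree_fin_two] using hi

/-! ### Weierstrass preparation for a branch. -/

instance isAdicComplete_maximalIdeal_powerSeries :
    IsAdicComplete (IsLocalRing.maximalIdeal ℂ⟦X⟧) ℂ⟦X⟧ := by
  rw [PowerSeries.maximalIdeal_eq_span_X]
  infer_instance

theorem order_map_residue_germEquiv {b : GermRing} {m : ℕ} (h : (m : ℕ∞) ≤ b.order)
    (hm : MvPowerSeries.coeff (biexp m 0) b ≠ 0) :
    ((germEquiv b).map (IsLocalRing.residue ℂ⟦X⟧)).order = m := by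
  have key (i : ℕ) : PowerSeries.coeff i ((germEquiv b).map (IsLocalRing.residue ℂ⟦X⟧)) = 0 ↔
      MvPowerSeries.coeff (biexp i 0) b = 0 := by
    rw [PowerSeries.coeff_map, IsLocalRing.residue_eq_zero_iff, PowerSeries.maximalIdeal_eq_span_X,
      Ideal.mem_span_singleton, PowerSeries.X_dvd_iff, ← coeff_coeff_germEquiv,
      PowerSeries.coeff_zero_eq_constantCoeff_apply]
  rw [PowerSeries.order_eq_nat]
  refine ⟨by rwa [Ne, key], fun i hi => ?_⟩
  rw [key]
  apply MvPowerSeries.coeff_of_lt_order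
  refine lt_of_lt_of_le ?_ h
  simpa [degree_fin_two] using hi

theorem PowerSeries.IsWeierstrassFactorizationAt.nonempty_ringEquiv {A : Type*} [CommRing A]
    {I : Ideal A} [IsAdicComplete I A] {g : A⟦X⟧} {f : Polynomial A} {h : A⟦X⟧}
    (H : g.IsWeierstrassFactorizationAt f h I) :
    Nonempty ((Polynomial A ⧸ Ideal.span {f}) ≃+* A⟦X⟧ ⧸ Ideal.span {g}) :=
  ⟨H.algEquivQuotient.toRingEquiv⟩

/-- The Weierstrass polynomial of a branch. -/
theorem exists_weierstrass {b : GermRing} (hb : Irreducible b) {m : ℕ}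
    (h : (m : ℕ∞) ≤ b.order) (hm : MvPowerSeries.coeff (biexp m 0) b ≠ 0) :
    ∃ (P : Polynomial ℂ⟦X⟧) (u : ℂ⟦X⟧⟦X⟧), IsUnit u ∧ germEquiv b = P * u ∧ P.Monic ∧
      Irreducible P ∧ P.natDegree = m ∧
      Nonempty (AdjoinRoot P ≃+* ℂ⟦X⟧⟦X⟧ ⧸ Ideal.span {germEquiv b}) := by
  have hord := order_map_residue_germEquiv h hm
  have hres : (germEquiv b).map (IsLocalRing.residue ℂ⟦X⟧) ≠ 0 := by
    rw [← PowerSeries.order_finite_iff_ne_zero, hord]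
    exact ENat.natCast_lt_top m
  obtain ⟨P, u, hPu⟩ := PowerSeries.exists_isWeierstrassFactorization hres
  obtain ⟨e⟩ := PowerSeries.IsWeierstrassFactorizationAt.nonempty_ringEquiv hPu
  have hmon := hPu.isDistinguishedAt.monic
  refine ⟨P, u, hPu.isUnit, hPu.eq_mul, hmon, ?_, ?_, ⟨e⟩⟩
  -- Irreducibility passes from the series to its Weierstrass polynomial because both have the same
  -- quotient ring, a domain.
  · have hprime : Prime (germEquiv b) :=
      ((MulEquiv.irreducible_iff germEquiv).2 hb).prime
    have := (Ideal.span_singleton_prime hprime.ne_zero).2 hprime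
    have hdom : IsDomain (Polynomial ℂ⟦X⟧ ⧸ Ideal.span {P}) := e.toMulEquiv.isDomain _
    rw [Ideal.Quotient.isDomain_iff_prime, Ideal.span_singleton_prime hmon.ne_zero] at hdom
    exact hdom.irreducible
  · rw [hPu.natDegree_eq_toNat_order_map, hord, ENat.toNat_natCast]

/-- By Weierstrass preparation the ring of the branch is finite over ℂ⟦y⟧, so its order of vanishing
is a valuation. -/
theorem min_contact_le_contact_add_of_regular {b : GermRing} (hb : Irreducible b) {m : ℕ}
    (h : (m : ℕ∞) ≤ b.order) (hm : MvPowerSeries.coeff (biexp m 0) b ≠ 0) (c d : GermRing) :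
    min (contact b c) (contact b d) ≤ contact b (c + d) := by
  obtain ⟨P, u, -, -, hmon, hirr, hdeg, ⟨e⟩⟩ := exists_weierstrass hb h hm
  have hprime : Prime (germEquiv b) := ((MulEquiv.irreducible_iff germEquiv).2 hb).prime
  have := (Ideal.span_singleton_prime hprime.ne_zero).2 hprime
  have hdom : IsDomain (AdjoinRoot P) := e.toMulEquiv.isDomain _
  have hfin : Module.Finite ℂ⟦X⟧ (AdjoinRoot P) := hmon.finite_adjoinRoot
  have hfaith : FaithfulSMul ℂ⟦X⟧ (AdjoinRoot P) := by
    rw [faithfulSMul_iff_algebraMap_injective]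
    exact AdjoinRoot.of.injective_of_degree_ne_zero (hmon.degree_pos_of_not_isUnit hirr.not_isUnit).ne'
  let φ : GermRing →+* AdjoinRoot P :=
    e.symm.toRingHom.comp ((Ideal.Quotient.mk (Ideal.span {germEquiv b})).comp germEquiv.toRingHom)
  have hφ : Function.Surjective φ :=
    e.symm.surjective.comp (Ideal.Quotient.mk_surjective.comp germEquiv.surjective)
  have hk : RingHom.ker φ = Ideal.span {b} := by
    ext x
    rw [RingHom.mem_ker, Ideal.mem_span_singleton, ← map_dvd_iff germEquiv,
      ← Ideal.mem_span_singleton]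
    exact (map_eq_zero_iff e.symm e.symm.injective).trans Ideal.Quotient.eq_zero_iff_mem
  rw [contact_eq_ord φ hφ hk, contact_eq_ord φ hφ hk, contact_eq_ord φ hφ hk, map_add]
  exact Ring.min_ord_le_ord_add _ _

/-! ### Linear changes of coordinates and initial forms. -/

/-- The linear form with the given coefficients. -/
noncomputable def linForm (s : Fin 2 → ℂ) : GermRing :=
  ∑ j, MvPowerSeries.C (s j) * MvPowerSeries.X j

theorem linForm_eq (s : Fin 2 → ℂ) : linForm s =
    MvPowerSeries.C (s 0) * MvPowerSeries.X 0 + MvPowerSeries.C (s 1) * MvPowerSeries.X 1 := by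
  rw [linForm, Fin.sum_univ_two]

theorem constantCoeff_linForm (s : Fin 2 → ℂ) : MvPowerSeries.constantCoeff (linForm s) = 0 := by
  simp [linForm]

theorem hasSubst_linForm (A : Matrix (Fin 2) (Fin 2) ℂ) :
    MvPowerSeries.HasSubst (fun i => linForm (A i)) :=
  MvPowerSeries.hasSubst_of_constantCoeff_zero fun _ => constantCoeff_linForm _

theorem linearChange_eq (A : GL (Fin 2) ℂ) (g : GermRing) :
    linearChange A g = MvPowerSeries.substAlgHom
      (hasSubst_linForm (A : Matrix (Fin 2) (Fin 2) ℂ)) g := by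
  rw [MvPowerSeries.coe_substAlgHom]; rfl

theorem substAlgHom_C {a : Fin 2 → GermRing} (ha : MvPowerSeries.HasSubst a) (c : ℂ) :
    MvPowerSeries.substAlgHom (R := ℂ) ha (MvPowerSeries.C c) = MvPowerSeries.C c := by
  have : (MvPowerSeries.C c : GermRing) = algebraMap ℂ GermRing c := rfl
  rw [this, AlgHom.commutes]

theorem linearChange_linForm (A : GL (Fin 2) ℂ) (s : Fin 2 → ℂ) :
    linearChange A (linForm s) =
      linForm (Matrix.vecMul s (A : Matrix (Fin 2) (Fin 2) ℂ)) := by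
  rw [linearChange_eq, linForm_eq, map_add, map_mul, map_mul, substAlgHom_C, substAlgHom_C,
    MvPowerSeries.substAlgHom_X, MvPowerSeries.substAlgHom_X, linForm_eq, linForm_eq, linForm_eq]
  simp only [Matrix.vecMul, dotProduct, Fin.sum_univ_two, map_add, map_mul]
  ring

theorem linearChange_mul (A B : GL (Fin 2) ℂ) (g : GermRing) :
    linearChange A (linearChange B g) = linearChange (B * A) g := by
  have h : ∀ i, MvPowerSeries.subst (fun i => linForm ((A : Matrix (Fin 2) (Fin 2) ℂ) i))
      (linForm ((B : Matrix (Fin 2) (Fin 2) ℂ) i)) =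
        linForm ((B * A : Matrix (Fin 2) (Fin 2) ℂ) i) :=
    fun i => linearChange_linForm A _
  change MvPowerSeries.subst (fun i => linForm ((A : Matrix (Fin 2) (Fin 2) ℂ) i))
    (MvPowerSeries.subst (fun i => linForm ((B : Matrix (Fin 2) (Fin 2) ℂ) i)) g) =
      MvPowerSeries.subst (fun i => linForm (((B * A : GL (Fin 2) ℂ) : Matrix (Fin 2) (Fin 2) ℂ) i)) g
  rw [MvPowerSeries.subst_comp_subst_apply (hasSubst_linForm _) (hasSubst_linForm _)]
  exact congrArg (fun a => MvPowerSeries.subst a g) (funext h)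

theorem linearChange_one (g : GermRing) : linearChange 1 g = g := by
  have : (fun i => linForm (((1 : GL (Fin 2) ℂ) : Matrix (Fin 2) (Fin 2) ℂ) i)) =
      (MvPowerSeries.X : Fin 2 → GermRing) := by
    funext i
    rw [linForm_eq]
    fin_cases i <;> simp
  change MvPowerSeries.subst (fun i => linForm (((1 : GL (Fin 2) ℂ) : Matrix (Fin 2) (Fin 2) ℂ) i)) g = g
  rw [this, MvPowerSeries.subst_self]
  rfl

/-- A linear change of coordinates as an automorphism of the ring of germs. -/
noncomputable def linearEquiv (A : GL (Fin 2) ℂ) : GermRing ≃+* GermRing where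
  toFun := linearChange A
  invFun := linearChange A⁻¹
  left_inv g := by rw [linearChange_mul, mul_inv_cancel, linearChange_one]
  right_inv g := by rw [linearChange_mul, inv_mul_cancel, linearChange_one]
  map_mul' f g := by simp only [linearChange_eq, map_mul]
  map_add' f g := by simp only [linearChange_eq, map_add]

@[simp] theorem linearEquiv_apply (A : GL (Fin 2) ℂ) (g : GermRing) :
    linearEquiv A g = linearChange A g := rfl

theorem one_le_order_of_constantCoeff {c : GermRing} (hc : MvPowerSeries.constantCoeff c = 0) :
    1 ≤ c.order :=
  MvPowerSeries.one_le_order_iff_constCoeff_eq_zero.2 hc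

theorem order_le_order_linearChange (A : GL (Fin 2) ℂ) (g : GermRing) :
    g.order ≤ (linearChange A g).order := by
  have h := MvPowerSeries.le_order_subst (hasSubst_linForm (A : Matrix (Fin 2) (Fin 2) ℂ)) g
  refine le_trans ?_ h
  refine le_mul_of_one_le_left zero_le (le_iInf fun i => ?_)
  exact one_le_order_of_constantCoeff (constantCoeff_linForm _)

theorem order_linearChange (A : GL (Fin 2) ℂ) (g : GermRing) :
    (linearChange A g).order = g.order := by
  refine le_antisymm ?_ (order_le_order_linearChange A g)
  have := order_le_order_linearChange A⁻¹ (linearChange A g)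
  rwa [linearChange_mul, mul_inv_cancel, linearChange_one] at this

theorem contact_linearChange (A : GL (Fin 2) ℂ) (b c : GermRing) :
    contact (linearChange A b) (linearChange A c) = contact b c :=
  contact_map (linearEquiv A) b c

/-- The initial form of degree `n`, evaluated at `s`. -/
noncomputable def formEval (b : GermRing) (n : ℕ) (s : Fin 2 → ℂ) : ℂ :=
  ∑ i ∈ Finset.range (n + 1), MvPowerSeries.coeff (biexp i (n - i)) b * s 0 ^ i * s 1 ^ (n - i)

theorem restrictLine_linForm (s : Fin 2 → ℂ) :
    restrictLine (linForm s) = PowerSeries.C (s 1) * PowerSeries.X := by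
  have hC (c : ℂ) : restrictLine (MvPowerSeries.C c) = PowerSeries.C c := by
    ext j
    rw [coeff_restrictLine, MvPowerSeries.coeff_C, PowerSeries.coeff_C]
    refine if_congr ?_ rfl rfl
    rw [show (0 : Fin 2 →₀ ℕ) = biexp 0 0 by simp [biexp], biexp_inj]
    simp
  have h0 : restrictLine (MvPowerSeries.X 0) = 0 := by
    change PowerSeries.constantCoeff (germEquiv _) = 0
    rw [germEquiv_X_zero]; simp
  have h1 : restrictLine (MvPowerSeries.X 1) = PowerSeries.X := by
    change PowerSeries.constantCoeff (germEquiv _) = PowerSeries.X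
    rw [germEquiv_X_one]; simp
  rw [linForm_eq, map_add, map_mul, map_mul, hC, hC, h0, h1, mul_zero, zero_add]

theorem order_sub_sum_monomial {b : GermRing} {n : ℕ} (h : (n : ℕ∞) ≤ b.order) :
    ((n + 1 : ℕ) : ℕ∞) ≤ (b - ∑ i ∈ Finset.range (n + 1),
      MvPowerSeries.monomial (biexp i (n - i)) (MvPowerSeries.coeff (biexp i (n - i)) b)).order := by
  refine MvPowerSeries.nat_le_order fun d hd => ?_
  rw [degree_fin_two] at hd
  rw [map_sub, map_sum, sub_eq_zero]
  have : ∀ i ∈ Finset.range (n + 1), MvPowerSeries.coeff d (MvPowerSeries.monomial (biexp i (n - i))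
      (MvPowerSeries.coeff (biexp i (n - i)) b)) =
      if d 0 = i then (if d 1 = n - i then MvPowerSeries.coeff d b else 0) else 0 := by
    intro i _
    rw [MvPowerSeries.coeff_monomial, ← ite_and]
    refine if_ctx_congr eq_biexp_iff (fun h => ?_) fun _ => rfl
    rw [← eq_biexp_iff.2 h]
  rw [Finset.sum_congr rfl this, Finset.sum_ite_eq]
  by_cases hlt : d 0 + d 1 < n
  · have h0 : MvPowerSeries.coeff d b = 0 := by
      apply MvPowerSeries.coeff_of_lt_order
      refine lt_of_lt_of_le ?_ h
      rw [degree_fin_two]; exact_mod_cast hlt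
    rw [h0]; simp
  · rw [if_pos (by rw [Finset.mem_range]; omega), if_pos (by omega)]

/-- A linear change preserves the order, so terms of degree above n do not contribute; putting x = 0
evaluates the form of degree n at the second column of `A`. -/
theorem coeff_linearChange_snd {b : GermRing} {n : ℕ} (h : (n : ℕ∞) ≤ b.order)
    (A : GL (Fin 2) ℂ) : MvPowerSeries.coeff (biexp 0 n) (linearChange A b) =
      formEval b n (fun i => (A : Matrix (Fin 2) (Fin 2) ℂ) i 1) := by
  have h1 := order_sub_sum_monomial h
  set T : GermRing := ∑ i ∈ Finset.range (n + 1),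
      MvPowerSeries.monomial (biexp i (n - i)) (MvPowerSeries.coeff (biexp i (n - i)) b) with hT
  have h2 : MvPowerSeries.coeff (biexp 0 n) (linearChange A (b - T)) = 0 := by
    apply MvPowerSeries.coeff_of_lt_order
    rw [order_linearChange]
    refine lt_of_lt_of_le ?_ h1
    rw [degree_fin_two, biexp_zero, biexp_one]
    exact_mod_cast (by omega : 0 + n < n + 1)
  have h3 : linearChange A (b - T) = linearChange A b - linearChange A T := by
    simp only [linearChange_eq, map_sub]
  rw [h3, map_sub, sub_eq_zero] at h2
  rw [h2, hT, linearChange_eq, map_sum, map_sum, formEval]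
  refine Finset.sum_congr rfl fun i hi => ?_
  rw [Finset.mem_range] at hi
  have h4 : (MvPowerSeries.monomial (biexp i (n - i)) (MvPowerSeries.coeff (biexp i (n - i)) b) : GermRing) =
      MvPowerSeries.C (MvPowerSeries.coeff (biexp i (n - i)) b) * MvPowerSeries.X 0 ^ i *
        MvPowerSeries.X 1 ^ (n - i) := by
    rw [MvPowerSeries.X_pow_eq, MvPowerSeries.X_pow_eq, ← MvPowerSeries.monomial_zero_eq_C_apply,
      MvPowerSeries.monomial_mul_monomial, MvPowerSeries.monomial_mul_monomial]
    simp [biexp]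
  have h5 : MvPowerSeries.substAlgHom (hasSubst_linForm (A : Matrix (Fin 2) (Fin 2) ℂ))
      (MvPowerSeries.C (MvPowerSeries.coeff (biexp i (n - i)) b) * MvPowerSeries.X 0 ^ i *
        MvPowerSeries.X 1 ^ (n - i)) = MvPowerSeries.C (MvPowerSeries.coeff (biexp i (n - i)) b) *
        (linForm ((A : Matrix (Fin 2) (Fin 2) ℂ) 0) ^ i *
          linForm ((A : Matrix (Fin 2) (Fin 2) ℂ) 1) ^ (n - i)) := by
    rw [map_mul, map_mul, map_pow, map_pow, substAlgHom_C, MvPowerSeries.substAlgHom_X,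
      MvPowerSeries.substAlgHom_X, mul_assoc]
  rw [h4, h5, MvPowerSeries.coeff_C_mul, mul_assoc]
  congr 1
  rw [← coeff_restrictLine, map_mul, map_pow, map_pow, restrictLine_linForm, restrictLine_linForm,
    mul_pow, mul_pow, mul_mul_mul_comm, ← pow_add, ← map_pow, ← map_pow, ← map_mul,
    PowerSeries.coeff_C_mul, show i + (n - i) = n by omega, PowerSeries.coeff_X_pow_self, mul_one]

theorem formEval_one_zero (b : GermRing) (n : ℕ) :
    formEval b n ![1, 0] = MvPowerSeries.coeff (biexp n 0) b := by
  rw [formEval, Finset.sum_eq_single_of_mem n (by simp)]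
  · simp
  · intro i hi hn
    rw [Finset.mem_range] at hi
    simp [show n - i ≠ 0 by omega]

theorem coeff_linearChange_fst {b : GermRing} {n : ℕ} (h : (n : ℕ∞) ≤ b.order)
    (A : GL (Fin 2) ℂ) : MvPowerSeries.coeff (biexp n 0) (linearChange A b) =
      formEval b n (fun i => (A : Matrix (Fin 2) (Fin 2) ℂ) i 0) := by
  let S : GL (Fin 2) ℂ := Matrix.GeneralLinearGroup.mkOfDetNeZero !![0, 1; 1, 0] (by simp)
  have h1 := coeff_linearChange_snd (b := linearChange A b) (n := n) (by rwa [order_linearChange]) S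
  have h2 : (fun i => (S : Matrix (Fin 2) (Fin 2) ℂ) i 1) = ![1, 0] := by
    ext i; fin_cases i <;> simp [S, Matrix.GeneralLinearGroup.mkOfDetNeZero]
  rw [h2, formEval_one_zero] at h1
  rw [← h1, linearChange_mul, coeff_linearChange_snd h]
  congr 1
  ext i
  simp [S, Matrix.GeneralLinearGroup.mkOfDetNeZero, Matrix.mul_apply, Fin.sum_univ_two]

/-- The initial form of degree `n`, dehomogenized. -/
noncomputable def formPoly (b : GermRing) (n : ℕ) : Polynomial ℂ :=
  ∑ i ∈ Finset.range (n + 1), Polynomial.monomial i (MvPowerSeries.coeff (biexp i (n - i)) b)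

theorem coeff_formPoly (b : GermRing) (n i : ℕ) : (formPoly b n).coeff i =
    if i < n + 1 then MvPowerSeries.coeff (biexp i (n - i)) b else 0 := by
  rw [formPoly, Polynomial.finsetSum_coeff]
  simp [Polynomial.coeff_monomial]

theorem eval_formPoly (b : GermRing) (n : ℕ) (t : ℂ) :
    (formPoly b n).eval t = formEval b n ![t, 1] := by
  rw [formPoly, Polynomial.eval_finsetSum, formEval]
  simp

theorem exists_linearChange_regular {b : GermRing} {m : ℕ} (hm : b.order = m) :
    ∃ A : GL (Fin 2) ℂ, MvPowerSeries.coeff (biexp m 0) (linearChange A b) ≠ 0 := by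
  have hne : formPoly b m ≠ 0 := by
    intro h0
    obtain ⟨d, hd, hdeg⟩ := MvPowerSeries.exists_coeff_ne_zero_and_order (f := b) (by rw [hm]; simp)
    rw [hm, degree_fin_two] at hdeg
    have hdeg : d 0 + d 1 = m := by exact_mod_cast hdeg
    have := congrArg (fun p => Polynomial.coeff p (d 0)) h0
    simp only [coeff_formPoly, Polynomial.coeff_zero] at this
    rw [if_pos (by omega), show m - d 0 = d 1 by omega, biexp_eta] at this
    exact hd this
  obtain ⟨t, ht⟩ : ∃ t, (formPoly b m).eval t ≠ 0 := by
    by_contra! h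
    exact hne (Polynomial.funext fun t => by simp [h t])
  refine ⟨Matrix.GeneralLinearGroup.mkOfDetNeZero !![t, 1; 1, 0] (by simp), ?_⟩
  rw [coeff_linearChange_fst hm.ge]
  rw [eval_formPoly] at ht
  convert ht using 2
  ext i; fin_cases i <;> simp [Matrix.GeneralLinearGroup.mkOfDetNeZero]

/-- After a first change the initial form contains x^m, so its dehomogenization has positive degree
and a root t. The shear with columns (1, 0) and (t, 1) then removes y^m and keeps x^m. -/
theorem exists_linearChange_normalized {b : GermRing} {m : ℕ} (hm : b.order = m) (hpos : 1 ≤ m) :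
    ∃ A : GL (Fin 2) ℂ, MvPowerSeries.coeff (biexp m 0) (linearChange A b) ≠ 0 ∧
      MvPowerSeries.coeff (biexp 0 m) (linearChange A b) = 0 := by
  obtain ⟨A, hA⟩ := exists_linearChange_regular hm
  set b' := linearChange A b with hb'
  have hm' : b'.order = m := by rw [hb', order_linearChange, hm]
  have hdeg : (formPoly b' m).degree ≠ 0 := by
    intro h0
    have := Polynomial.coeff_eq_zero_of_degree_lt (p := formPoly b' m) (n := m)
      (by rw [h0]; exact_mod_cast hpos)
    rw [coeff_formPoly, if_pos (by omega), Nat.sub_self] at this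
    exact hA this
  obtain ⟨t, ht⟩ := IsAlgClosed.exists_root _ hdeg
  let B : GL (Fin 2) ℂ := Matrix.GeneralLinearGroup.mkOfDetNeZero !![1, t; 0, 1] (by simp)
  have hB0 : (fun i => (B : Matrix (Fin 2) (Fin 2) ℂ) i 0) = ![1, 0] := by
    ext i; fin_cases i <;> simp [B, Matrix.GeneralLinearGroup.mkOfDetNeZero]
  have hB1 : (fun i => (B : Matrix (Fin 2) (Fin 2) ℂ) i 1) = ![t, 1] := by
    ext i; fin_cases i <;> simp [B, Matrix.GeneralLinearGroup.mkOfDetNeZero]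
  refine ⟨A * B, ?_, ?_⟩
  · rw [← linearChange_mul, ← hb', coeff_linearChange_fst hm'.ge, hB0, formEval_one_zero]
    exact hA
  · rw [← linearChange_mul, ← hb', coeff_linearChange_snd hm'.ge, hB1, ← eval_formPoly]
    exact ht

/-! ### The Newton diagram and the tangent of a branch. -/

/-- The Newton diagram of a branch lies above the segment between its end points. -/
theorem min_le_weightedOrder {b : GermRing} (hb : Irreducible b) {m : ℕ}
    (h : (m : ℕ∞) ≤ b.order) (hm : MvPowerSeries.coeff (biexp m 0) b ≠ 0) (w : Fin 2 → ℕ) :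
    min ((m * w 0 : ℕ) : ℕ∞) ((restrictLine b).order * w 1) ≤ b.weightedOrder w := by
  obtain ⟨P, u, hu, hPu, hmon, hirr, hdeg, -⟩ := exists_weierstrass hb h hm
  have hN : (restrictLine b).order = (P.coeff 0).order := by
    change (PowerSeries.constantCoeff (germEquiv b)).order = _
    rw [hPu, map_mul, PowerSeries.order_mul,
      PowerSeries.order_zero_of_unit (hu.map PowerSeries.constantCoeff), add_zero,
      ← PowerSeries.coeff_zero_eq_constantCoeff_apply, Polynomial.coeff_coe]
  have hbp : b = germEquiv.symm (P : ℂ⟦X⟧⟦X⟧) * germEquiv.symm u := by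
    rw [← map_mul, ← hPu, RingEquiv.symm_apply_apply]
  have hle : (germEquiv.symm (P : ℂ⟦X⟧⟦X⟧)).weightedOrder w ≤ b.weightedOrder w := by
    rw [hbp]
    exact le_self_add.trans (MvPowerSeries.le_weightedOrder_mul w)
  refine le_trans (MvPowerSeries.le_weightedOrder w fun d hd => ?_) hle
  rw [lt_min_iff, hN, weight_fin_two] at hd
  obtain ⟨hd1, hd2⟩ := hd
  have hd1 : d 0 * w 0 + d 1 * w 1 < m * w 0 := by exact_mod_cast hd1
  rw [← biexp_eta d, ← coeff_coeff_germEquiv, RingEquiv.apply_symm_apply, Polynomial.coeff_coe]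
  apply PowerSeries.coeff_of_lt_order
  have hlt : d 0 < m := by
    by_contra! hge
    have := Nat.mul_le_mul_right (w 0) hge
    omega
  have hs := hmon.order_coeff_slope hirr (hdeg.symm ▸ hlt)
  rw [hdeg] at hs
  by_contra! hj
  rcases eq_or_ne (P.coeff 0).order ⊤ with htop | htop
  · rw [htop, ENat.mul_top (Nat.cast_ne_zero.2 (by omega)), top_le_iff] at hs
    have : (m : ℕ∞) * (P.coeff (d 0)).order ≤ m * d 1 := by gcongr
    rw [hs, top_le_iff] at this
    exact ENat.natCast_ne_top (m * d 1) (by exact_mod_cast this)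
  · lift (P.coeff 0).order to ℕ using htop with N
    have hs2 : ((m - d 0 : ℕ) : ℕ∞) * N ≤ m * d 1 := hs.trans (by gcongr)
    have hs3 : (m - d 0) * N ≤ m * d 1 := by exact_mod_cast hs2
    have hd2 : d 0 * w 0 + d 1 * w 1 < N * w 1 := by exact_mod_cast hd2
    obtain ⟨k, rfl⟩ := Nat.exists_eq_add_of_lt hlt
    rw [show d 0 + k + 1 - d 0 = k + 1 by omega] at hs3
    nlinarith [Nat.mul_le_mul_right (w 1) hs3]

/-- The tangent line `t = 0` of a branch `b`, and the resulting form of its intersection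
multiplicities. -/
structure IsTangentBranch (b : GermRing) (m : ℕ) (t : Fin 2 → ℂ) : Prop where
  pos : 1 ≤ m
  order_eq : b.order = m
  ne_zero : t ≠ 0
  transversal : ∀ s : Fin 2 → ℂ, s 0 * t 1 ≠ s 1 * t 0 → contact b (linForm s) = m
  tangent : m < contact b (linForm t)
  initial : ∃ c : ℂ, c ≠ 0 ∧
    ((m + 1 : ℕ) : ℕ∞) ≤ (b - MvPowerSeries.C c * linForm t ^ m).order
  ultra : ∀ c d, min (contact b c) (contact b d) ≤ contact b (c + d)

theorem linearChange_C (A : GL (Fin 2) ℂ) (c : ℂ) :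
    linearChange A (MvPowerSeries.C c) = MvPowerSeries.C c := by
  rw [linearChange_eq, substAlgHom_C]

theorem IsTangentBranch.of_linearChange {A : GL (Fin 2) ℂ} {b : GermRing} {m : ℕ} {t : Fin 2 → ℂ}
    (h : IsTangentBranch (linearChange A b) m (Matrix.vecMul t (A : Matrix (Fin 2) (Fin 2) ℂ))) :
    IsTangentBranch b m t where
  pos := h.pos
  order_eq := by rw [← h.order_eq, order_linearChange]
  ne_zero := by
    rintro rfl
    exact h.ne_zero (Matrix.zero_vecMul _)
  transversal s hs := by
    rw [← contact_linearChange A, linearChange_linForm]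
    apply h.transversal
    have hdet : (A : Matrix (Fin 2) (Fin 2) ℂ).det ≠ 0 := A.det_ne_zero
    rw [Matrix.det_fin_two] at hdet
    simp only [Matrix.vecMul, dotProduct, Fin.sum_univ_two]
    rw [← sub_ne_zero] at hs ⊢
    convert mul_ne_zero hs hdet using 1
    ring
  tangent := by
    rw [← contact_linearChange A, linearChange_linForm]
    exact h.tangent
  initial := by
    obtain ⟨c, hc, h2⟩ := h.initial
    refine ⟨c, hc, ?_⟩
    have e : linearChange A (b - MvPowerSeries.C c * linForm t ^ m) = linearChange A b -
        MvPowerSeries.C c * linForm (Matrix.vecMul t (A : Matrix (Fin 2) (Fin 2) ℂ)) ^ m := by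
      rw [← linearEquiv_apply, map_sub, map_mul, map_pow, linearEquiv_apply, linearEquiv_apply,
        linearEquiv_apply, linearChange_C, linearChange_linForm]
    rwa [← order_linearChange A, e]
  ultra c d := by
    have := h.ultra (linearChange A c) (linearChange A d)
    rwa [← linearEquiv_apply A c, ← linearEquiv_apply A d, ← map_add, linearEquiv_apply,
      linearEquiv_apply, linearEquiv_apply, contact_linearChange, contact_linearChange,
      contact_linearChange] at this

theorem linForm_one_zero : linForm ![1, 0] = MvPowerSeries.X 0 := by
  rw [linForm_eq]; simp

theorem linForm_zero_one : linForm ![0, 1] = MvPowerSeries.X 1 := by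
  rw [linForm_eq]; simp

theorem contact_mul_of_isUnit (b : GermRing) {u : GermRing} (hu : IsUnit u) (c : GermRing) :
    contact b (u * c) = contact b c := by
  rw [contact, contact, Ideal.span_singleton_mul_left_unit hu]

theorem contact_neg (b c : GermRing) : contact b (-c) = contact b c := by
  rw [contact, contact, Ideal.span_singleton_neg]

theorem isUnit_C {a : ℂ} (ha : a ≠ 0) : IsUnit (MvPowerSeries.C a : GermRing) :=
  ha.isUnit.map MvPowerSeries.C

theorem contact_le_contact_of_dvd (b : GermRing) {c d : GermRing} (h : c ∣ d) :
    contact b c ≤ contact b d := by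
  rw [contact, contact, intersectionMultiplicity, intersectionMultiplicity]
  have hle : Ideal.span {b} ⊔ Ideal.span {d} ≤ Ideal.span {b} ⊔ Ideal.span {c} :=
    sup_le_sup_left (Ideal.span_singleton_le_span_singleton.2 h) _
  exact Module.length_le_of_surjective (Submodule.factor hle) (Submodule.factor_surjective hle)

theorem min_contact_le_contact_C_mul_add {b : GermRing}
    (h : ∀ c d, min (contact b c) (contact b d) ≤ contact b (c + d)) (x y : ℂ) (c d : GermRing) :
    min (contact b c) (contact b d) ≤
      contact b (MvPowerSeries.C x * c + MvPowerSeries.C y * d) := by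
  have key (x : ℂ) (c : GermRing) : contact b c ≤ contact b (MvPowerSeries.C x * c) := by
    rcases eq_or_ne x 0 with rfl | hx
    · rw [map_zero, zero_mul]
      exact contact_le_contact_of_dvd b (dvd_zero c)
    · rw [contact_mul_of_isUnit b (isUnit_C hx)]
  exact (min_le_min (key x c) (key y d)).trans (h _ _)

/-- With x^m present and y^m absent, the contact with x = 0 exceeds m while that with y = 0 is m;
all other lines follow from the ultrametric inequality. -/
theorem isTangentBranch_of_normalized {b : GermRing} (hb : Irreducible b) {m : ℕ}
    (hord : b.order = m) (hpos : 1 ≤ m) (hm : MvPowerSeries.coeff (biexp m 0) b ≠ 0)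
    (h0 : MvPowerSeries.coeff (biexp 0 m) b = 0) : IsTangentBranch b m ![1, 0] := by
  have hultra := min_contact_le_contact_add_of_regular hb hord.ge hm
  have hN : ((m + 1 : ℕ) : ℕ∞) ≤ (restrictLine b).order := by
    refine PowerSeries.nat_le_order _ _ fun j hj => ?_
    rw [coeff_restrictLine]
    rcases Nat.lt_succ_iff_lt_or_eq.1 hj with hj | rfl
    · apply MvPowerSeries.coeff_of_lt_order
      rw [hord, degree_fin_two]
      simpa using hj
    · exact h0
  have hlt : (m : ℕ∞) < (m + 1 : ℕ) := by exact_mod_cast Nat.lt_succ_self m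
  have htan : m < contact b (linForm ![1, 0]) := by
    rw [linForm_one_zero, contact_X_zero]
    exact hlt.trans_le hN
  have hX1 : contact b (linForm ![0, 1]) = m := by
    rw [linForm_zero_one, contact_X_one_eq hord.ge hm]
  refine ⟨hpos, hord, by simp, ?_, htan, ⟨MvPowerSeries.coeff (biexp m 0) b, hm, ?_⟩, hultra⟩
  · intro s hs
    have hs1 : s 1 ≠ 0 := by simpa using hs.symm
    apply le_antisymm
    · have e : linForm ![0, 1] = MvPowerSeries.C (s 1)⁻¹ * linForm s +
          MvPowerSeries.C (-(s 1)⁻¹ * s 0) * linForm ![1, 0] := by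
        simp only [linForm_eq, mul_add, ← mul_assoc, ← map_mul, inv_mul_cancel₀ hs1]
        simp
      have := min_contact_le_contact_C_mul_add hultra (s 1)⁻¹ (-(s 1)⁻¹ * s 0)
        (linForm s) (linForm ![1, 0])
      rw [← e, hX1, min_le_iff] at this
      exact this.resolve_right htan.not_ge
    · have e : linForm s = MvPowerSeries.C (s 0) * linForm ![1, 0] +
          MvPowerSeries.C (s 1) * linForm ![0, 1] := by
        simp [linForm_eq]
      have := min_contact_le_contact_C_mul_add hultra (s 0) (s 1) (linForm ![1, 0]) (linForm ![0, 1])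
      rw [← e, hX1, min_eq_right htan.le] at this
      exact this
  -- The diagram lies above the segment from (m, 0) to (0, m + 1). For the weights (m + 1, m) this
  -- line has value m(m + 1), whereas x^i y^(m-i) has value m² + i, which is smaller for i < m. So
  -- only x^m is left in degree m.
  · have hw := min_le_weightedOrder hb hord.ge hm ![m + 1, m]
    have hw2 : ((m * (m + 1) : ℕ) : ℕ∞) ≤ b.weightedOrder ![m + 1, m] := by
      refine le_trans (le_min ?_ ?_) hw
      · exact le_rfl
      · calc ((m * (m + 1) : ℕ) : ℕ∞) = ((m + 1 : ℕ) : ℕ∞) * m := by push_cast; ring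
          _ ≤ _ := by gcongr; exact le_rfl
    refine MvPowerSeries.nat_le_order fun d hd => ?_
    rw [linForm_one_zero, map_sub, MvPowerSeries.X_pow_eq, MvPowerSeries.coeff_C_mul,
      MvPowerSeries.coeff_monomial, sub_eq_zero]
    rw [degree_fin_two] at hd
    have hmm : (Finsupp.single 0 m : Fin 2 →₀ ℕ) = biexp m 0 := by simp [biexp]
    rw [hmm]
    split_ifs with hdm
    · rw [hdm, mul_one]
    · rw [mul_zero]
      rw [eq_biexp_iff] at hdm
      by_cases hd' : d 0 + d 1 < m
      · apply MvPowerSeries.coeff_of_lt_order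
        rw [hord, degree_fin_two]
        exact_mod_cast hd'
      · apply MvPowerSeries.coeff_eq_zero_of_lt_weightedOrder ![m + 1, m]
        refine lt_of_lt_of_le ?_ hw2
        rw [weight_fin_two]
        have h1 : d 0 < m := by omega
        have h2 : d 0 * (m + 1) + d 1 * m < m * (m + 1) := by
          have : d 1 = m - d 0 := by omega
          obtain ⟨k, hk⟩ := Nat.exists_eq_add_of_lt h1
          rw [this, hk, show d 0 + k + 1 - d 0 = k + 1 by omega]
          nlinarith
        exact_mod_cast h2

theorem one_le_order_of_irreducible {b : GermRing} (hb : Irreducible b) : 1 ≤ b.order := by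
  apply one_le_order_of_constantCoeff
  by_contra h
  exact hb.not_isUnit (MvPowerSeries.isUnit_iff_constantCoeff.2 (isUnit_iff_ne_zero.2 h))

/-- A branch has a unique tangent. -/
theorem exists_isTangentBranch {b : GermRing} (hb : Irreducible b) :
    ∃ m t, IsTangentBranch b m t := by
  have hfin : b.order ≠ ⊤ := by rw [Ne, MvPowerSeries.order_eq_top_iff]; exact hb.ne_zero
  obtain ⟨m, hm⟩ := ENat.ne_top_iff_exists.1 hfin
  have hpos : 1 ≤ m := by
    have := one_le_order_of_irreducible hb
    rw [← hm] at this
    exact_mod_cast this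
  obtain ⟨A, h1, h2⟩ := exists_linearChange_normalized hm.symm hpos
  have hb' : Irreducible (linearChange A b) := (MulEquiv.irreducible_iff (linearEquiv A)).2 hb
  have := isTangentBranch_of_normalized hb' (by rw [order_linearChange, hm]) hpos h1 h2
  refine ⟨m, Matrix.vecMul ![1, 0] ((A⁻¹ : GL (Fin 2) ℂ) : Matrix (Fin 2) (Fin 2) ℂ), ?_⟩
  apply IsTangentBranch.of_linearChange (A := A)
  rw [Matrix.vecMul_vecMul]
  have : ((A⁻¹ : GL (Fin 2) ℂ) : Matrix (Fin 2) (Fin 2) ℂ) * (A : Matrix (Fin 2) (Fin 2) ℂ) = 1 := by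
    rw [← Units.val_mul, inv_mul_cancel, Units.val_one]
  rwa [this, Matrix.vecMul_one]

theorem contact_mul_of_not_dvd {b : GermRing} (hb : Irreducible b) {c d : GermRing} (hd : ¬ b ∣ d) :
    contact b (c * d) = contact b c + contact b d := by
  have hp := (Ideal.span_singleton_prime hb.ne_zero).2 hb.prime
  have key (c : GermRing) : contact b c =
      Ring.ord (GermRing ⧸ Ideal.span {b}) (Ideal.Quotient.mk (Ideal.span {b}) c) :=
    contact_eq_ord _ Ideal.Quotient.mk_surjective Ideal.mk_ker c
  rw [key, key, key, map_mul, Ring.ord_mul]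
  apply mem_nonZeroDivisors_of_ne_zero
  rwa [Ne, Ideal.Quotient.eq_zero_iff_dvd]

theorem contact_eq_of_dvd_sub {b c d : GermRing} (h : b ∣ c - d) : contact b c = contact b d := by
  rw [contact, contact, intersectionMultiplicity, intersectionMultiplicity]
  suffices H : Ideal.span {b} ⊔ Ideal.span {c} = Ideal.span {b} ⊔ Ideal.span {d} by rw [H]
  obtain ⟨e, he⟩ := h
  have hc : c = d + b * e := by rw [← he]; ring
  apply le_antisymm <;> refine sup_le le_sup_left ?_ <;>
    rw [Ideal.span_singleton_le_iff_mem]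
  · rw [hc]
    exact add_mem (Ideal.mem_sup_right (Ideal.mem_span_singleton_self d))
      (Ideal.mem_sup_left (Ideal.mul_mem_right _ _ (Ideal.mem_span_singleton_self b)))
  · rw [show d = c - b * e by rw [hc]; ring]
    exact sub_mem (Ideal.mem_sup_right (Ideal.mem_span_singleton_self c))
      (Ideal.mem_sup_left (Ideal.mul_mem_right _ _ (Ideal.mem_span_singleton_self b)))

theorem contact_eq_zero_of_isUnit (b : GermRing) {u : GermRing} (hu : IsUnit u) :
    contact b u = 0 := by
  rw [contact, intersectionMultiplicity, Ideal.span_singleton_eq_top.2 hu, sup_top_eq]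
  exact Module.length_eq_zero

theorem exists_transversal {t : Fin 2 → ℂ} (ht : t ≠ 0) :
    ∃ s : Fin 2 → ℂ, s 0 * t 1 ≠ s 1 * t 0 := by
  by_cases h : t 0 = 0
  · refine ⟨![1, 0], ?_⟩
    have : t 1 ≠ 0 := fun h1 => ht (by ext i; fin_cases i <;> assumption)
    simpa [h] using this
  · exact ⟨![0, 1], by simpa using Ne.symm h⟩

theorem eq_smul_of_parallel {s t : Fin 2 → ℂ} (ht : t ≠ 0) (h : s 0 * t 1 = s 1 * t 0) :
    ∃ a : ℂ, s = a • t := by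
  by_cases h0 : t 0 = 0
  · have h1 : t 1 ≠ 0 := fun h1 => ht (by ext i; fin_cases i <;> assumption)
    refine ⟨s 1 / t 1, ?_⟩
    rw [h0, mul_zero] at h
    have hs := (mul_eq_zero.1 h).resolve_right h1
    ext i; fin_cases i
    · simp [h0, hs]
    · simp [h1]
  · refine ⟨s 0 / t 0, ?_⟩
    ext i; fin_cases i
    · simp [h0]
    · simp only [Fin.mk_one, Pi.smul_apply, smul_eq_mul]
      field_simp
      linear_combination -h

theorem linForm_smul (a : ℂ) (t : Fin 2 → ℂ) : linForm (a • t) = MvPowerSeries.C a * linForm t := by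
  simp only [linForm_eq, Pi.smul_apply, smul_eq_mul, map_mul]
  ring

theorem exists_eq_linForm_add {c : GermRing} (hc : MvPowerSeries.constantCoeff c = 0) :
    ∃ (s : Fin 2 → ℂ) (r : GermRing), c = linForm s + r ∧ 2 ≤ r.order := by
  refine ⟨![MvPowerSeries.coeff (biexp 1 0) c, MvPowerSeries.coeff (biexp 0 1) c], c - linForm _,
    (add_sub_cancel _ _).symm, ?_⟩
  have := order_sub_sum_monomial (b := c) (n := 1) (one_le_order_of_constantCoeff hc)
  refine le_of_le_of_eq (by exact_mod_cast this) (congrArg (fun u => (c - u).order) ?_)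
  symm
  rw [linForm_eq, Finset.sum_range_succ, Finset.sum_range_one]
  have hX (i : Fin 2) (a : ℂ) : (MvPowerSeries.C a * MvPowerSeries.X i : GermRing) =
      MvPowerSeries.monomial (Finsupp.single i 1) a := by
    rw [MvPowerSeries.X_def, ← MvPowerSeries.monomial_zero_eq_C_apply,
      MvPowerSeries.monomial_mul_monomial, zero_add, mul_one]
  rw [hX, hX, add_comm]
  simp [biexp]

/-- Monomials divisible by x go to p and pure powers of y to q; the constant term is zero because
the order is positive. -/
theorem exists_eq_X_mul_add {c : GermRing} {n : ℕ} (hc : ((n + 1 : ℕ) : ℕ∞) ≤ c.order) :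
    ∃ p q : GermRing, c = p * MvPowerSeries.X 0 + q * MvPowerSeries.X 1 ∧
      (n : ℕ∞) ≤ p.order ∧ (n : ℕ∞) ≤ q.order := by
  let p : GermRing := fun d => MvPowerSeries.coeff (d + Finsupp.single 0 1) c
  let q : GermRing := fun d => if d 0 = 0 then MvPowerSeries.coeff (d + Finsupp.single 1 1) c else 0
  have hp (d) : MvPowerSeries.coeff d p = MvPowerSeries.coeff (d + Finsupp.single 0 1) c := rfl
  have hq (d) : MvPowerSeries.coeff d q =
    if d 0 = 0 then MvPowerSeries.coeff (d + Finsupp.single 1 1) c else 0 := rfl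
  have hvan (d : Fin 2 →₀ ℕ) (hd : d 0 + d 1 < n + 1) : MvPowerSeries.coeff d c = 0 := by
    apply MvPowerSeries.coeff_of_lt_order
    refine lt_of_lt_of_le ?_ hc
    rw [degree_fin_two]; exact_mod_cast hd
  refine ⟨p, q, MvPowerSeries.ext fun d => ?_, ?_, ?_⟩
  · rw [map_add]
    by_cases h0 : d 0 = 0
    · have e0 : MvPowerSeries.coeff d (p * MvPowerSeries.X 0) = 0 := by
        rw [MvPowerSeries.X_def, MvPowerSeries.coeff_mul_monomial, if_neg]
        intro h
        have := h 0
        simp [h0] at this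
      rw [e0, zero_add]
      by_cases h1 : d 1 = 0
      · rw [hvan d (by omega), MvPowerSeries.X_def, MvPowerSeries.coeff_mul_monomial, if_neg]
        intro h
        have := h 1
        simp [h1] at this
      · have hd : d = Finsupp.single 1 (d 1 - 1) + Finsupp.single 1 1 := by
          rw [← Finsupp.single_add, Nat.sub_add_cancel (Nat.one_le_iff_ne_zero.2 h1)]
          ext i; fin_cases i <;> simp [h0]
        rw [hd, MvPowerSeries.X_def, MvPowerSeries.coeff_add_mul_monomial, mul_one, hq, if_pos (by simp)]
    · have hd : d = biexp (d 0 - 1) (d 1) + Finsupp.single 0 1 := by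
        ext i; fin_cases i
        · simp; omega
        · simp
      have e1 : MvPowerSeries.coeff d (q * MvPowerSeries.X 1) = 0 := by
        rw [MvPowerSeries.X_def, MvPowerSeries.coeff_mul_monomial]
        split_ifs with h
        · rw [hq, if_neg (by simpa using h0), zero_mul]
        · rfl
      rw [e1, add_zero]
      conv_rhs => rw [hd]
      rw [MvPowerSeries.X_def, MvPowerSeries.coeff_add_mul_monomial, mul_one, hp, ← hd]
  · refine MvPowerSeries.nat_le_order fun d hd => ?_
    rw [degree_fin_two] at hd
    rw [hp, hvan]
    simp; omega
  · refine MvPowerSeries.nat_le_order fun d hd => ?_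
    rw [degree_fin_two] at hd
    rw [hq, hvan]
    · simp
    · simp; omega

/-! ### Contact of a branch with lines and with other germs. -/

namespace IsTangentBranch

variable {b : GermRing} {m : ℕ} {t : Fin 2 → ℂ} (h : IsTangentBranch b m t)
include h

theorem contact_linForm_ge (s : Fin 2 → ℂ) : (m : ℕ∞) ≤ contact b (linForm s) := by
  by_cases hs : s 0 * t 1 = s 1 * t 0
  · obtain ⟨a, rfl⟩ := eq_smul_of_parallel h.ne_zero hs
    rw [linForm_smul]
    exact h.tangent.le.trans (contact_le_contact_of_dvd b (dvd_mul_left _ _))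
  · exact (h.transversal s hs).ge

theorem not_dvd_linForm {s : Fin 2 → ℂ} (hs : s 0 * t 1 ≠ s 1 * t 0) : ¬ b ∣ linForm s := by
  intro hd
  have h1 : contact b 0 = m := by
    rw [← h.transversal s hs]
    exact (contact_eq_of_dvd_sub (by simpa using hd)).symm
  have h2 := contact_le_contact_of_dvd b (dvd_zero (linForm t))
  rw [h1] at h2
  exact absurd h.tangent h2.not_gt

/-- The powers of a transversal linear form have the contacts k · m, and each of them bounds the
contact with 0 from below. -/
theorem contact_eq_top (hb : Irreducible b) {c : GermRing} (hc : b ∣ c) : contact b c = ⊤ := by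
  rw [contact_eq_of_dvd_sub (d := 0) (by simpa using hc)]
  obtain ⟨s, hs⟩ := exists_transversal h.ne_zero
  have hpow (k : ℕ) : contact b (linForm s ^ k) = (k * m : ℕ) := by
    induction k with
    | zero => rw [pow_zero, contact_eq_zero_of_isUnit b isUnit_one]; simp
    | succ k ih =>
      rw [pow_succ, contact_mul_of_not_dvd hb (h.not_dvd_linForm hs), ih, h.transversal s hs]
      push_cast; ring
  rw [ENat.eq_top_iff_forall_ge]
  intro n
  calc (n : ℕ∞) ≤ (n * m : ℕ) := by exact_mod_cast Nat.le_mul_of_pos_right n h.pos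
    _ = contact b (linForm s ^ n) := (hpow n).symm
    _ ≤ contact b 0 := contact_le_contact_of_dvd b (dvd_zero _)

theorem contact_mul (hb : Irreducible b) (c d : GermRing) :
    contact b (c * d) = contact b c + contact b d := by
  by_cases hd : b ∣ d
  · rw [h.contact_eq_top hb hd, h.contact_eq_top hb (hd.mul_left c), add_top]
  · exact contact_mul_of_not_dvd hb hd

theorem contact_pow (hb : Irreducible b) (c : GermRing) (n : ℕ) :
    contact b (c ^ n) = n * contact b c := by
  induction n with
  | zero => rw [pow_zero, contact_eq_zero_of_isUnit b isUnit_one]; simp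
  | succ k ih => rw [pow_succ, h.contact_mul hb, ih]; push_cast; ring

/-- Each coordinate has contact at least m, and a germ of order n is written with n coordinate
factors in every term. -/
theorem mul_le_contact (hb : Irreducible b) (n : ℕ) :
    ∀ c : GermRing, (n : ℕ∞) ≤ c.order → ((n * m : ℕ) : ℕ∞) ≤ contact b c := by
  induction n with
  | zero => simp
  | succ n ih =>
    intro c hc
    obtain ⟨p, q, rfl, hp, hq⟩ := exists_eq_X_mul_add hc
    refine le_trans (le_min ?_ ?_) (h.ultra _ _)
    · rw [h.contact_mul hb, ← linForm_one_zero, Nat.succ_mul]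
      push_cast
      exact add_le_add (by exact_mod_cast ih p hp) (h.contact_linForm_ge _)
    · rw [h.contact_mul hb, ← linForm_zero_one, Nat.succ_mul]
      push_cast
      exact add_le_add (by exact_mod_cast ih q hq) (h.contact_linForm_ge _)

theorem contact_add_of_lt {c d : GermRing} (hlt : contact b c < contact b d) :
    contact b (c + d) = contact b c := by
  apply le_antisymm
  · have := h.ultra (c + d) (-d)
    rw [add_neg_cancel_right, contact_neg, min_le_iff] at this
    exact this.resolve_right hlt.not_ge
  · have := h.ultra c d
    rwa [min_eq_left hlt.le] at this

/-- Write c = a sⁿ + r with r of order above n. The remainder has contact at least (n + 1)m > mn,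
and the power of the linear form s has contact n(b·s), which is mn exactly when s is transversal to
b. -/
theorem contact_eq_mul_iff (hb : Irreducible b) {c : GermRing} {n : ℕ} {s : Fin 2 → ℂ}
    (hc : IsTangentBranch c n s) :
    contact b c = (m * n : ℕ) ↔ s 0 * t 1 ≠ s 1 * t 0 := by
  obtain ⟨a, ha, hr⟩ := hc.initial
  set r := c - MvPowerSeries.C a * linForm s ^ n with hrdef
  have hcr : c = MvPowerSeries.C a * linForm s ^ n + r := by rw [hrdef]; ring
  have h1 := h.mul_le_contact hb (n + 1) r hr
  have h2 : contact b (MvPowerSeries.C a * linForm s ^ n) = n * contact b (linForm s) := by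
    rw [contact_mul_of_isUnit b (isUnit_C ha), h.contact_pow hb]
  have hlt : ((m * n : ℕ) : ℕ∞) < ((n + 1) * m : ℕ) := by
    have := h.pos
    exact_mod_cast (by nlinarith : m * n < (n + 1) * m)
  constructor
  · intro heq hs
    obtain ⟨e, rfl⟩ := eq_smul_of_parallel h.ne_zero hs
    have h3 : ((m * n + 1 : ℕ) : ℕ∞) ≤ n * contact b (linForm (e • t)) := by
      have h4 : ((m + 1 : ℕ) : ℕ∞) ≤ contact b (linForm (e • t)) := by
        rw [linForm_smul]
        refine le_trans ?_ (contact_le_contact_of_dvd b (dvd_mul_left _ _))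
        exact_mod_cast Order.add_one_le_of_lt h.tangent
      calc ((m * n + 1 : ℕ) : ℕ∞) ≤ (n * (m + 1) : ℕ) := by
            have := hc.pos
            exact_mod_cast (by nlinarith : m * n + 1 ≤ n * (m + 1))
        _ = n * ((m + 1 : ℕ) : ℕ∞) := by push_cast; ring
        _ ≤ _ := by gcongr
    have h5 := h.ultra (MvPowerSeries.C a * linForm (e • t) ^ n) r
    rw [← hcr, heq, h2, min_le_iff] at h5
    rcases h5 with h5 | h5
    · have := h3.trans h5
      exact absurd this (by exact_mod_cast (Nat.lt_succ_self _).not_ge)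
    · exact absurd (hlt.trans_le h1) h5.not_gt
  · intro hs
    rw [h.transversal s hs] at h2
    have h3 : contact b (MvPowerSeries.C a * linForm s ^ n) = (m * n : ℕ) := by
      rw [h2]; push_cast; ring
    rw [hcr, h.contact_add_of_lt (by rw [h3]; exact hlt.trans_le h1), h3]

/-- Terms of order at least 2 have contact at least 2m, so a contact n below 2m comes from the
linear part. As n exceeds m, that part is a multiple of the tangent. -/
theorem contact_tangent_eq_of_lt (hb : Irreducible b) {c : GermRing} {n : ℕ} (hc : contact b c = n)
    (h1 : m < n) (h2 : n < 2 * m) : contact b (linForm t) = n := by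
  have hc0 : MvPowerSeries.constantCoeff c = 0 := by
    by_contra hne
    rw [contact_eq_zero_of_isUnit b
      (MvPowerSeries.isUnit_iff_constantCoeff.2 (isUnit_iff_ne_zero.2 hne))] at hc
    have : 0 = n := by exact_mod_cast hc
    omega
  obtain ⟨s, r, rfl, hr⟩ := exists_eq_linForm_add hc0
  have hr2 := h.mul_le_contact hb 2 r hr
  have hlt : contact b (linForm s + r) < contact b (-r) := by
    rw [hc, contact_neg]
    refine lt_of_lt_of_le ?_ hr2
    exact_mod_cast h2
  have hs : contact b (linForm s) = n := by
    rw [← hc, ← h.contact_add_of_lt hlt, add_neg_cancel_right]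
  have hpar : s 0 * t 1 = s 1 * t 0 := by
    by_contra hne
    rw [h.transversal s hne] at hs
    have : m = n := by exact_mod_cast hs
    omega
  obtain ⟨a, rfl⟩ := eq_smul_of_parallel h.ne_zero hpar
  have ha : a ≠ 0 := by
    rintro rfl
    rw [zero_smul, show linForm 0 = 0 by simp [linForm], h.contact_eq_top hb (dvd_zero b)] at hs
    exact ENat.top_ne_natCast n hs
  rwa [linForm_smul, contact_mul_of_isUnit b (isUnit_C ha)] at hs

theorem le_of_mem_valueSemigroup (hb : Irreducible b) {n : ℕ}
    (hn : n ∈ valueSemigroup (Ideal.span {b})) (h0 : n ≠ 0) : m ≤ n := by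
  obtain ⟨c, hc⟩ := hn
  change contact b c = n at hc
  have hc0 : MvPowerSeries.constantCoeff c = 0 := by
    by_contra hne
    rw [contact_eq_zero_of_isUnit b
      (MvPowerSeries.isUnit_iff_constantCoeff.2 (isUnit_iff_ne_zero.2 hne))] at hc
    exact h0 (by exact_mod_cast hc.symm)
  have := h.mul_le_contact hb 1 c (one_le_order_of_constantCoeff hc0)
  rw [hc, one_mul] at this
  exact_mod_cast this

theorem mem_valueSemigroup : m ∈ valueSemigroup (Ideal.span {b}) := by
  obtain ⟨s, hs⟩ := exists_transversal h.ne_zero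
  exact ⟨linForm s, h.transversal s hs⟩

/-- The multiplicity is the least nonzero element of the value semigroup. -/
theorem multiplicity_eq (hb : Irreducible b) {c : GermRing} (hc : Irreducible c) {n : ℕ}
    {s : Fin 2 → ℂ} (h' : IsTangentBranch c n s)
    (hsg : valueSemigroup (Ideal.span {b}) = valueSemigroup (Ideal.span {c})) : m = n := by
  have h1 := h.le_of_mem_valueSemigroup hb (hsg ▸ h'.mem_valueSemigroup) (by have := h'.pos; omega)
  have h2 := h'.le_of_mem_valueSemigroup hc (hsg ▸ h.mem_valueSemigroup) (by have := h.pos; omega)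
  omega

theorem weightedOrder_eq (hb : Irreducible b) (w : Fin 2 → ℕ) (hw : w 1 ≤ w 0) (hw1 : 0 < w 1) :
    b.weightedOrder w = min ((m * w 0 : ℕ) : ℕ∞) (contact b (MvPowerSeries.X 0) * w 1) := by
  have hord := h.order_eq
  by_cases hm : MvPowerSeries.coeff (biexp m 0) b ≠ 0
  · rw [contact_X_zero]
    refine le_antisymm (le_min ?_ ?_) (min_le_weightedOrder hb hord.ge hm w)
    · refine (MvPowerSeries.weightedOrder_le w hm).trans ?_
      rw [weight_fin_two]; simp
    · rcases eq_or_ne (restrictLine b).order ⊤ with htop | htop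
      · rw [htop, ENat.top_mul (Nat.cast_ne_zero.2 hw1.ne')]
        exact le_top
      · obtain ⟨N, hN⟩ := ENat.ne_top_iff_exists.1 htop
        have := ((PowerSeries.order_eq_nat).1 hN.symm).1
        rw [coeff_restrictLine] at this
        refine (MvPowerSeries.weightedOrder_le w this).trans ?_
        rw [weight_fin_two, ← hN]; simp
  -- If x^m is absent, the initial form is a multiple of y^m. Then (b·x) = m, and since w₁ ≤ w₀ both
  -- sides equal m w₁.
  · obtain ⟨c, hc, hr⟩ := h.initial
    have hcoef (d : Fin 2 →₀ ℕ) (hd : d 0 + d 1 = m) : MvPowerSeries.coeff d b =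
        MvPowerSeries.coeff d (MvPowerSeries.C c * linForm t ^ m) := by
      rw [← sub_eq_zero, ← map_sub]
      apply MvPowerSeries.coeff_of_lt_order
      refine lt_of_lt_of_le ?_ hr
      rw [degree_fin_two, hd]; exact_mod_cast Nat.lt_succ_self m
    have ht0 : t 0 = 0 := by
      by_contra ht0
      apply hm
      rw [hcoef _ (by simp), MvPowerSeries.coeff_C_mul, ← coeff_germSwap, ← coeff_restrictLine,
        map_pow, map_pow]
      have : restrictLine (germSwap (linForm t)) = PowerSeries.C (t 0) * PowerSeries.X := by
        have hC (a : ℂ) : germSwap (MvPowerSeries.C a) = MvPowerSeries.C a :=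
          (MvPowerSeries.renameEquiv ℂ (Equiv.swap (0 : Fin 2) 1)).commutes a
        have e : germSwap (linForm t) = linForm ![t 1, t 0] := by
          rw [linForm_eq, map_add, map_mul, map_mul, hC, hC, germSwap_X_zero, germSwap_X_one,
            linForm_eq, add_comm]
          rfl
        rw [e, restrictLine_linForm]; rfl
      rw [this, mul_pow, ← map_pow, PowerSeries.coeff_C_mul, PowerSeries.coeff_X_pow_self, mul_one]
      exact mul_ne_zero hc (pow_ne_zero _ ht0)
    have ht1 : t 1 ≠ 0 := fun h1 => h.ne_zero (by ext i; fin_cases i <;> assumption)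
    have hX0 : contact b (MvPowerSeries.X 0) = m := by
      rw [← linForm_one_zero]
      exact h.transversal _ (by simpa using ht1)
    have hm1 : MvPowerSeries.coeff (biexp 0 m) b ≠ 0 := by
      rw [hcoef _ (by simp), MvPowerSeries.coeff_C_mul, ← coeff_restrictLine, map_pow,
        restrictLine_linForm, mul_pow, ← map_pow, PowerSeries.coeff_C_mul,
        PowerSeries.coeff_X_pow_self, mul_one]
      exact mul_ne_zero hc (pow_ne_zero _ ht1)
    rw [hX0]
    have hmin : min ((m * w 0 : ℕ) : ℕ∞) (m * w 1) = (m * w 1 : ℕ) := by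
      rw [min_eq_right]
      · push_cast; rfl
      · exact_mod_cast Nat.mul_le_mul_left m hw
    rw [hmin]
    apply le_antisymm
    · refine (MvPowerSeries.weightedOrder_le w hm1).trans ?_
      rw [weight_fin_two]; simp
    · refine MvPowerSeries.nat_le_weightedOrder w fun d hd => ?_
      apply MvPowerSeries.coeff_of_lt_order
      rw [hord, degree_fin_two]
      rw [weight_fin_two] at hd
      by_contra hge
      have hge : m ≤ d 0 + d 1 := by
        rw [not_lt] at hge; exact_mod_cast hge
      nlinarith [Nat.mul_le_mul_left (d 0) hw]

end IsTangentBranch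

/-! ### Equisingularity under automorphisms and decomposition into branches. -/

theorem valueSemigroup_map (e : GermRing ≃+* GermRing) (P : Ideal GermRing) :
    valueSemigroup (P.map e) = valueSemigroup P := by
  have key (h : GermRing) : intersectionMultiplicity (P.map e) (Ideal.span {e h}) =
      intersectionMultiplicity P (Ideal.span {h}) := by
    rw [← intersectionMultiplicity_map e P, Ideal.map_span, Set.image_singleton]
  ext n
  constructor
  · rintro ⟨h, hh⟩
    refine ⟨e.symm h, ?_⟩
    rw [← key, e.apply_symm_apply, hh]
  · rintro ⟨h, hh⟩
    exact ⟨e h, by rw [key, hh]⟩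

theorem map_mem_branches (e : GermRing ≃+* GermRing) {g : GermRing} {P : Ideal GermRing}
    (hP : P ∈ branches g) : P.map e ∈ branches (e g) := by
  obtain ⟨b, hb, hdvd, rfl⟩ := hP
  refine ⟨e b, (MulEquiv.irreducible_iff e).2 hb, (map_dvd_iff e).2 hdvd, ?_⟩
  rw [Ideal.map_span, Set.image_singleton]

theorem squarefree_map (e : GermRing ≃+* GermRing) {g : GermRing} (hg : Squarefree g) :
    Squarefree (e g) := by
  intro x hx
  have h1 : e.symm x * e.symm x ∣ g := by
    rw [← map_mul, ← map_dvd_iff e, e.apply_symm_apply]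
    exact hx
  simpa using (hg _ h1).map e

/-- The branches of the image of a germ under an automorphism. -/
noncomputable def branchesEquiv (e : GermRing ≃+* GermRing) (g : GermRing) :
    branches (e g) ≃ branches g where
  toFun P := ⟨(P : Ideal GermRing).map e.symm, by
    simpa using map_mem_branches e.symm P.2⟩
  invFun P := ⟨(P : Ideal GermRing).map e, map_mem_branches e P.2⟩
  left_inv P := Subtype.ext (by simp [Ideal.map_symm, Ideal.map_comap_of_surjective _ e.surjective])
  right_inv P := Subtype.ext (by simp [Ideal.map_symm, Ideal.comap_map_of_bijective _ e.bijective])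

theorem Equisingular.map_left (e : GermRing ≃+* GermRing) {g h : GermRing}
    (H : Equisingular g h) : Equisingular (e g) h := by
  obtain ⟨hg, hh, σ, h1, h2⟩ := H
  refine ⟨squarefree_map e hg, hh, (branchesEquiv e g).trans σ, fun P => ?_, fun P Q hPQ => ?_⟩
  · rw [Equiv.trans_apply, ← h1]
    exact (valueSemigroup_map e.symm _).symm
  · rw [Equiv.trans_apply, Equiv.trans_apply, ← h2 _ _ ((branchesEquiv e g).injective.ne hPQ)]
    exact (intersectionMultiplicity_map e.symm _ _).symm

theorem Equisingular.refl {g : GermRing} (hg : Squarefree g) : Equisingular g g :=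
  ⟨hg, hg, Equiv.refl _, fun _ => rfl, fun _ _ _ => rfl⟩

instance isDomain_germRing : IsDomain GermRing := NoZeroDivisors.to_isDomain _

theorem finite_branches {g : GermRing} (hg : g ≠ 0) : (branches g).Finite := by
  refine Set.Finite.subset (s := (fun b => Ideal.span {b}) '' {b | b ∈ UniqueFactorizationMonoid.factors g})
    (Set.Finite.image _ (Multiset.finite_toSet _)) ?_
  rintro _ ⟨b, hb, hdvd, rfl⟩
  obtain ⟨q, hq, hbq⟩ := UniqueFactorizationMonoid.exists_mem_factors_of_dvd hg hb hdvd
  exact ⟨q, hq, (Ideal.span_singleton_eq_span_singleton.2 hbq).symm⟩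

/-- An equation of a branch. -/
noncomputable def branchGen {g : GermRing} (P : branches g) : GermRing := P.2.choose

theorem irreducible_branchGen {g : GermRing} (P : branches g) : Irreducible (branchGen P) :=
  P.2.choose_spec.1

theorem branchGen_dvd {g : GermRing} (P : branches g) : branchGen P ∣ g := P.2.choose_spec.2.1

theorem span_branchGen {g : GermRing} (P : branches g) :
    Ideal.span {branchGen P} = (P : Ideal GermRing) := P.2.choose_spec.2.2.symm

/-- Distinct branches have non-associated equations, so their product divides g; an irreducible
factor of the cofactor would occur twice in the squarefree germ g. -/
theorem associated_prod_branchGen {g : GermRing} (hg : Squarefree g) [Fintype (branches g)] :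
    Associated (∏ P : branches g, branchGen P) g := by
  have hdvd (s : Finset (branches g)) : (∏ P ∈ s, branchGen P) ∣ g := by
    classical
    induction s using Finset.induction_on with
    | empty => simp
    | insert Q s hQ ih =>
      obtain ⟨c, hc⟩ := ih
      have hprime := (irreducible_branchGen Q).prime
      rcases hprime.dvd_or_dvd ((branchGen_dvd Q).trans hc.dvd) with h | h
      · obtain ⟨P, hP, hQP⟩ := (hprime.dvd_finsetProd_iff _).1 h
        have := (irreducible_branchGen Q).associated_of_dvd (irreducible_branchGen P) hQP
        rw [← Ideal.span_singleton_eq_span_singleton, span_branchGen, span_branchGen] at this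
        exact absurd (Subtype.ext this ▸ hP) hQ
      · rw [Finset.prod_insert hQ, mul_comm]
        conv_rhs => rw [hc]
        exact mul_dvd_mul_left _ h
  obtain ⟨c, hc⟩ := hdvd Finset.univ
  have hu : IsUnit c := by
    by_contra hu
    have hc0 : c ≠ 0 := by
      rintro rfl
      rw [mul_zero] at hc
      exact hg.ne_zero hc
    obtain ⟨q, hq, hqc⟩ := WfDvdMonoid.exists_irreducible_factor hu hc0
    have hqg : q ∣ g := hc ▸ hqc.mul_left _
    let P : branches g := ⟨Ideal.span {q}, q, hq, hqg, rfl⟩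
    have h1 : q ∣ ∏ P : branches g, branchGen P := by
      refine dvd_trans ?_ (Finset.dvd_prod_of_mem _ (Finset.mem_univ P))
      exact (Ideal.span_singleton_eq_span_singleton.1 (span_branchGen P)).symm.dvd
    refine hq.not_isUnit (hg q ?_)
    rw [hc]
    exact mul_dvd_mul h1 hqc
  refine ⟨hu.unit, ?_⟩
  rw [IsUnit.unit_spec, ← hc]

theorem weightedOrder_eq_of_associated (w : Fin 2 → ℕ) {b c : GermRing} (h : Associated b c) :
    b.weightedOrder w = c.weightedOrder w := by
  obtain ⟨u, rfl⟩ := h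
  rw [MvPowerSeries.weightedOrder_mul]
  have : (u : GermRing).weightedOrder w = 0 := by
    rw [← nonpos_iff_eq_zero]
    have h1 : MvPowerSeries.coeff 0 (u : GermRing) ≠ 0 := by
      rw [MvPowerSeries.coeff_zero_eq_constantCoeff]
      exact (MvPowerSeries.isUnit_iff_constantCoeff.1 u.isUnit).ne_zero
    simpa using MvPowerSeries.weightedOrder_le w h1
  rw [this, add_zero]

theorem weightedOrder_linearChange_eq_sum {g : GermRing} (hg : Squarefree g)
    [Fintype (branches g)] (A : GL (Fin 2) ℂ) (w : Fin 2 → ℕ) :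
    (linearChange A g).weightedOrder w =
      ∑ P : branches g, (linearChange A (branchGen P)).weightedOrder w := by
  rw [← linearEquiv_apply, ← weightedOrder_eq_of_associated w
    ((associated_prod_branchGen hg).map (linearEquiv A)), map_prod]
  exact MvPowerSeries.weightedOrder_prod _ _ _

theorem weightedOrder_eq_sum {g : GermRing} (hg : Squarefree g)
    [Fintype (branches g)] (w : Fin 2 → ℕ) :
    g.weightedOrder w = ∑ P : branches g, (branchGen P).weightedOrder w := by
  simpa only [linearChange_one] using weightedOrder_linearChange_eq_sum hg 1 w

/-! ### Matching tangent directions with the coordinate axes. -/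

/-- Proportionality of two vectors of the plane. -/
def Parallel (s t : Fin 2 → ℂ) : Prop := s 0 * t 1 = s 1 * t 0

theorem Parallel.symm {s t : Fin 2 → ℂ} (h : Parallel s t) : Parallel t s := by
  unfold Parallel at *; linear_combination -h

theorem Parallel.trans {s t u : Fin 2 → ℂ} (ht : t ≠ 0) (h : Parallel s t) (h' : Parallel t u) :
    Parallel s u := by
  obtain ⟨a, rfl⟩ := eq_smul_of_parallel ht h
  unfold Parallel at *
  simp only [Pi.smul_apply, smul_eq_mul]
  linear_combination a * h'

theorem exists_forall_not_parallel {ι : Type*} [Finite ι] (t : ι → Fin 2 → ℂ) (ht : ∀ i, t i ≠ 0) :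
    ∃ s : Fin 2 → ℂ, s ≠ 0 ∧ ∀ i, ¬ Parallel s (t i) := by
  obtain ⟨c, hc⟩ := (Set.finite_range fun i => t i 1 / t i 0).exists_notMem
  refine ⟨![1, c], fun h => by simpa using congrFun h 0, fun i h => ?_⟩
  have h1 : t i 1 = c * t i 0 := by simpa [Parallel] using h
  have h0 : t i 0 ≠ 0 := fun h0 => ht i (by
    ext j; fin_cases j
    · exact h0
    · simpa [h0] using h1)
  exact hc ⟨i, by simp only [h1]; field_simp⟩

/-- If r is the direction of some t' i, take t i; otherwise take a direction avoiding all the t i.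
-/
theorem exists_parallel_iff {ι : Type*} [Finite ι] (t t' : ι → Fin 2 → ℂ) (ht : ∀ i, t i ≠ 0)
    (ht' : ∀ i, t' i ≠ 0) (h : ∀ i j, Parallel (t i) (t j) ↔ Parallel (t' i) (t' j))
    {r : Fin 2 → ℂ} (hr0 : r ≠ 0) : ∃ s : Fin 2 → ℂ, s ≠ 0 ∧ ∀ i, Parallel s (t i) ↔ Parallel r (t' i) := by
  by_cases hr : ∃ i, Parallel r (t' i)
  · obtain ⟨i, hi⟩ := hr
    refine ⟨t i, ht i, fun j => (h i j).trans ⟨fun hj => hi.trans (ht' i) hj, hi.symm.trans hr0⟩⟩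
  · obtain ⟨s, hs, hst⟩ := exists_forall_not_parallel t ht
    exact ⟨s, hs, fun i => ⟨fun hi => absurd hi (hst i), fun hi => absurd ⟨i, hi⟩ hr⟩⟩


theorem exists_pair_parallel_iff {ι : Type*} [Finite ι] (t t' : ι → Fin 2 → ℂ)
    (ht : ∀ i, t i ≠ 0) (ht' : ∀ i, t' i ≠ 0)
    (h : ∀ i j, Parallel (t i) (t j) ↔ Parallel (t' i) (t' j)) {r₁ r₂ : Fin 2 → ℂ}
    (hr₁ : r₁ ≠ 0) (hr₂ : r₂ ≠ 0) (hr : ¬ Parallel r₁ r₂) :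
    ∃ s₁ s₂ : Fin 2 → ℂ, s₁ ≠ 0 ∧ s₂ ≠ 0 ∧ ¬ Parallel s₁ s₂ ∧
      (∀ i, Parallel s₁ (t i) ↔ Parallel r₁ (t' i)) ∧
      ∀ i, Parallel s₂ (t i) ↔ Parallel r₂ (t' i) := by
  obtain ⟨s₁, hs₁, H₁⟩ := exists_parallel_iff t t' ht ht' h hr₁
  -- Adjoining the pair s₁, r₁ to the two families makes the second vector independent of the first.
  obtain ⟨s₂, hs₂, H₂⟩ := exists_parallel_iff (fun i : Option ι => i.elim s₁ t)
    (fun i => i.elim r₁ t') (by rintro (_ | i) <;> simp [*]) (by rintro (_ | i) <;> simp [*])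
    (by
      rintro (_ | i) (_ | j)
      · simp [Parallel, mul_comm]
      · exact H₁ j
      · exact ⟨fun hp => ((H₁ i).1 hp.symm).symm, fun hp => ((H₁ i).2 hp.symm).symm⟩
      · exact h i j) hr₂
  exact ⟨s₁, s₂, hs₁, hs₂, fun hp => hr ((H₂ none).1 hp.symm).symm, H₁, fun i => H₂ (some i)⟩

/-! ### Weighted orders of corresponding branches. -/

namespace IsTangentBranch

theorem weightedOrder_eq_swap {b : GermRing} {m : ℕ} {t : Fin 2 → ℂ} (h : IsTangentBranch b m t)
    (hb : Irreducible b) (w : Fin 2 → ℕ) (hw : w 0 ≤ w 1) (hw0 : 0 < w 0) :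
    b.weightedOrder w = min ((m * w 1 : ℕ) : ℕ∞) (contact b (MvPowerSeries.X 1) * w 0) := by
  have hb' : Irreducible (germSwap b) := (MulEquiv.irreducible_iff germSwap).2 hb
  obtain ⟨m', t', h'⟩ := exists_isTangentBranch hb'
  have hm : m' = m := by
    have := h'.order_eq
    rw [order_germSwap, h.order_eq] at this
    exact_mod_cast this.symm
  have := h'.weightedOrder_eq hb' ![w 1, w 0] hw hw0
  rw [weightedOrder_germSwap] at this
  rw [← contact_map germSwap, germSwap_X_one, ← hm]
  have e : ![(![w 1, w 0] : Fin 2 → ℕ) 1, (![w 1, w 0] : Fin 2 → ℕ) 0] = w := by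
    ext i; fin_cases i <;> rfl
  rwa [e] at this

theorem contact_linForm_of_parallel {b : GermRing} {m : ℕ} {t : Fin 2 → ℂ}
    (h : IsTangentBranch b m t) {s : Fin 2 → ℂ} (hs : s ≠ 0) (hst : Parallel s t) :
    contact b (linForm s) = contact b (linForm t) := by
  obtain ⟨a, rfl⟩ := eq_smul_of_parallel h.ne_zero hst
  rw [linForm_smul, contact_mul_of_isUnit b (isUnit_C _)]
  rintro rfl
  exact hs (zero_smul _ _)

theorem contact_tangent_eq {b c : GermRing} {m : ℕ} {s t : Fin 2 → ℂ}
    (hb : IsTangentBranch b m s) (hc : IsTangentBranch c m t) (hc' : Irreducible c)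
    (hsg : valueSemigroup (Ideal.span {b}) = valueSemigroup (Ideal.span {c}))
    (hlt : contact b (linForm s) < (2 * m : ℕ)) :
    contact c (linForm t) = contact b (linForm s) := by
  obtain ⟨n, hn⟩ := ENat.ne_top_iff_exists.1 (ne_top_of_lt hlt)
  rw [← hn] at hlt
  have hmem : n ∈ valueSemigroup (Ideal.span {c}) := hsg ▸ ⟨linForm s, hn.symm⟩
  obtain ⟨d, hd⟩ := hmem
  have h1 := hb.tangent
  rw [← hn] at h1
  rw [← hn]
  exact hc.contact_tangent_eq_of_lt hc' hd (by exact_mod_cast h1) (by exact_mod_cast hlt)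

/-- Along a tangent, the contacts agree as soon as one of them is below 2m. If both are at least 2m,
then u ≤ 2v makes both minima equal to mu. Here the bound 2 on the slopes enters. -/
theorem min_contact_eq {b c : GermRing} {m : ℕ} {s t : Fin 2 → ℂ}
    (hb : IsTangentBranch b m s) (hb' : Irreducible b) (hc : IsTangentBranch c m t)
    (hc' : Irreducible c)
    (hsg : valueSemigroup (Ideal.span {b}) = valueSemigroup (Ideal.span {c}))
    {r₁ r₂ : Fin 2 → ℂ} (hr₁ : r₁ ≠ 0) (hr₂ : r₂ ≠ 0) (hpar : Parallel r₁ s ↔ Parallel r₂ t)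
    {u v : ℕ} (huv : u ≤ 2 * v) :
    min ((m * u : ℕ) : ℕ∞) (contact b (linForm r₁) * v) =
      min ((m * u : ℕ) : ℕ∞) (contact c (linForm r₂) * v) := by
  by_cases hp : Parallel r₁ s
  · rw [hb.contact_linForm_of_parallel hr₁ hp, hc.contact_linForm_of_parallel hr₂ (hpar.1 hp)]
    by_cases h1 : contact b (linForm s) < (2 * m : ℕ)
    · rw [hb.contact_tangent_eq hc hc' hsg h1]
    by_cases h2 : contact c (linForm t) < (2 * m : ℕ)
    · rw [hc.contact_tangent_eq hb hb' hsg.symm h2]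
    have key (N : ℕ∞) (hN : ¬ N < (2 * m : ℕ)) : ((m * u : ℕ) : ℕ∞) ≤ N * v :=
      calc ((m * u : ℕ) : ℕ∞) ≤ (2 * m : ℕ) * v := by exact_mod_cast (by nlinarith)
        _ ≤ N * v := by gcongr; exact not_lt.1 hN
    rw [min_eq_left (key _ h1), min_eq_left (key _ h2)]
  · rw [hb.transversal _ hp, hc.transversal _ fun h => hp (hpar.2 h)]

end IsTangentBranch

theorem exists_linearChange_X {s₁ s₂ : Fin 2 → ℂ} (h : ¬ Parallel s₁ s₂) :
    ∃ A : GL (Fin 2) ℂ, linearChange A (linForm s₁) = MvPowerSeries.X 0 ∧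
      linearChange A (linForm s₂) = MvPowerSeries.X 1 := by
  let S : GL (Fin 2) ℂ := Matrix.GeneralLinearGroup.mkOfDetNeZero (Matrix.of ![s₁, s₂]) (by
    rw [Matrix.det_fin_two]
    simp only [Matrix.of_apply, Matrix.cons_val_zero, Matrix.cons_val_one]
    intro h0
    exact h (by unfold Parallel; linear_combination h0))
  have h0 : linForm s₁ = linearChange S (MvPowerSeries.X 0) := by
    rw [← linForm_one_zero, linearChange_linForm]
    congr 1
    ext j
    simp [S, Matrix.vecMul, dotProduct, Fin.sum_univ_two]
  have h1 : linForm s₂ = linearChange S (MvPowerSeries.X 1) := by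
    rw [← linForm_zero_one, linearChange_linForm]
    congr 1
    ext j
    simp [S, Matrix.vecMul, dotProduct, Fin.sum_univ_two]
  refine ⟨S⁻¹, ?_, ?_⟩
  · rw [h0, linearChange_mul, mul_inv_cancel, linearChange_one]
  · rw [h1, linearChange_mul, mul_inv_cancel, linearChange_one]

theorem weightedOrder_linearChange_branch {b c : GermRing} {m : ℕ} {s t : Fin 2 → ℂ}
    (hb : IsTangentBranch b m s) (hb' : Irreducible b) (hc : IsTangentBranch c m t)
    (hc' : Irreducible c)
    (hsg : valueSemigroup (Ideal.span {b}) = valueSemigroup (Ideal.span {c}))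
    {s₁ s₂ : Fin 2 → ℂ} (hs₁ : s₁ ≠ 0) (hs₂ : s₂ ≠ 0)
    (h₁ : Parallel s₁ s ↔ Parallel ![1, 0] t) (h₂ : Parallel s₂ s ↔ Parallel ![0, 1] t)
    {A : GL (Fin 2) ℂ} (hA₁ : linearChange A (linForm s₁) = MvPowerSeries.X 0)
    (hA₂ : linearChange A (linForm s₂) = MvPowerSeries.X 1) {w : Fin 2 → ℕ}
    (hw0 : 0 < w 0) (hw1 : 0 < w 1) (hw : w 0 ≤ 2 * w 1) (hw' : w 1 ≤ 2 * w 0) :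
    (linearChange A b).weightedOrder w = c.weightedOrder w := by
  have hAb : Irreducible (linearChange A b) := (MulEquiv.irreducible_iff (linearEquiv A)).2 hb'
  obtain ⟨m', s', h'⟩ := exists_isTangentBranch hAb
  have hm : m' = m := by
    have := h'.order_eq
    rw [order_linearChange, hb.order_eq] at this
    exact_mod_cast this.symm
  subst hm
  rcases le_total (w 1) (w 0) with hle | hle
  · rw [h'.weightedOrder_eq hAb w hle hw1, hc.weightedOrder_eq hc' w hle hw1, ← linForm_one_zero]
    nth_rw 1 [linForm_one_zero]
    rw [← hA₁, contact_linearChange]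
    exact hb.min_contact_eq hb' hc hc' hsg hs₁ (fun h => by simpa using congrFun h 0) h₁ hw
  · rw [h'.weightedOrder_eq_swap hAb w hle hw0, hc.weightedOrder_eq_swap hc' w hle hw0,
      ← linForm_zero_one]
    nth_rw 1 [linForm_zero_one]
    rw [← hA₂, contact_linearChange]
    exact hb.min_contact_eq hb' hc hc' hsg hs₂ (fun h => by simpa using congrFun h 1) h₂ hw'

/-- A germ has the weighted orders of any equisingular germ, up to a linear change of
coordinates, for all weights of slope between `1 / 2` and `2`. -/
theorem Equisingular.exists_linearChange_weightedOrder {g f : GermRing} (H : Equisingular g f) :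
    ∃ A : GL (Fin 2) ℂ, ∀ w : Fin 2 → ℕ, 0 < w 0 → 0 < w 1 → w 0 ≤ 2 * w 1 → w 1 ≤ 2 * w 0 →
      (linearChange A g).weightedOrder w = f.weightedOrder w := by
  obtain ⟨hg, hf, σ, hσ, hσ'⟩ := H
  have := (finite_branches hg.ne_zero).fintype
  have := (finite_branches hf.ne_zero).fintype
  choose m t ht using fun P : branches g => exists_isTangentBranch (irreducible_branchGen P)
  choose n t' ht' using fun P : branches f => exists_isTangentBranch (irreducible_branchGen P)
  have hsg (P : branches g) : valueSemigroup (Ideal.span {branchGen P}) =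
      valueSemigroup (Ideal.span {branchGen (σ P)}) := by
    rw [span_branchGen, span_branchGen, hσ]
  have hmn (P : branches g) : m P = n (σ P) :=
    (ht P).multiplicity_eq (irreducible_branchGen P) (irreducible_branchGen _) (ht' _) (hsg P)
  have hpar (P Q : branches g) : Parallel (t P) (t Q) ↔ Parallel (t' (σ P)) (t' (σ Q)) := by
    -- Equisingularity compares the contacts of distinct branches only; for P = Q both sides hold
    -- trivially.
    rcases eq_or_ne P Q with rfl | hPQ
    · simp [Parallel, mul_comm]
    · rw [← not_iff_not]
      have h1 := (ht Q).contact_eq_mul_iff (irreducible_branchGen Q) (ht P)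
      have h2 := (ht' (σ Q)).contact_eq_mul_iff (irreducible_branchGen (σ Q)) (ht' (σ P))
      unfold Parallel
      rw [← Ne, ← Ne, ← h1, ← h2, contact, contact, span_branchGen, span_branchGen,
        span_branchGen, span_branchGen, hσ' _ _ hPQ.symm, hmn, hmn]
  obtain ⟨s₁, s₂, hs₁, hs₂, hs, H₁, H₂⟩ := exists_pair_parallel_iff t (fun P => t' (σ P))
    (fun P => (ht P).ne_zero) (fun P => (ht' _).ne_zero) hpar (r₁ := ![1, 0]) (r₂ := ![0, 1])
    (fun h => by simpa using congrFun h 0) (fun h => by simpa using congrFun h 1)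
    (by simp [Parallel])
  obtain ⟨A, hA₁, hA₂⟩ := exists_linearChange_X hs
  refine ⟨A, fun w hw0 hw1 hw hw' => ?_⟩
  rw [weightedOrder_linearChange_eq_sum hg, weightedOrder_eq_sum hf, ← Equiv.sum_comp σ]
  exact Finset.sum_congr rfl fun P _ => weightedOrder_linearChange_branch (ht P)
    (irreducible_branchGen P) (hmn P ▸ ht' (σ P)) (irreducible_branchGen _) (hsg P) hs₁ hs₂
    (H₁ P) (H₂ P) hA₁ hA₂ hw0 hw1 hw hw'

/-! ### From slopes to preliminary form. -/

theorem weightedOrder_coe_of_isNewtonSegment {f : MvPolynomial (Fin 2) ℂ} {p q : Fin 2 →₀ ℕ}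
    (h : IsNewtonSegment f p q) : (f : GermRing).weightedOrder (segmentWeight p q) =
      (Finsupp.weight (segmentWeight p q) p : ℕ) := by
  obtain ⟨hp, -, -, -, hm⟩ := h
  apply le_antisymm
  · apply MvPowerSeries.weightedOrder_le
    rw [MvPolynomial.coeff_coe]
    exact MvPolynomial.mem_support_iff.1 hp
  · refine MvPowerSeries.nat_le_weightedOrder _ fun d hd => ?_
    rw [MvPolynomial.coeff_coe]
    by_contra hne
    exact hd.not_ge (hm d (MvPolynomial.mem_support_iff.2 hne)).1

/-- A line supports the diagram exactly when it is the level of the weighted order for the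
corresponding weight. -/
theorem isPreliminaryForm_of_weightedOrder {f : MvPolynomial (Fin 2) ℂ} {h : GermRing}
    (hE : Equisingular h (f : GermRing))
    (hw : ∀ p q, IsNewtonSegment f p q → h.weightedOrder (segmentWeight p q) =
      (f : GermRing).weightedOrder (segmentWeight p q)) : IsPreliminaryForm f h := by
  refine ⟨hE, fun p q hpq => ?_⟩
  have H := hw p q hpq
  rw [weightedOrder_coe_of_isNewtonSegment hpq] at H
  constructor
  · intro m hm
    have := MvPowerSeries.weightedOrder_le (segmentWeight p q) hm
    rw [H] at this
    exact_mod_cast this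
  · obtain ⟨m, hm, hm'⟩ := MvPowerSeries.exists_coeff_ne_zero_and_weightedOrder
      (segmentWeight p q) (f := h) (MvPowerSeries.ne_zero_iff_weightedOrder_finite _ |>.1 hE.1.ne_zero)
    refine ⟨m, hm, ?_⟩
    rw [H] at hm'
    exact_mod_cast hm'

theorem isLinearSingularity_of_slopes {f : MvPolynomial (Fin 2) ℂ}
    (h : ∀ p q, IsNewtonSegment f p q → 1 / 2 ≤ segmentSlope p q ∧ segmentSlope p q ≤ 2) :
    IsLinearSingularity f := by
  intro g hg
  obtain ⟨A, hA⟩ := hg.exists_linearChange_weightedOrder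
  refine ⟨A, isPreliminaryForm_of_weightedOrder (hg.map_left (linearEquiv A)) fun p q hpq => ?_⟩
  obtain ⟨h1, h2⟩ := h p q hpq
  obtain ⟨-, -, h3, h4, -⟩ := hpq
  have h5 : (0 : ℝ) < (q 0 : ℝ) - p 0 := sub_pos.2 (by exact_mod_cast h3)
  rw [segmentSlope, le_div_iff₀ h5] at h1
  rw [segmentSlope, div_le_iff₀ h5] at h2
  have h6 : q 0 + 2 * q 1 ≤ p 0 + 2 * p 1 := by
    have : (q 0 : ℝ) + 2 * q 1 ≤ p 0 + 2 * p 1 := by linarith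
    exact_mod_cast this
  have h7 : p 1 + 2 * p 0 ≤ q 1 + 2 * q 0 := by
    have : (p 1 : ℝ) + 2 * p 0 ≤ q 1 + 2 * q 0 := by linarith
    exact_mod_cast this
  apply hA <;> simp [segmentWeight] <;> omega

/-! ### Projective coordinate changes. -/

/-- The affine form with the given coefficients. -/
noncomputable def affineForm (r : Fin 3 → ℂ) : GermRing :=
  MvPowerSeries.C (r 0) + linForm ![r 1, r 2]

theorem germAtOrigin_projectiveChange (M : GL (Fin 3) ℂ) (F : MvPolynomial (Fin 3) ℂ) :
    germAtOrigin (projectiveChange M F) =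
      MvPolynomial.aeval (fun i => affineForm ((M : Matrix (Fin 3) (Fin 3) ℂ) i)) F := by
  have h : ((MvPolynomial.coeToMvPowerSeries.algHom (R := ℂ) ℂ).comp (MvPolynomial.aeval
      (![1, MvPolynomial.X 0, MvPolynomial.X 1] : Fin 3 → MvPolynomial (Fin 2) ℂ))).comp
      (MvPolynomial.aeval (fun i => ∑ j, MvPolynomial.C ((M : Matrix (Fin 3) (Fin 3) ℂ) i j) *
        MvPolynomial.X j)) =
      MvPolynomial.aeval (fun i => affineForm ((M : Matrix (Fin 3) (Fin 3) ℂ) i)) := by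
    apply MvPolynomial.algHom_ext
    intro i
    simp [affineForm, linForm_eq, Fin.sum_univ_three, MvPolynomial.algHom_C]
    rw [add_assoc]
  exact DFunLike.congr_fun h F

theorem linearChange_aeval {σ : Type*} (A : GL (Fin 2) ℂ) (u : σ → GermRing) (F : MvPolynomial σ ℂ) :
    linearChange A (MvPolynomial.aeval u F) =
      MvPolynomial.aeval (fun i => linearChange A (u i)) F := by
  rw [linearChange_eq, ← AlgHom.comp_apply, MvPolynomial.comp_aeval]
  simp only [linearChange_eq]

/-- A linear coordinate change of the affine plane as a projective one. -/
noncomputable def projectiveExtension (A : GL (Fin 2) ℂ) : GL (Fin 3) ℂ :=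
  Matrix.GeneralLinearGroup.mkOfDetNeZero !![1, 0, 0; 0, A 0 0, A 0 1; 0, A 1 0, A 1 1] (by
    have := A.det.ne_zero
    rw [Matrix.GeneralLinearGroup.val_det_apply, Matrix.det_fin_two] at this
    simpa [Matrix.det_fin_three] using this)

theorem IsCentredAt.mul_projectiveExtension {M : GL (Fin 3) ℂ} {v : Fin 3 → ℂ}
    (h : IsCentredAt M v) (A : GL (Fin 2) ℂ) : IsCentredAt (M * projectiveExtension A) v := by
  rw [IsCentredAt] at *
  rw [Units.val_mul, ← Matrix.mulVec_mulVec, ← h]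
  congr 1
  ext i; fin_cases i <;> simp [projectiveExtension, Matrix.mulVec, dotProduct, Fin.sum_univ_three]

theorem germAtOrigin_mul_projectiveExtension (M : GL (Fin 3) ℂ) (A : GL (Fin 2) ℂ)
    (F : MvPolynomial (Fin 3) ℂ) : germAtOrigin (projectiveChange (M * projectiveExtension A) F) =
      linearChange A (germAtOrigin (projectiveChange M F)) := by
  rw [germAtOrigin_projectiveChange, germAtOrigin_projectiveChange, linearChange_aeval]
  congr 2
  funext i
  rw [affineForm, affineForm, linearChange_eq, map_add, ← linearChange_eq, ← linearChange_eq,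
    linearChange_C, linearChange_linForm]
  congr 2
  · simp [projectiveExtension, Matrix.mul_apply, Fin.sum_univ_three]
  · ext j
    fin_cases j <;>
      simp [projectiveExtension, Matrix.mul_apply, Fin.sum_univ_three, Matrix.vecMul, dotProduct]

theorem IsLinearSingularity.isLinearStratum {f : MvPolynomial (Fin 2) ℂ}
    (h : IsLinearSingularity f) (d : ℕ) : IsLinearStratum d f := by
  rintro F - v ⟨M, hM, hE⟩
  obtain ⟨A, hA⟩ := h _ hE
  refine ⟨M * projectiveExtension A, hM.mul_projectiveExtension A, ?_⟩
  rwa [germAtOrigin_mul_projectiveExtension]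

/-! ### Homogenization and restriction to lines through the point. -/

/-- The homogenization of degree `d`. -/
noncomputable def homogenize (d : ℕ) (f : MvPolynomial (Fin 2) ℂ) : MvPolynomial (Fin 3) ℂ :=
  ∑ m ∈ f.support, MvPolynomial.C (f.coeff m) * (MvPolynomial.X 0 ^ (d - (m 0 + m 1)) *
    (MvPolynomial.X 1 ^ m 0 * MvPolynomial.X 2 ^ m 1))

theorem isHomogeneous_homogenize {d : ℕ} {f : MvPolynomial (Fin 2) ℂ} (hd : f.totalDegree ≤ d) :
    (homogenize d f).IsHomogeneous d := by
  refine MvPolynomial.IsHomogeneous.sum _ _ _ fun m hm => ?_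
  have h1 : m 0 + m 1 ≤ d := by
    refine le_trans ?_ hd
    have := MvPolynomial.le_totalDegree hm
    rwa [Finsupp.sum_fintype _ _ (by simp), Fin.sum_univ_two] at this
  have h2 := ((MvPolynomial.isHomogeneous_X_pow (R := ℂ) (0 : Fin 3) (d - (m 0 + m 1))).mul
    ((MvPolynomial.isHomogeneous_X_pow (R := ℂ) (1 : Fin 3) (m 0)).mul
      (MvPolynomial.isHomogeneous_X_pow (R := ℂ) (2 : Fin 3) (m 1)))).C_mul (f.coeff m)
  rwa [Nat.sub_add_cancel h1] at h2

theorem germAtOrigin_homogenize (d : ℕ) (f : MvPolynomial (Fin 2) ℂ) :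
    germAtOrigin (homogenize d f) = f := by
  rw [germAtOrigin]
  congr 1
  conv_rhs => rw [f.as_sum]
  rw [homogenize, map_sum]
  refine Finset.sum_congr rfl fun m _ => ?_
  rw [MvPolynomial.monomial_eq, Finsupp.prod_fintype _ _ (by simp)]
  simp [Fin.prod_univ_two]

/-- The restriction of a polynomial to the line through the origin with direction `a`. -/
noncomputable def lineRestriction (f : MvPolynomial (Fin 2) ℂ) (a : Fin 2 → ℂ) : Polynomial ℂ :=
  MvPolynomial.aeval (fun i => Polynomial.C (a i) * Polynomial.X) f

theorem lineRestriction_eq_sum (f : MvPolynomial (Fin 2) ℂ) (a : Fin 2 → ℂ) :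
    lineRestriction f a = ∑ m ∈ f.support,
      Polynomial.C (f.coeff m * (a 0 ^ m 0 * a 1 ^ m 1)) * Polynomial.X ^ (m 0 + m 1) := by
  rw [lineRestriction, MvPolynomial.aeval_def, MvPolynomial.eval₂_eq']
  refine Finset.sum_congr rfl fun m _ => ?_
  simp only [Fin.prod_univ_two, mul_pow, map_mul, map_pow, pow_add, Polynomial.algebraMap_eq]
  ring

theorem restrictLine_C (c : ℂ) : restrictLine (MvPowerSeries.C c) = PowerSeries.C c := by
  ext j
  rw [coeff_restrictLine, MvPowerSeries.coeff_C, PowerSeries.coeff_C]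
  refine if_congr ?_ rfl rfl
  rw [show (0 : Fin 2 →₀ ℕ) = biexp 0 0 by simp [biexp], biexp_inj]
  simp

/-- On a line through the centre a projective change differs from a linear one by powers of 1 +
M₀ₗX, which multiply the homogeneous parts of f. These powers have constant term 1, so the lowest
nonzero coefficient of the restriction is unchanged. -/
theorem exists_coeff_ne_zero_of_lineRestriction {M : GL (Fin 3) ℂ} (hM : IsCentredAt M ![1, 0, 0])
    (d : ℕ) (f : MvPolynomial (Fin 2) ℂ) (ρ : GermRing →+* ℂ⟦X⟧) (l : Fin 3)
    (hC : ∀ c, ρ (MvPowerSeries.C c) = PowerSeries.C c)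
    (hρ : ∀ r, ρ (affineForm r) = PowerSeries.C (r 0) + PowerSeries.C (r l) * PowerSeries.X)
    {k : ℕ} (hk : (lineRestriction f ![M 1 l, M 2 l]).coeff k ≠ 0) :
    ∃ n ≤ k, PowerSeries.coeff n
      (ρ (germAtOrigin (projectiveChange M (homogenize d f)))) ≠ 0 := by
  have h00 : M 0 0 = 1 := by
    simpa [Matrix.mulVec, dotProduct, Fin.sum_univ_three] using congrFun hM 0
  have h10 : M 1 0 = 0 := by
    simpa [Matrix.mulVec, dotProduct, Fin.sum_univ_three] using congrFun hM 1
  have h20 : M 2 0 = 0 := by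
    simpa [Matrix.mulVec, dotProduct, Fin.sum_univ_three] using congrFun hM 2
  classical
  have hex : ∃ k, (lineRestriction f ![M 1 l, M 2 l]).coeff k ≠ 0 := ⟨k, hk⟩
  refine ⟨Nat.find hex, Nat.find_min' hex hk, ?_⟩
  have hn := Nat.find_spec hex
  have hlt : ∀ j < Nat.find hex, (lineRestriction f ![M 1 l, M 2 l]).coeff j = 0 := fun j hj =>
    not_not.1 (Nat.find_min hex hj)
  set n := Nat.find hex
  let U : ℂ⟦X⟧ := 1 + PowerSeries.C (M 0 l) * PowerSeries.X
  let G (j : ℕ) : ℂ := PowerSeries.coeff n (PowerSeries.X ^ j * U ^ (d - j))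
  have hG1 : G n = 1 := by
    simp only [G]
    rw [PowerSeries.coeff_X_pow_mul', if_pos le_rfl, Nat.sub_self]
    simp [U]
  have hG0 (j : ℕ) (hj : n < j) : G j = 0 := by
    simp only [G]
    rw [PowerSeries.coeff_X_pow_mul', if_neg hj.not_ge]
  have hq (j : ℕ) : (lineRestriction f ![M 1 l, M 2 l]).coeff j =
      ∑ m ∈ f.support with m 0 + m 1 = j, f.coeff m * (M 1 l ^ m 0 * M 2 l ^ m 1) := by
    rw [lineRestriction_eq_sum, Polynomial.finsetSum_coeff, Finset.sum_filter]
    refine Finset.sum_congr rfl fun m _ => ?_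
    rw [Polynomial.coeff_C_mul_X_pow]
    exact if_congr eq_comm rfl rfl
  have hsum : PowerSeries.coeff n (ρ (germAtOrigin (projectiveChange M (homogenize d f)))) =
      ∑ m ∈ f.support, f.coeff m * (M 1 l ^ m 0 * M 2 l ^ m 1) * G (m 0 + m 1) := by
    rw [germAtOrigin_projectiveChange, homogenize, map_sum, map_sum, map_sum]
    refine Finset.sum_congr rfl fun m _ => ?_
    rw [← PowerSeries.coeff_C_mul]
    congr 1
    simp only [map_mul, map_pow, MvPolynomial.aeval_C, MvPolynomial.aeval_X, hρ, h00, h10, h20]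
    change ρ (MvPowerSeries.C _) * _ = _
    rw [hC]
    simp only [map_one, map_zero, zero_add, mul_pow, pow_add, U]
    ring
  rw [hsum, ← Finset.sum_fiberwise_of_maps_to (g := fun m => m 0 + m 1)
    (t := insert n (f.support.image fun m => m 0 + m 1))
    fun m hm => Finset.mem_insert_of_mem (Finset.mem_image_of_mem _ hm),
    Finset.sum_eq_single_of_mem n (Finset.mem_insert_self _ _)]
  · rw [Finset.sum_congr rfl (g := fun m => f.coeff m * (M 1 l ^ m 0 * M 2 l ^ m 1)), ← hq]
    · exact hn
    · intro m hm
      rw [(Finset.mem_filter.1 hm).2, hG1, mul_one]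
  · intro j _ hj
    rw [Finset.sum_congr rfl (g := fun m => f.coeff m * (M 1 l ^ m 0 * M 2 l ^ m 1) * G j),
      ← Finset.sum_mul, ← hq]
    · rcases lt_or_gt_of_ne hj with h | h
      · rw [hlt j h, zero_mul]
      · rw [hG0 j h, mul_zero]
    · intro m hm
      rw [(Finset.mem_filter.1 hm).2]

theorem exists_coeff_zero_left_ne_zero {M : GL (Fin 3) ℂ} (hM : IsCentredAt M ![1, 0, 0])
    (d : ℕ) (f : MvPolynomial (Fin 2) ℂ) {k : ℕ}
    (hk : (lineRestriction f ![M 1 2, M 2 2]).coeff k ≠ 0) :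
    ∃ n ≤ k, MvPowerSeries.coeff (biexp 0 n)
      (germAtOrigin (projectiveChange M (homogenize d f))) ≠ 0 := by
  simp only [← coeff_restrictLine]
  refine exists_coeff_ne_zero_of_lineRestriction hM d f restrictLine 2 restrictLine_C (fun r => ?_) hk
  rw [affineForm, map_add, restrictLine_C, restrictLine_linForm]
  rfl

theorem germSwap_C (c : ℂ) : germSwap (MvPowerSeries.C c) = MvPowerSeries.C c :=
  (MvPowerSeries.renameEquiv ℂ (Equiv.swap (0 : Fin 2) 1)).commutes c

theorem exists_coeff_zero_right_ne_zero {M : GL (Fin 3) ℂ} (hM : IsCentredAt M ![1, 0, 0])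
    (d : ℕ) (f : MvPolynomial (Fin 2) ℂ) {k : ℕ}
    (hk : (lineRestriction f ![M 1 1, M 2 1]).coeff k ≠ 0) :
    ∃ n ≤ k, MvPowerSeries.coeff (biexp n 0)
      (germAtOrigin (projectiveChange M (homogenize d f))) ≠ 0 := by
  simp only [← coeff_germSwap _ 0, ← coeff_restrictLine]
  refine exists_coeff_ne_zero_of_lineRestriction hM d f (restrictLine.comp germSwap.toRingHom) 1
    (fun c => ?_) (fun r => ?_) hk
  · exact (congrArg restrictLine (germSwap_C c)).trans (restrictLine_C c)
  · change restrictLine (germSwap (affineForm r)) = _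
    have e : germSwap (linForm ![r 1, r 2]) = linForm ![r 2, r 1] := by
      rw [linForm_eq, map_add, map_mul, map_mul, germSwap_C, germSwap_C, germSwap_X_zero,
        germSwap_X_one, linForm_eq, add_comm]
      rfl
    rw [affineForm, map_add, map_add, germSwap_C, restrictLine_C, e, restrictLine_linForm]
    rfl

/-! ### Lowest coefficients along parametrized curves. -/

theorem coeff_aeval_X_pow_mul (w : Fin 2 → ℕ) (u : Fin 2 → Polynomial ℂ) (k : ℕ)
    (φ : MvPolynomial (Fin 2) ℂ) :
    (MvPolynomial.aeval (fun i => Polynomial.X ^ w i * u i) φ).coeff k =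
      ∑ n ∈ Finset.range (k + 1), (MvPolynomial.aeval u
        (MvPolynomial.weightedHomogeneousComponent w n φ)).coeff (k - n) := by
  induction φ using MvPolynomial.induction_on' with
  | monomial m a =>
    have h1 (n : ℕ) : MvPolynomial.weightedHomogeneousComponent w n (MvPolynomial.monomial m a) =
        if n = Finsupp.weight w m then MvPolynomial.monomial m a else 0 :=
      MvPolynomial.weightedHomogeneousComponent_of_mem
        (MvPolynomial.isWeightedHomogeneous_monomial w m a rfl)
    have h2 : MvPolynomial.aeval (fun i => Polynomial.X ^ w i * u i) (MvPolynomial.monomial m a) =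
        Polynomial.X ^ Finsupp.weight w m * MvPolynomial.aeval u (MvPolynomial.monomial m a) := by
      rw [MvPolynomial.aeval_monomial, MvPolynomial.aeval_monomial,
        Finsupp.prod_fintype _ _ (by simp), Finsupp.prod_fintype _ _ (by simp), weight_fin_two]
      simp only [Fin.prod_univ_two, mul_pow, ← pow_mul, pow_add, mul_comm (w _)]
      ring
    rw [h2, Polynomial.coeff_X_pow_mul']
    have h3 (n : ℕ) : (MvPolynomial.aeval u (MvPolynomial.weightedHomogeneousComponent w n
        (MvPolynomial.monomial m a))).coeff (k - n) = if n = Finsupp.weight w m then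
          (MvPolynomial.aeval u (MvPolynomial.monomial m a)).coeff (k - n) else 0 := by
      rw [h1]; split_ifs <;> simp
    simp only [h3, Finset.sum_ite_eq', Finset.mem_range, Nat.lt_succ_iff]
  | add p q hp hq =>
    simp only [map_add, Polynomial.coeff_add, hp, hq, Finset.sum_add_distrib]

theorem coeff_aeval_zero (u : Fin 2 → Polynomial ℂ) (φ : MvPolynomial (Fin 2) ℂ) :
    (MvPolynomial.aeval u φ).coeff 0 = MvPolynomial.eval (fun i => (u i).coeff 0) φ := by
  induction φ using MvPolynomial.induction_on with
  | C a => simp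
  | add p q hp hq => simp [hp, hq]
  | mul_X p i hp => simp [Polynomial.mul_coeff_zero, hp]

theorem coeff_aeval_one (u : Fin 2 → Polynomial ℂ) (φ : MvPolynomial (Fin 2) ℂ) :
    (MvPolynomial.aeval u φ).coeff 1 =
      ∑ j, MvPolynomial.eval (fun i => (u i).coeff 0) (MvPolynomial.pderiv j φ) * (u j).coeff 1 := by
  induction φ using MvPolynomial.induction_on with
  | C a => simp
  | add p q hp hq => simp [hp, hq, add_mul, Finset.sum_add_distrib]
  | mul_X p i hp =>
    rw [map_mul, MvPolynomial.aeval_X, Polynomial.coeff_mul, Finset.Nat.antidiagonal_succ]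
    simp [hp, coeff_aeval_zero, Fin.sum_univ_two]
    fin_cases i <;> simp <;> ring

theorem coeff_aeval_X_pow_mul_of_forall_le {w : Fin 2 → ℕ} {N : ℕ} {φ : MvPolynomial (Fin 2) ℂ}
    (hN : ∀ m ∈ φ.support, N ≤ Finsupp.weight w m) (u : Fin 2 → Polynomial ℂ) :
    (MvPolynomial.aeval (fun i => Polynomial.X ^ w i * u i) φ).coeff N =
      MvPolynomial.eval (fun i => (u i).coeff 0)
        (MvPolynomial.weightedHomogeneousComponent w N φ) := by
  rw [coeff_aeval_X_pow_mul, Finset.sum_range_succ, Finset.sum_eq_zero, zero_add, Nat.sub_self,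
    coeff_aeval_zero]
  intro n hn
  rw [MvPolynomial.weightedHomogeneousComponent_eq_zero', map_zero, Polynomial.coeff_zero]
  intro m hm
  have := hN m hm
  have := Finset.mem_range.1 hn
  omega

/-- First-order Taylor expansion: the component of least weight enters through its derivatives, the
next component through its value. -/
theorem coeff_succ_aeval_X_pow_mul_of_forall_le {w : Fin 2 → ℕ} {N : ℕ}
    {φ : MvPolynomial (Fin 2) ℂ} (hN : ∀ m ∈ φ.support, N ≤ Finsupp.weight w m)
    (u : Fin 2 → Polynomial ℂ) :
    (MvPolynomial.aeval (fun i => Polynomial.X ^ w i * u i) φ).coeff (N + 1) =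
      ∑ j, MvPolynomial.eval (fun i => (u i).coeff 0) (MvPolynomial.pderiv j
        (MvPolynomial.weightedHomogeneousComponent w N φ)) * (u j).coeff 1 +
      MvPolynomial.eval (fun i => (u i).coeff 0)
        (MvPolynomial.weightedHomogeneousComponent w (N + 1) φ) := by
  rw [coeff_aeval_X_pow_mul, Finset.sum_range_succ, Finset.sum_range_succ, Finset.sum_eq_zero,
    zero_add, Nat.sub_self, coeff_aeval_zero, Nat.add_sub_cancel_left, coeff_aeval_one]
  intro n hn
  rw [MvPolynomial.weightedHomogeneousComponent_eq_zero', map_zero, Polynomial.coeff_zero]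
  intro m hm
  have := hN m hm
  have := Finset.mem_range.1 hn
  omega

/-- A nonzero polynomial has only finitely many zeros on a coordinate line if the exponents of
its monomials are determined by their coordinates. -/
theorem finite_setOf_eval_eq_zero {φ : MvPolynomial (Fin 2) ℂ} (hφ : φ ≠ 0) (i : Fin 2)
    (hi : ∀ m ∈ φ.support, ∀ n ∈ φ.support, m i = n i → m = n) :
    {c : ℂ | MvPolynomial.eval (Function.update 1 i c) φ = 0}.Finite := by
  let p : Polynomial ℂ := ∑ m ∈ φ.support, Polynomial.monomial (m i) (φ.coeff m)
  have hp : p ≠ 0 := by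
    obtain ⟨m, hm⟩ := MvPolynomial.ne_zero_iff.1 hφ
    have hm' := MvPolynomial.mem_support_iff.2 hm
    intro h0
    apply hm
    have h1 : p.coeff (m i) = φ.coeff m := by
      rw [Polynomial.finsetSum_coeff, Finset.sum_eq_single_of_mem m hm']
      · simp
      · intro n hn hnm
        rw [Polynomial.coeff_monomial, if_neg fun h => hnm (hi n hn m hm' h)]
    rw [← h1, h0, Polynomial.coeff_zero]
  refine (p.rootSet_finite ℂ).subset fun c hc => ?_
  rw [Polynomial.mem_rootSet]
  refine ⟨hp, ?_⟩
  rw [Polynomial.coe_aeval_eq_eval, Polynomial.eval_finsetSum, ← hc, MvPolynomial.eval_eq']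
  refine Finset.sum_congr rfl fun m _ => ?_
  rw [Polynomial.eval_monomial, Finset.prod_eq_single_of_mem i (Finset.mem_univ i)]
  · simp
  · intro j _ hj
    simp [hj]

/-- For positive weights, one coordinate and the weighted degree determine the exponent, so no
cancellation occurs when the other variable is set to 1. -/
theorem finite_setOf_eval_weightedHomogeneousComponent_eq_zero {φ : MvPolynomial (Fin 2) ℂ}
    {w : Fin 2 → ℕ} (hw : ∀ i, 0 < w i) {p : Fin 2 →₀ ℕ} (hp : p ∈ φ.support) (i : Fin 2) :
    {c : ℂ | MvPolynomial.eval (Function.update 1 i c) (MvPolynomial.weightedHomogeneousComponent w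
      (Finsupp.weight w p) φ) = 0}.Finite := by
  refine finite_setOf_eval_eq_zero ?_ i fun m hm n hn hmn => ?_
  · intro h0
    have := congrArg (MvPolynomial.coeff p) h0
    rw [MvPolynomial.coeff_weightedHomogeneousComponent, if_pos rfl] at this
    exact MvPolynomial.mem_support_iff.1 hp this
  · have h := MvPolynomial.weightedHomogeneousComponent_isWeightedHomogeneous (w := w)
      (Finsupp.weight w p) φ
    have h1 := h (MvPolynomial.mem_support_iff.1 hm)
    rw [← h (MvPolynomial.mem_support_iff.1 hn), weight_fin_two, weight_fin_two] at h1
    have := hw 0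
    have := hw 1
    fin_cases i
    · have h2 : m 1 = n 1 := by
        simp only [Fin.zero_eta] at hmn
        rw [hmn] at h1
        exact Nat.eq_of_mul_eq_mul_right (hw 1) (Nat.add_left_cancel h1)
      ext j; fin_cases j
      · exact hmn
      · exact h2
    · have h2 : m 0 = n 0 := by
        simp only [Fin.mk_one] at hmn
        rw [hmn] at h1
        exact Nat.eq_of_mul_eq_mul_right (hw 0) (Nat.add_right_cancel h1)
      ext j; fin_cases j
      · exact h2
      · exact hmn

/-! ### The quadratic twist, source of the test curves. -/

/-- A quadratic shear in the direction of the first coordinate axis. -/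
noncomputable def shearVec (c : ℂ) : Fin 2 → GermRing :=
  ![MvPowerSeries.X 0 + MvPowerSeries.C c * MvPowerSeries.X 1 ^ 2, MvPowerSeries.X 1]

theorem hasSubst_shearVec (c : ℂ) : MvPowerSeries.HasSubst (shearVec c) :=
  MvPowerSeries.hasSubst_of_constantCoeff_zero fun i => by fin_cases i <;> simp [shearVec]

theorem subst_shearVec_subst_shearVec_neg (c : ℂ) (g : GermRing) :
    MvPowerSeries.substAlgHom (R := ℂ) (hasSubst_shearVec c)
      (MvPowerSeries.substAlgHom (R := ℂ) (hasSubst_shearVec (-c)) g) = g := by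
  rw [MvPowerSeries.coe_substAlgHom, MvPowerSeries.coe_substAlgHom,
    MvPowerSeries.subst_comp_subst_apply (hasSubst_shearVec _) (hasSubst_shearVec _)]
  have : (fun i => MvPowerSeries.subst (shearVec c) (shearVec (-c) i)) = MvPowerSeries.X := by
    funext i
    rw [← MvPowerSeries.coe_substAlgHom (hasSubst_shearVec c)]
    fin_cases i
    · simp only [shearVec, Fin.zero_eta, Matrix.cons_val_zero, map_add, map_mul, map_pow,
        substAlgHom_C, MvPowerSeries.substAlgHom_X, Matrix.cons_val_one, map_neg]
      ring
    · exact MvPowerSeries.substAlgHom_X (hasSubst_shearVec c) 1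
  rw [this, MvPowerSeries.subst_self]
  rfl

/-- The automorphism `x ↦ x + c * y ^ 2`, `y ↦ y`. -/
noncomputable def shear (c : ℂ) : GermRing ≃+* GermRing where
  toFun := MvPowerSeries.substAlgHom (R := ℂ) (hasSubst_shearVec c)
  invFun := MvPowerSeries.substAlgHom (R := ℂ) (hasSubst_shearVec (-c))
  left_inv g := by simpa using subst_shearVec_subst_shearVec_neg (-c) g
  right_inv g := subst_shearVec_subst_shearVec_neg c g
  map_mul' := map_mul _
  map_add' := map_add _

theorem shear_C (c a : ℂ) : shear c (MvPowerSeries.C a) = MvPowerSeries.C a :=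
  substAlgHom_C (hasSubst_shearVec c) a

theorem shear_X_zero (c : ℂ) : shear c (MvPowerSeries.X 0) =
    MvPowerSeries.X 0 + MvPowerSeries.C c * MvPowerSeries.X 1 ^ 2 :=
  MvPowerSeries.substAlgHom_X (hasSubst_shearVec c) 0

theorem shear_X_one (c : ℂ) : shear c (MvPowerSeries.X 1) = MvPowerSeries.X 1 :=
  MvPowerSeries.substAlgHom_X (hasSubst_shearVec c) 1

theorem map_coe_eq_coe_aeval (e : GermRing →+* GermRing)
    (he : ∀ c, e (MvPowerSeries.C c) = MvPowerSeries.C c) (u : Fin 2 → MvPolynomial (Fin 2) ℂ)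
    (hu : ∀ i, e (MvPowerSeries.X i) = (u i : GermRing)) (f : MvPolynomial (Fin 2) ℂ) :
    e (f : GermRing) = ((MvPolynomial.aeval u f : MvPolynomial (Fin 2) ℂ) : GermRing) := by
  induction f using MvPolynomial.induction_on with
  | C a => simp [he, MvPolynomial.algHom_C]
  | add p q hp hq => simp [hp, hq]
  | mul_X p i hp => simp [hp, hu]

/-- The polynomial `f (x + c * (y + c' * x ^ 2) ^ 2, y + c' * x ^ 2)`. -/
noncomputable def twist (c c' : ℂ) (f : MvPolynomial (Fin 2) ℂ) : MvPolynomial (Fin 2) ℂ :=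
  MvPolynomial.aeval ![MvPolynomial.X 0 + MvPolynomial.C c *
      (MvPolynomial.X 1 + MvPolynomial.C c' * MvPolynomial.X 0 ^ 2) ^ 2,
    MvPolynomial.X 1 + MvPolynomial.C c' * MvPolynomial.X 0 ^ 2] f

/-- The shear in y is the shear in x conjugated by the interchange of coordinates. -/
theorem exists_equiv_twist (c c' : ℂ) (f : MvPolynomial (Fin 2) ℂ) :
    ∃ e : GermRing ≃+* GermRing, e (f : GermRing) = (twist c c' f : GermRing) := by
  let e : GermRing ≃+* GermRing :=
    (shear c).trans ((germSwap.trans (shear c')).trans germSwap)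
  refine ⟨e, map_coe_eq_coe_aeval e.toRingHom (fun a => ?_) _ (fun i => ?_) f⟩
  · simp [e, shear_C, germSwap_C]
  · fin_cases i <;> simp [e, shear_C, germSwap_C, shear_X_zero, shear_X_one, germSwap_X_zero,
      germSwap_X_one]

theorem equisingular_twist (c c' : ℂ) {f : MvPolynomial (Fin 2) ℂ}
    (hf : Squarefree (f : GermRing)) : Equisingular (twist c c' f : GermRing) (f : GermRing) := by
  obtain ⟨e, he⟩ := exists_equiv_twist c c' f
  rw [← he]
  exact (Equisingular.refl hf).map_left e

theorem lineRestriction_twist (c c' : ℂ) (f : MvPolynomial (Fin 2) ℂ) (a : Fin 2 → ℂ) :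
    lineRestriction (twist c c' f) a = MvPolynomial.aeval
      ![Polynomial.C (a 0) * Polynomial.X + Polynomial.C c *
          (Polynomial.C (a 1) * Polynomial.X + Polynomial.C (c' * a 0 ^ 2) * Polynomial.X ^ 2) ^ 2,
        Polynomial.C (a 1) * Polynomial.X + Polynomial.C (c' * a 0 ^ 2) * Polynomial.X ^ 2] f := by
  rw [lineRestriction, twist, ← AlgHom.comp_apply, MvPolynomial.comp_aeval]
  congr 2
  funext i
  fin_cases i
  · simp [mul_pow]; left; ring
  · simp [mul_pow]; ring

/-! ### Supporting weights, Newton segments and non-degeneracy. -/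

/-- The leftmost and rightmost minimizers of w span a segment, and w is proportional to its
`segmentWeight`. Statements on segments thus become available for every positive weight with two
minimizers. -/
theorem exists_isNewtonSegment {f : MvPolynomial (Fin 2) ℂ} {w : Fin 2 → ℕ} (hw : ∀ i, 0 < w i)
    {p q : Fin 2 →₀ ℕ} (hp : p ∈ f.support) (hq : q ∈ f.support) (hpq : p ≠ q)
    (hmin : ∀ m ∈ f.support, Finsupp.weight w p ≤ Finsupp.weight w m)
    (heq : Finsupp.weight w q = Finsupp.weight w p) :
    ∃ p' q' : Fin 2 →₀ ℕ, IsNewtonSegment f p' q' ∧ ∀ m : Fin 2 →₀ ℕ,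
      (Finsupp.weight (segmentWeight p' q') p' ≤ Finsupp.weight (segmentWeight p' q') m ↔
        Finsupp.weight w p ≤ Finsupp.weight w m) ∧
      (Finsupp.weight (segmentWeight p' q') m = Finsupp.weight (segmentWeight p' q') p' ↔
        Finsupp.weight w m = Finsupp.weight w p) := by
  set T := f.support.filter fun m => Finsupp.weight w m = Finsupp.weight w p
  have hpT : p ∈ T := Finset.mem_filter.2 ⟨hp, rfl⟩
  have hqT : q ∈ T := Finset.mem_filter.2 ⟨hq, heq⟩
  obtain ⟨p', hp', hpmin⟩ := T.exists_min_image (fun m => m 0) ⟨p, hpT⟩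
  obtain ⟨q', hq', hqmax⟩ := T.exists_max_image (fun m => m 0) ⟨p, hpT⟩
  have hw0 := hw 0
  have hw1 := hw 1
  have hne : p 0 ≠ q 0 := by
    intro h0
    rw [weight_fin_two, weight_fin_two, h0] at heq
    refine hpq (Finsupp.ext fun i => ?_)
    fin_cases i
    · exact h0
    · exact (Nat.eq_of_mul_eq_mul_right hw1 (Nat.add_left_cancel heq)).symm
  have hlt : p' 0 < q' 0 := by
    have := hpmin p hpT
    have := hpmin q hqT
    have := hqmax p hpT
    have := hqmax q hqT
    omega
  obtain ⟨hp'f, hp'w⟩ := Finset.mem_filter.1 hp'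
  obtain ⟨hq'f, hq'w⟩ := Finset.mem_filter.1 hq'
  have hpw : p' 0 * w 0 + p' 1 * w 1 = q' 0 * w 0 + q' 1 * w 1 := by
    rw [← weight_fin_two, ← weight_fin_two, hp'w, hq'w]
  have hlt' : q' 1 < p' 1 := by
    by_contra h
    have h1 := Nat.mul_le_mul_right (w 1) (not_lt.1 h)
    have h2 := Nat.mul_lt_mul_of_pos_right hlt hw0
    omega
  have hprop : (p' 1 - q' 1) * w 1 = (q' 0 - p' 0) * w 0 := by
    zify [hlt.le, hlt'.le] at hpw ⊢
    linear_combination hpw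
  have key (m : Fin 2 →₀ ℕ) : Finsupp.weight (segmentWeight p' q') m * w 1 =
      (q' 0 - p' 0) * Finsupp.weight w m := by
    rw [weight_fin_two, weight_fin_two]
    simp only [segmentWeight, Matrix.cons_val_zero, Matrix.cons_val_one]
    linear_combination m 0 * hprop
  have hpos : 0 < q' 0 - p' 0 := Nat.sub_pos_of_lt hlt
  have hle (m : Fin 2 →₀ ℕ) :
      Finsupp.weight (segmentWeight p' q') p' ≤ Finsupp.weight (segmentWeight p' q') m ↔
        Finsupp.weight w p ≤ Finsupp.weight w m := by
    rw [← Nat.mul_le_mul_right_iff hw1, key, key, Nat.mul_le_mul_left_iff hpos, hp'w]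
  have heq' (m : Fin 2 →₀ ℕ) :
      Finsupp.weight (segmentWeight p' q') m = Finsupp.weight (segmentWeight p' q') p' ↔
        Finsupp.weight w m = Finsupp.weight w p := by
    rw [← Nat.mul_left_inj hw1.ne', key, key, Nat.mul_right_inj hpos.ne', hp'w]
  refine ⟨p', q', ⟨hp'f, hq'f, hlt, hlt', fun m hm => ⟨(hle m).2 (hmin m hm), fun h => ?_⟩⟩,
    fun m => ⟨hle m, heq' m⟩⟩
  have hmT : m ∈ T := Finset.mem_filter.2 ⟨hm, (heq' m).1 h⟩
  exact ⟨hpmin m hmT, hqmax m hmT⟩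

/-- A form of lowest degree with a zero in the torus is not a monomial, so it is the truncation to a
segment of slope 1. By Euler's relation the vanishing of one partial derivative at the zero would
force that of the other. -/
theorem NewtonNondegenerate.eval_pderiv_ne_zero {f : MvPolynomial (Fin 2) ℂ}
    (hf : NewtonNondegenerate f) {p : Fin 2 →₀ ℕ} (hp : p ∈ f.support)
    (hmin : ∀ m ∈ f.support, Finsupp.weight (1 : Fin 2 → ℕ) p ≤ Finsupp.weight (1 : Fin 2 → ℕ) m) {z : Fin 2 → ℂ}
    (hz : ∀ i, z i ≠ 0) (h0 : MvPolynomial.eval z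
      (MvPolynomial.weightedHomogeneousComponent 1 (Finsupp.weight (1 : Fin 2 → ℕ) p) f) = 0) :
    MvPolynomial.eval z (MvPolynomial.pderiv 1
      (MvPolynomial.weightedHomogeneousComponent 1 (Finsupp.weight (1 : Fin 2 → ℕ) p) f)) ≠ 0 := by
  intro h1
  set φ := MvPolynomial.weightedHomogeneousComponent 1 (Finsupp.weight (1 : Fin 2 → ℕ) p) f with hφ
  obtain ⟨q, hq, hqp, hqw⟩ : ∃ q ∈ f.support, p ≠ q ∧ Finsupp.weight (1 : Fin 2 → ℕ) q = Finsupp.weight (1 : Fin 2 → ℕ) p := by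
    by_contra! hcon
    have : φ = MvPolynomial.monomial p (f.coeff p) := by
      ext d
      rw [MvPolynomial.coeff_weightedHomogeneousComponent, MvPolynomial.coeff_monomial]
      rcases eq_or_ne p d with rfl | hd
      · simp
      · rw [if_neg hd]
        split_ifs with hw
        · by_contra hne
          exact hcon d (MvPolynomial.mem_support_iff.2 hne) hd hw
        · rfl
    rw [this, MvPolynomial.eval_monomial, Finsupp.prod_fintype _ _ (by simp), mul_eq_zero,
      Finset.prod_eq_zero_iff] at h0
    rcases h0 with h0 | ⟨i, -, hi⟩
    · exact MvPolynomial.mem_support_iff.1 hp h0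
    · exact hz i (eq_zero_of_pow_eq_zero hi)
  obtain ⟨p', q', hseg, hw⟩ := exists_isNewtonSegment (w := 1) (by simp) hp hq hqp hmin hqw
  have htr : segmentTruncation f p' q' = φ := by
    ext d
    rw [segmentTruncation, MvPolynomial.coeff_weightedHomogeneousComponent, hφ,
      MvPolynomial.coeff_weightedHomogeneousComponent]
    exact if_congr (hw d).2 rfl rfl
  have hE := (MvPolynomial.weightedHomogeneousComponent_isWeightedHomogeneous (w := 1)
    (Finsupp.weight (1 : Fin 2 → ℕ) p) f).sum_weight_X_mul_pderiv
  have hE' := congrArg (MvPolynomial.eval z) hE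
  rw [← hφ] at hE'
  simp only [Fin.sum_univ_two, map_add, nsmul_eq_mul, map_mul, MvPolynomial.eval_X, h1, h0, mul_zero, add_zero,
    Pi.one_apply, Nat.cast_one, one_mul, map_natCast] at hE'
  refine hf p' q' hseg ⟨z, hz 0, hz 1, by rw [htr, h0], fun i => ?_⟩
  rw [htr]
  fin_cases i
  · exact (mul_eq_zero.1 hE').resolve_left (hz 0)
  · exact h1

theorem coeff_lineRestriction_smul (f : MvPolynomial (Fin 2) ℂ) (s : ℂ) (a : Fin 2 → ℂ) (k : ℕ) :
    (lineRestriction f (s • a)).coeff k = s ^ k * (lineRestriction f a).coeff k := by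
  rw [lineRestriction_eq_sum, lineRestriction_eq_sum, Polynomial.finsetSum_coeff,
    Polynomial.finsetSum_coeff, Finset.mul_sum]
  refine Finset.sum_congr rfl fun m _ => ?_
  rw [Polynomial.coeff_C_mul_X_pow, Polynomial.coeff_C_mul_X_pow]
  split_ifs with h
  · rw [h, Pi.smul_apply, Pi.smul_apply, smul_eq_mul, smul_eq_mul, mul_pow, mul_pow, pow_add]
    ring
  · rw [mul_zero]

/-! ### Restrictions of the twist to lines, and the choice of its parameters. -/

section twist

variable {f : MvPolynomial (Fin 2) ℂ} {N : ℕ} (c c' : ℂ)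

theorem coeff_lineRestriction_twist_fst (hN : ∀ m ∈ f.support, N ≤ Finsupp.weight ![1, 2] m) :
    (lineRestriction (twist c c' f) ![1, 0]).coeff N = MvPolynomial.eval (Function.update 1 1 c')
      (MvPolynomial.weightedHomogeneousComponent ![1, 2] N f) := by
  -- On the x-axis the twist is f(X + c c'² X⁴, c' X²), a curve of weights (1, 2).
  have h := coeff_aeval_X_pow_mul_of_forall_le hN
    ![1 + Polynomial.C (c * c' ^ 2) * Polynomial.X ^ 3, Polynomial.C c']
  rw [lineRestriction_twist]
  convert h using 3
  · congr 1
    funext i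
    fin_cases i
    · simp; ring
    · simp
  · funext i
    fin_cases i <;> simp

theorem coeff_lineRestriction_twist_snd (hN : ∀ m ∈ f.support, N ≤ Finsupp.weight ![2, 1] m) :
    (lineRestriction (twist c c' f) ![0, 1]).coeff N = MvPolynomial.eval (Function.update 1 0 c)
      (MvPolynomial.weightedHomogeneousComponent ![2, 1] N f) := by
  -- On the y-axis the twist is f(c X², X), a curve of weights (2, 1).
  have h := coeff_aeval_X_pow_mul_of_forall_le hN ![Polynomial.C c, 1]
  rw [lineRestriction_twist]
  convert h using 3
  · congr 1
    funext i
    fin_cases i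
    · simp
    · simp
  · funext i
    fin_cases i <;> simp

theorem coeff_lineRestriction_twist (hN : ∀ m ∈ f.support, N ≤ Finsupp.weight (1 : Fin 2 → ℕ) m) (b : ℂ) :
    (lineRestriction (twist c c' f) ![1, b]).coeff N = MvPolynomial.eval (Function.update 1 1 b)
      (MvPolynomial.weightedHomogeneousComponent 1 N f) ∧
    (lineRestriction (twist c c' f) ![1, b]).coeff (N + 1) =
      MvPolynomial.eval (Function.update 1 1 b) (MvPolynomial.pderiv 0
        (MvPolynomial.weightedHomogeneousComponent 1 N f)) * (c * b ^ 2) +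
      MvPolynomial.eval (Function.update 1 1 b) (MvPolynomial.pderiv 1
        (MvPolynomial.weightedHomogeneousComponent 1 N f)) * c' +
      MvPolynomial.eval (Function.update 1 1 b)
        (MvPolynomial.weightedHomogeneousComponent 1 (N + 1) f) := by
  let u : Fin 2 → Polynomial ℂ :=
    ![1 + Polynomial.C c * (Polynomial.C b + Polynomial.C c' * Polynomial.X) ^ 2 * Polynomial.X,
      Polynomial.C b + Polynomial.C c' * Polynomial.X]
  have hu : (fun i => (u i).coeff 0) = Function.update (1 : Fin 2 → ℂ) 1 b := by
    funext i
    fin_cases i <;> simp [u]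
  have hu0 : (u 0).coeff 1 = c * b ^ 2 := by
    simp [u, Polynomial.coeff_one, Polynomial.coeff_zero_eq_eval_zero]
  have hu1 : (u 1).coeff 1 = c' := by simp [u, Polynomial.coeff_C]
  have hL : lineRestriction (twist c c' f) ![1, b] =
      MvPolynomial.aeval (fun i => Polynomial.X ^ (1 : Fin 2 → ℕ) i * u i) f := by
    rw [lineRestriction_twist]
    congr 2
    funext i
    fin_cases i
    · simp [u]; ring
    · simp [u]; ring
  rw [hL, coeff_aeval_X_pow_mul_of_forall_le hN, coeff_succ_aeval_X_pow_mul_of_forall_le hN, hu,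
    Fin.sum_univ_two, hu0, hu1]
  exact ⟨rfl, rfl⟩

end twist

theorem exists_twist_coeff_lineRestriction_ne_zero {f : MvPolynomial (Fin 2) ℂ}
    (hf : NewtonNondegenerate f) {p₁ p₂ p : Fin 2 →₀ ℕ} (hp₁ : p₁ ∈ f.support)
    (hp₂ : p₂ ∈ f.support) (hp : p ∈ f.support)
    (hmin₁ : ∀ m ∈ f.support, Finsupp.weight ![1, 2] p₁ ≤ Finsupp.weight ![1, 2] m)
    (hmin₂ : ∀ m ∈ f.support, Finsupp.weight ![2, 1] p₂ ≤ Finsupp.weight ![2, 1] m)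
    (hmin : ∀ m ∈ f.support,
      Finsupp.weight (1 : Fin 2 → ℕ) p ≤ Finsupp.weight (1 : Fin 2 → ℕ) m) :
    ∃ c c' : ℂ, ∀ a : Fin 2 → ℂ, a ≠ 0 →
      (a 1 = 0 → (lineRestriction (twist c c' f) a).coeff (Finsupp.weight ![1, 2] p₁) ≠ 0) ∧
      (a 0 = 0 → (lineRestriction (twist c c' f) a).coeff (Finsupp.weight ![2, 1] p₂) ≠ 0) ∧
      (a 0 ≠ 0 → a 1 ≠ 0 → ∃ k ≤ Finsupp.weight (1 : Fin 2 → ℕ) p + 1,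
        (lineRestriction (twist c c' f) a).coeff k ≠ 0) := by
  obtain ⟨c, hc⟩ := (finite_setOf_eval_weightedHomogeneousComponent_eq_zero
    (w := ![2, 1]) (by simp [Fin.forall_fin_two]) hp₂ 0).exists_notMem
  set N := Finsupp.weight (1 : Fin 2 → ℕ) p with hN
  set φ := MvPolynomial.weightedHomogeneousComponent (1 : Fin 2 → ℕ) N f with hφ
  have hroots : {b : ℂ | MvPolynomial.eval (Function.update 1 1 b) φ = 0}.Finite :=
    finite_setOf_eval_weightedHomogeneousComponent_eq_zero (by simp) hp 1
  have hbad : (⋃ b ∈ {b : ℂ | MvPolynomial.eval (Function.update 1 1 b) φ = 0},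
      {c' : ℂ | b ≠ 0 ∧ MvPolynomial.eval (Function.update 1 1 b) (MvPolynomial.pderiv 0 φ) * (c * b ^ 2) +
        MvPolynomial.eval (Function.update 1 1 b) (MvPolynomial.pderiv 1 φ) * c' +
        MvPolynomial.eval (Function.update 1 1 b)
          (MvPolynomial.weightedHomogeneousComponent (1 : Fin 2 → ℕ) (N + 1) f) = 0}).Finite := by
    -- For a zero b ≠ 0 of the tangent cone, the coefficient of degree N + 1 is affine in c' with
    -- nonzero slope, by non-degeneracy; at most one c' makes it vanish.
    refine hroots.biUnion fun b hb => Set.Subsingleton.finite ?_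
    rintro x ⟨hb0, hx⟩ y ⟨-, hy⟩
    have hne := hf.eval_pderiv_ne_zero hp hmin (z := Function.update 1 1 b)
      (by simpa [Fin.forall_fin_two] using hb0) hb
    refine mul_left_cancel₀ hne ?_
    linear_combination hx - hy
  obtain ⟨c', hc'⟩ := ((finite_setOf_eval_weightedHomogeneousComponent_eq_zero
    (w := ![1, 2]) (by simp [Fin.forall_fin_two]) hp₁ 1).union hbad).exists_notMem
  rw [Set.mem_union, not_or] at hc'
  refine ⟨c, c', fun a ha => ⟨fun h1 => ?_, fun h0 => ?_, fun h0 h1 => ?_⟩⟩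
  · have h0 : a 0 ≠ 0 := fun h0 => ha (by ext i; fin_cases i <;> assumption)
    have e : a = a 0 • ![1, 0] := by ext i; fin_cases i <;> simp [h1]
    rw [e, coeff_lineRestriction_smul, coeff_lineRestriction_twist_fst c c' hmin₁]
    exact mul_ne_zero (pow_ne_zero _ h0) hc'.1
  · have h1 : a 1 ≠ 0 := fun h1 => ha (by ext i; fin_cases i <;> assumption)
    have e : a = a 1 • ![0, 1] := by ext i; fin_cases i <;> simp [h0]
    rw [e, coeff_lineRestriction_smul, coeff_lineRestriction_twist_snd c c' hmin₂]
    exact mul_ne_zero (pow_ne_zero _ h1) hc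
  · have e : a = a 0 • ![1, a 1 / a 0] := by
      ext i; fin_cases i
      · simp
      · simp; field_simp
    obtain ⟨e0, e1⟩ := coeff_lineRestriction_twist c c' hmin (a 1 / a 0)
    by_cases hb : MvPolynomial.eval (Function.update 1 1 (a 1 / a 0)) φ = 0
    · refine ⟨N + 1, le_rfl, ?_⟩
      rw [e, coeff_lineRestriction_smul, e1]
      refine mul_ne_zero (pow_ne_zero _ h0) fun hz => hc'.2 ?_
      exact Set.mem_biUnion (x := a 1 / a 0) hb ⟨div_ne_zero h1 h0, hz⟩
    · refine ⟨N, Nat.le_succ N, ?_⟩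
      rw [e, coeff_lineRestriction_smul, e0]
      exact mul_ne_zero (pow_ne_zero _ h0) hb

/-! ### The combinatorics of supporting lines and slopes. -/

/-- Let `A`, `B`, `o` be the smallest values of `x + 2 * y`, `2 * x + y`, `x + y` on a finite set
whose supporting lines lie below the points `(n₁, 0)` and `(0, n₂)`. If `n₁` and `n₂` are subject
to the bounds `hn`, then no segment of its Newton diagram has slope less than `1 / 2`. -/
theorem le_two_mul_of_supporting {ι : Type*} (S : Finset ι) (x y : ι → ℕ) {A B o n₁ n₂ : ℕ}
    (hA : ∀ m ∈ S, A ≤ x m + 2 * y m) (hA' : ∃ m ∈ S, x m + 2 * y m = A)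
    (hB : ∀ m ∈ S, B ≤ 2 * x m + y m) (ho : ∀ m ∈ S, o ≤ x m + y m)
    (ho' : ∃ m ∈ S, x m + y m = o) (hx : ∃ m ∈ S, x m ≤ 1)
    (H : ∀ u v, 0 < u → 0 < v → ∀ p ∈ S, ∀ q ∈ S, x p < x q → y q < y p →
      (∀ m ∈ S, u * x p + v * y p ≤ u * x m + v * y m) →
      u * x q + v * y q = u * x p + v * y p →
      u * x p + v * y p ≤ u * n₁ ∧ u * x p + v * y p ≤ v * n₂)
    (hn : (n₁ ≤ A ∨ n₁ ≤ o + 1) ∨ n₁ ≤ B ∧ (n₂ ≤ A ∨ n₂ ≤ o + 1))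
    {u v : ℕ} (hu : 0 < u) (hv : 0 < v) {p q : ι} (hp : p ∈ S) (hq : q ∈ S) (hxpq : x p < x q)
    (hypq : y q < y p) (hmin : ∀ m ∈ S, u * x p + v * y p ≤ u * x m + v * y m)
    (heq : u * x q + v * y q = u * x p + v * y p) : v ≤ 2 * u := by
  by_contra! hlt
  have h1 := (H u v hu hv p hp q hq hxpq hypq hmin heq).1
  -- A segment flatter than 1/2 meets the horizontal axis beyond A, and n₁ lies at or beyond that
  -- intercept.
  have hAn : A < n₁ := by
    have h2 := hA p hp
    refine lt_of_mul_lt_mul_left (lt_of_lt_of_le ?_ h1) (Nat.zero_le u)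
    calc u * A ≤ u * (x p + 2 * y p) := Nat.mul_le_mul_left u h2
      _ = u * x p + 2 * u * y p := by ring
      _ < u * x p + v * y p := by
        have := Nat.mul_lt_mul_of_pos_right hlt (lt_of_le_of_lt (Nat.zero_le _) hypq)
        omega
  -- Otherwise a point attaining A would lie on the horizontal axis, below the supporting line. With
  -- A < n₁ this leaves only the alternative n₁ ≤ B and n₂ ≤ A.
  have hoA : o + 1 ≤ A := by
    obtain ⟨r, hr, hrA⟩ := hA'
    have h2 := ho r hr
    by_contra! h3
    have hy0 : y r = 0 := by omega
    have h4 := hmin r hr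
    have h5 : u * x p + v * y p ≤ u * A := by rw [← hrA, hy0]; rw [hy0] at h4; simpa using h4
    have h6 := hA p hp
    have h7 := Nat.mul_lt_mul_of_pos_right hlt (lt_of_le_of_lt (Nat.zero_le _) hypq)
    have h8 := Nat.mul_le_mul_left u h6
    have h9 : u * (x p + 2 * y p) = u * x p + 2 * u * y p := by ring
    omega
  have hn₁ : n₁ ≤ B := by omega
  have hn₂ : n₂ ≤ A := by omega
  obtain ⟨r, hr, hr1⟩ := hx
  -- The upper end s of the diagram: leftmost, then lowest. It has x s ≤ 1.
  obtain ⟨s, hs, hsmin⟩ := S.exists_min_image (fun m => toLex (x m, y m)) ⟨r, hr⟩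
  have hsx (m) (hm : m ∈ S) : x s ≤ x m := by
    have := hsmin m hm
    rw [Prod.Lex.toLex_le_toLex] at this
    rcases this with h | h
    · exact h.le
    · exact h.1.le
  have hsy (m) (hm : m ∈ S) (h : x m = x s) : y s ≤ y m := by
    have := hsmin m hm
    rw [Prod.Lex.toLex_le_toLex] at this
    rcases this with h' | h'
    · exact absurd h.symm h'.ne
    · exact h'.2
  have hs1 : x s ≤ 1 := (hsx r hr).trans hr1
  have hBs := hB s hs
  by_cases hdeg : ∃ m ∈ S, x m + y m < x s + y s
  · obtain ⟨m, hm, hms⟩ := hdeg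
    have hxm : x s < x m := by
      rcases (hsx m hm).lt_or_eq with h | h
      · exact h
      · have := hsy m hm h.symm
        omega
    -- The steepest descent from s is a supporting segment. Its slope j/i exceeds 1 because some
    -- point has smaller degree than s.
    obtain ⟨t, ht, htmax⟩ := (S.filter fun m => x s < x m).exists_max_image
      (fun m => ((y s : ℚ) - y m) / ((x m : ℚ) - x s)) ⟨m, Finset.mem_filter.2 ⟨hm, hxm⟩⟩
    obtain ⟨htS, hxt⟩ := Finset.mem_filter.1 ht
    have hpos (k : ι) (hk : x s < x k) : (0 : ℚ) < (x k : ℚ) - x s :=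
      sub_pos.2 (by exact_mod_cast hk)
    have hslope : (1 : ℚ) < ((y s : ℚ) - y t) / ((x t : ℚ) - x s) := by
      refine lt_of_lt_of_le ?_ (htmax m (Finset.mem_filter.2 ⟨hm, hxm⟩))
      rw [lt_div_iff₀ (hpos m hxm)]
      have : (x m : ℚ) + y m < x s + y s := by exact_mod_cast hms
      linarith
    rw [lt_div_iff₀ (hpos t hxt)] at hslope
    have hst : x t + y t < x s + y s := by
      have : (x t : ℚ) + y t < x s + y s := by linarith
      exact_mod_cast this
    obtain ⟨i, hi⟩ : ∃ i, x t = x s + i := ⟨x t - x s, by omega⟩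
    obtain ⟨j, hj⟩ : ∃ j, y s = y t + j := ⟨y s - y t, by omega⟩
    have hij : i < j := by omega
    have hi0 : 0 < i := by omega
    have hsupp (k) (hk : k ∈ S) : j * x s + i * y s ≤ j * x k + i * y k := by
      rcases (hsx k hk).lt_or_eq with h | h
      · have h2 := htmax k (Finset.mem_filter.2 ⟨hk, h⟩)
        rw [div_le_div_iff₀ (hpos k h) (hpos t hxt), hi, hj] at h2
        push_cast at h2
        have h3 : (j : ℚ) * x s + i * y s ≤ j * x k + i * y k := by
          rw [hj]; push_cast; linarith
        exact_mod_cast h3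
      · have := Nat.mul_le_mul_left i (hsy k hk h.symm)
        rw [h]; omega
    have h2 := (H j i (by omega) hi0 s hs t htS hxt (by omega) hsupp (by rw [hi, hj]; ring)).2
    -- For x s = 1 the inequality i < j improves the intercept bound by one. Then B ≤ 2 x s + y s ≤
    -- n₂ ≤ A < n₁ ≤ B, which is absurd.
    have h3 : 2 * x s + y s ≤ n₂ := by
      rcases Nat.le_one_iff_eq_zero_or_eq_one.1 hs1 with h | h
      · rw [h] at h2 ⊢
        simpa using Nat.le_of_mul_le_mul_left (by simpa using h2) hi0
      · rw [h] at h2 ⊢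
        have : i * (1 + y s) < i * n₂ := by
          refine lt_of_lt_of_le ?_ h2
          rw [mul_add]; omega
        have := lt_of_mul_lt_mul_left this (Nat.zero_le i)
        omega
    omega
  -- Now s has the least degree o, so B ≤ 2 x s + y s ≤ o + 1 ≤ A < n₁ ≤ B, again absurd.
  · push Not at hdeg
    obtain ⟨m, hm, hmo⟩ := ho'
    have := hdeg m hm
    omega

/-- Otherwise the square of a coordinate would divide the reduced germ. -/
theorem exists_support_le_one {f : MvPolynomial (Fin 2) ℂ} (hf : Squarefree (f : GermRing))
    (i : Fin 2) : ∃ m ∈ f.support, m i ≤ 1 := by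
  by_contra! h
  have h1 : (MvPowerSeries.X i * MvPowerSeries.X i : GermRing) ∣ f := by
    rw [← pow_two, MvPowerSeries.X_pow_dvd_iff]
    intro m hm
    rw [MvPolynomial.coeff_coe]
    by_contra hne
    have := h m (MvPolynomial.mem_support_iff.2 hne)
    omega
  have h2 := MvPowerSeries.isUnit_iff_constantCoeff.1 (hf _ h1)
  simp at h2

theorem IsPreliminaryForm.weight_le {f : MvPolynomial (Fin 2) ℂ} {h : GermRing}
    (H : IsPreliminaryForm f h) {w : Fin 2 → ℕ} (hw : ∀ i, 0 < w i)
    {p q : Fin 2 →₀ ℕ} (hp : p ∈ f.support) (hq : q ∈ f.support) (hpq : p ≠ q)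
    (hmin : ∀ m ∈ f.support, Finsupp.weight w p ≤ Finsupp.weight w m)
    (heq : Finsupp.weight w q = Finsupp.weight w p) {m : Fin 2 →₀ ℕ}
    (hm : MvPowerSeries.coeff m h ≠ 0) : Finsupp.weight w p ≤ Finsupp.weight w m := by
  obtain ⟨p', q', hseg, hiff⟩ := exists_isNewtonSegment hw hp hq hpq hmin heq
  exact (hiff m).1.1 ((H.2 p' q' hseg).1 m hm)

theorem IsPreliminaryForm.slopes {f : MvPolynomial (Fin 2) ℂ} (hf : Squarefree (f : GermRing))
    {h : GermRing} (H : IsPreliminaryForm f h) {p₁ p₂ r : Fin 2 →₀ ℕ} (hp₁ : p₁ ∈ f.support)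
    (hp₂ : p₂ ∈ f.support) (hr : r ∈ f.support)
    (hmin₁ : ∀ m ∈ f.support, p₁ 0 + 2 * p₁ 1 ≤ m 0 + 2 * m 1)
    (hmin₂ : ∀ m ∈ f.support, 2 * p₂ 0 + p₂ 1 ≤ 2 * m 0 + m 1)
    (hmin : ∀ m ∈ f.support, r 0 + r 1 ≤ m 0 + m 1) {n₁ n₂ : ℕ}
    (hc₁ : MvPowerSeries.coeff (biexp n₁ 0) h ≠ 0) (hc₂ : MvPowerSeries.coeff (biexp 0 n₂) h ≠ 0)
    (hn : (n₁ ≤ p₁ 0 + 2 * p₁ 1 ∨ n₁ ≤ r 0 + r 1 + 1) ∨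
      n₁ ≤ 2 * p₂ 0 + p₂ 1 ∧ (n₂ ≤ p₁ 0 + 2 * p₁ 1 ∨ n₂ ≤ r 0 + r 1 + 1))
    (hn' : (n₂ ≤ 2 * p₂ 0 + p₂ 1 ∨ n₂ ≤ r 0 + r 1 + 1) ∨
      n₂ ≤ p₁ 0 + 2 * p₁ 1 ∧ (n₁ ≤ 2 * p₂ 0 + p₂ 1 ∨ n₁ ≤ r 0 + r 1 + 1)) :
    ∀ p q, IsNewtonSegment f p q → 1 / 2 ≤ segmentSlope p q ∧ segmentSlope p q ≤ 2 := by
  have key (u v : ℕ) (hu : 0 < u) (hv : 0 < v) (p q : Fin 2 →₀ ℕ) (hp : p ∈ f.support)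
      (hq : q ∈ f.support) (hpq : p ≠ q)
      (hmin : ∀ m ∈ f.support, u * p 0 + v * p 1 ≤ u * m 0 + v * m 1)
      (heq : u * q 0 + v * q 1 = u * p 0 + v * p 1) :
      u * p 0 + v * p 1 ≤ u * n₁ ∧ u * p 0 + v * p 1 ≤ v * n₂ := by
    have hw (m : Fin 2 →₀ ℕ) : Finsupp.weight ![u, v] m = u * m 0 + v * m 1 := by
      rw [weight_fin_two]; simp [mul_comm]
    have K (m : Fin 2 →₀ ℕ) := H.weight_le (w := ![u, v]) (by simp [Fin.forall_fin_two, hu, hv])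
      hp hq hpq (by simpa only [hw] using hmin) (by simpa only [hw] using heq) (m := m)
    simp only [hw] at K
    exact ⟨by simpa using K _ hc₁, by simpa using K _ hc₂⟩
  rintro p q ⟨hp, hq, h0, h1, hseg⟩
  have hsw (m : Fin 2 →₀ ℕ) : Finsupp.weight (segmentWeight p q) m =
      (p 1 - q 1) * m 0 + (q 0 - p 0) * m 1 := by
    rw [weight_fin_two]; simp [segmentWeight, mul_comm]
  simp only [hsw] at hseg
  have heq : (p 1 - q 1) * q 0 + (q 0 - p 0) * q 1 = (p 1 - q 1) * p 0 + (q 0 - p 0) * p 1 := by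
    zify [h0.le, h1.le]; ring
  have hs1 : q 0 - p 0 ≤ 2 * (p 1 - q 1) := by
    refine le_two_mul_of_supporting f.support (fun m => m 0) (fun m => m 1)
      (A := p₁ 0 + 2 * p₁ 1) (B := 2 * p₂ 0 + p₂ 1) (o := r 0 + r 1) (n₁ := n₁) (n₂ := n₂)
      (fun m hm => by have := hmin₁ m hm; omega) ⟨p₁, hp₁, rfl⟩
      (fun m hm => by have := hmin₂ m hm; omega) hmin ⟨r, hr, rfl⟩
      (exists_support_le_one hf 0) ?_ hn (Nat.sub_pos_of_lt h1) (Nat.sub_pos_of_lt h0)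
      hp hq h0 h1 (fun m hm => (hseg m hm).1) heq
    · intro u v hu hv p hp q hq hx _
      exact key u v hu hv p q hp hq fun h => hx.ne (by rw [h])
  -- The upper bound is the lower bound with the coordinates interchanged, which swaps A with B and
  -- n₁ with n₂.
  have hs2 : p 1 - q 1 ≤ 2 * (q 0 - p 0) := by
    refine le_two_mul_of_supporting f.support (fun m => m 1) (fun m => m 0)
      (A := 2 * p₂ 0 + p₂ 1) (B := p₁ 0 + 2 * p₁ 1) (o := r 0 + r 1) (n₁ := n₂) (n₂ := n₁)
      (fun m hm => by have := hmin₂ m hm; omega) ⟨p₂, hp₂, by omega⟩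
      (fun m hm => by have := hmin₁ m hm; omega) (fun m hm => by have := hmin m hm; omega)
      ⟨r, hr, by omega⟩
      (exists_support_le_one hf 1) ?_ hn' (Nat.sub_pos_of_lt h0) (Nat.sub_pos_of_lt h1)
      hq hp h1 h0 (fun m hm => by have := (hseg m hm).1; omega) (by omega)
    · intro u v hu hv p hp q hq hx _ hmin heq
      have := key v u hv hu p q hp hq (fun h => hx.ne (by rw [h]))
        (fun m hm => by have := hmin m hm; omega) (by omega)
      omega
  have h5 : (0 : ℝ) < (q 0 : ℝ) - p 0 := sub_pos.2 (by exact_mod_cast h0)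
  rw [segmentSlope, le_div_iff₀ h5, div_le_iff₀ h5]
  have h6 : (q 0 : ℝ) + 2 * q 1 ≤ p 0 + 2 * p 1 := by
    exact_mod_cast (by omega : q 0 + 2 * q 1 ≤ p 0 + 2 * p 1)
  have h7 : (p 1 : ℝ) + 2 * p 0 ≤ q 1 + 2 * q 0 := by
    exact_mod_cast (by omega : p 1 + 2 * p 0 ≤ q 1 + 2 * q 0)
  constructor <;> linarith

/-! ### The test curve and the equivalence. -/

theorem slopes_of_isLinearStratum {f : MvPolynomial (Fin 2) ℂ}
    (hf : IsNewtonNondegenerateNormalForm f) :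
    ∃ d₀ : ℕ, ∀ d : ℕ, d₀ ≤ d → IsLinearStratum d f →
      ∀ p q, IsNewtonSegment f p q → 1 / 2 ≤ segmentSlope p q ∧ segmentSlope p q ≤ 2 := by
  obtain ⟨m₀, hm₀, -⟩ := exists_support_le_one hf.reduced 0
  obtain ⟨p₁, hp₁, hmin₁⟩ := f.support.exists_min_image (Finsupp.weight ![1, 2]) ⟨m₀, hm₀⟩
  obtain ⟨p₂, hp₂, hmin₂⟩ := f.support.exists_min_image (Finsupp.weight ![2, 1]) ⟨m₀, hm₀⟩
  obtain ⟨r, hr, hmin⟩ := f.support.exists_min_image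
    (Finsupp.weight (1 : Fin 2 → ℕ)) ⟨m₀, hm₀⟩
  obtain ⟨c, c', hcc⟩ := exists_twist_coeff_lineRestriction_ne_zero hf.nondegenerate hp₁ hp₂ hr
    hmin₁ hmin₂ hmin
  -- From this degree on the twist can be homogenized to a form of degree d.
  refine ⟨(twist c c' f).totalDegree, fun d hd hlin => ?_⟩
  have hne : homogenize d (twist c c' f) ≠ 0 := by
    intro h0
    have h1 := germAtOrigin_homogenize d (twist c c' f)
    rw [h0, germAtOrigin, map_zero] at h1
    exact (equisingular_twist c c' hf.reduced).1.ne_zero (by rw [← h1]; simp)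
  have hat : HasSingularityTypeAt f (homogenize d (twist c c' f)) ![1, 0, 0] := by
    refine ⟨1, by simp [IsCentredAt], ?_⟩
    have : projectiveChange 1 (homogenize d (twist c c' f)) = homogenize d (twist c c' f) := by
      rw [projectiveChange]
      convert MvPolynomial.aeval_X_left_apply _ using 3
      simp [Matrix.one_apply]
    rw [this, germAtOrigin_homogenize]
    exact equisingular_twist c c' hf.reduced
  obtain ⟨M, hM, hpre⟩ := hlin _ ⟨isHomogeneous_homogenize hd, hne, _, hat⟩ _ hat
  set h := germAtOrigin (projectiveChange M (homogenize d (twist c c' f)))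
  have hdet : M 1 1 * M 2 2 - M 1 2 * M 2 1 ≠ 0 := by
    have h10 : M 1 0 = 0 := by
      simpa [Matrix.mulVec, dotProduct, Fin.sum_univ_three] using congrFun hM 1
    have h20 : M 2 0 = 0 := by
      simpa [Matrix.mulVec, dotProduct, Fin.sum_univ_three] using congrFun hM 2
    have h1 := M.det.ne_zero
    rw [Matrix.GeneralLinearGroup.val_det_apply, Matrix.det_fin_three] at h1
    intro h0
    apply h1
    rw [h10, h20]
    linear_combination M 0 0 * h0
  have hbound (a : Fin 2 → ℂ) (ha : a ≠ 0) :
      ∃ k, (lineRestriction (twist c c' f) a).coeff k ≠ 0 ∧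
        (a 1 = 0 → k ≤ p₁ 0 + 2 * p₁ 1) ∧ (a 0 = 0 → k ≤ 2 * p₂ 0 + p₂ 1) ∧
        (a 0 ≠ 0 → a 1 ≠ 0 → k ≤ r 0 + r 1 + 1) := by
    obtain ⟨h1, h2, h3⟩ := hcc a ha
    simp only [weight_fin_two, Matrix.cons_val_zero, Matrix.cons_val_one, Pi.one_apply,
      mul_one] at h1 h2 h3
    by_cases ha1 : a 1 = 0
    · have ha0 : a 0 ≠ 0 := fun ha0 => ha (by ext i; fin_cases i <;> assumption)
      exact ⟨_, h1 ha1, fun _ => by omega, fun h => absurd h ha0, fun _ h => absurd ha1 h⟩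
    · by_cases ha0 : a 0 = 0
      · exact ⟨_, h2 ha0, fun h => absurd h ha1, fun _ => by omega, fun h => absurd ha0 h⟩
      · obtain ⟨k, hk, hk'⟩ := h3 ha0 ha1
        exact ⟨k, hk', fun h => absurd h ha1, fun h => absurd h ha0, fun _ _ => hk⟩
  obtain ⟨k₁, hk₁, hk₁A, hk₁B, hk₁o⟩ := hbound ![M 1 1, M 2 1] fun h0 => hdet (by
    have h1 : M 1 1 = 0 := congrFun h0 0
    have h2 : M 2 1 = 0 := congrFun h0 1
    rw [h1, h2]; ring)
  obtain ⟨k₂, hk₂, hk₂A, hk₂B, hk₂o⟩ := hbound ![M 1 2, M 2 2] fun h0 => hdet (by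
    have h1 : M 1 2 = 0 := congrFun h0 0
    have h2 : M 2 2 = 0 := congrFun h0 1
    rw [h1, h2]; ring)
  obtain ⟨n₁, hn₁, hc₁⟩ := exists_coeff_zero_right_ne_zero hM d _ hk₁
  obtain ⟨n₂, hn₂, hc₂⟩ := exists_coeff_zero_left_ne_zero hM d _ hk₂
  simp only [Matrix.cons_val_zero, Matrix.cons_val_one] at hk₁A hk₁B hk₁o hk₂A hk₂B hk₂o
  -- The bounds depend on whether the image of each coordinate axis is the x-axis, the y-axis or
  -- neither. As the two images are distinct lines, at most one of them is the y-axis, and likewise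
  -- for the x-axis.
  have hor (P Q : Prop) : (P ∨ Q) ∨ (¬ P ∧ ¬ Q) := by
    rw [← not_or]; exact em _
  have hex₁ : ¬ (M 1 1 = 0 ∧ M 1 2 = 0) := fun ⟨h1, h2⟩ => hdet (by rw [h1, h2]; ring)
  have hex₂ : ¬ (M 2 1 = 0 ∧ M 2 2 = 0) := fun ⟨h1, h2⟩ => hdet (by rw [h1, h2]; ring)
  refine hpre.slopes hf.reduced hp₁ hp₂ hr (fun m hm => ?_) (fun m hm => ?_) (fun m hm => ?_)
    hc₁ hc₂ ?_ ?_
  · simpa [weight_fin_two, mul_comm] using hmin₁ m hm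
  · simpa [weight_fin_two, mul_comm] using hmin₂ m hm
  · simpa [weight_fin_two] using hmin m hm
  · rcases hor (M 1 1 = 0) (M 2 1 = 0) with (h | h) | ⟨h, h'⟩
    · refine Or.inr ⟨hn₁.trans (hk₁B h), ?_⟩
      have h2 : M 1 2 ≠ 0 := fun h2 => hex₁ ⟨h, h2⟩
      by_cases h3 : M 2 2 = 0
      · exact Or.inl (hn₂.trans (hk₂A h3))
      · exact Or.inr (hn₂.trans (hk₂o h2 h3))
    · exact Or.inl (Or.inl (hn₁.trans (hk₁A h)))
    · exact Or.inl (Or.inr (hn₁.trans (hk₁o h h')))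
  · rcases hor (M 1 2 = 0) (M 2 2 = 0) with (h | h) | ⟨h, h'⟩
    · exact Or.inl (Or.inl (hn₂.trans (hk₂B h)))
    · refine Or.inr ⟨hn₂.trans (hk₂A h), ?_⟩
      have h2 : M 2 1 ≠ 0 := fun h2 => hex₂ ⟨h2, h⟩
      by_cases h3 : M 1 1 = 0
      · exact Or.inl (hn₁.trans (hk₁B h3))
      · exact Or.inr (hn₁.trans (hk₁o h3 h2))
    · exact Or.inl (Or.inr (hn₂.trans (hk₂o h h')))

theorem mainTheorem8 (f : MvPolynomial (Fin 2) ℂ) (hf : IsNewtonNondegenerateNormalForm f) :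
    ∃ d₀ : ℕ, ∀ d : ℕ, d₀ ≤ d →
      (IsLinearStratum d f ↔
        ∀ p q, IsNewtonSegment f p q → 1 / 2 ≤ segmentSlope p q ∧ segmentSlope p q ≤ 2) ∧
      (IsLinearStratum d f ↔ IsLinearSingularity f) := by
  obtain ⟨d₀, hd₀⟩ := slopes_of_isLinearStratum hf
  refine ⟨d₀, fun d hd => ⟨⟨hd₀ d hd, fun h => (isLinearSingularity_of_slopes h).isLinearStratum d⟩,
    ⟨fun h => isLinearSingularity_of_slopes (hd₀ d hd h), fun h => h.isLinearStratum d⟩⟩⟩
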